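/- Let $n\ge 2$, let $I\subseteq\mathbb R$ be a nonempty open interval, $\mathcal F=C^\infty(I,\mathbb R)$, and let $\mathcal D_x=\mathcal F[\partial_x]$ be the ring of linear ordinary differential operators over $\mathcal F$. A curve $\gamma=(\gamma_1,\dots,\gamma_n)\in\mathcal F^{1\times n}$ is star-shaped if the matrix $W(\gamma)$ with rows $\gamma,\gamma^{(1)},\dots,\gamma^{(n-1)}$ is invertible at every point of $I$; $\mathcal M$ is the set of orbits $[\gamma]=\{\gamma g: g\in GL_n(\mathbb R)\}$ of star-shaped curves. The curvature $u=\varphi[\gamma]\in\mathcal F^{1\times n}$ is defined by $\gamma^{(n)}=-\sum_{k<n}u_k\gamma^{(k)}$, and $L_{[\gamma]}=\partial_x^n+\sum_{k<n}u_k\partial_x^k$. For an open interval $I'\ni 0$, a family $[\gamma](t)\in\mathcal M$ $(t\in I')$ with $[\gamma](0)=[\gamma]$ is an admissible deformation of $[\gamma]$ if it has representatives $\gamma(t)$ that are smooth in $(t,x)$. The tangent space $T_{[\gamma]}\mathcal M$ is the set of admissible deformations of $[\gamma]$ modulo equality of $\partial_t\varphi([\gamma](t))|_{t=0}$. A curve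 of tangent vectors at $[\gamma]$ is smooth if it is represented by deformations $t\mapsto[\gamma(s,t)]$ with $\gamma$ smooth in $(s,t,x)$. Put $\mathcal F_{x,t}=C^\infty(I\times I')$. For $X\in\mathcal D_x$ and $h\in\mathcal F^{1\times n}$, the equation $L_{[\gamma]}(X([\gamma]))=-h$ means $L_{[\gamma]}(X(\gamma_j))=-\sum_{k<n}h_k\gamma_j^{(k)}$ for all $j$ and all $\gamma\in[\gamma]$. Let $[\gamma]\in\mathcal M$. (1) $T_{[\gamma]}\mathcal M$ has an $\mathcal F$-module structure for which $[\gamma](t)\mapsto\partial_t\varphi([\gamma](t))|_{t=0}$ induces an isomorphism of $\mathcal F$-modules $T_{[\gamma]}\mathcal M\cong\mathcal F^{1\times n}$; it is smooth in both directions (smooth curves correspond to smooth curves). Let $\mathcal E=\{q\in\mathcal D_x/\mathcal D_xL_{[\gamma]}: L_{[\gamma]}\cdot q=0\}$ (the kernel of the tangent vector mapping). There is an isomorphism of real vector spaces $\Phi$ from the quotient of the cyclic left module $\mathcal D_x/\mathcal D_xL_{[\gamma]}$ by $\mathcal E$ onto $T_{[\gamma]}\mathcal M$, which sends the class of $X$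 to the class of every deformation having smooth representatives $\gamma(t)$ with $\partial_t\gamma|_{t=0}=X(\gamma(0))$; such a deformation exists for every $X\in\mathcal D_x$. (2) For every $h\in\mathcal F^{1\times n}$ there is $X\in\mathcal D_x$ with $L_{[\gamma]}(X([\gamma]))=-h$. If $X$ is one solution, then $Y$ is another if and only if $L_{[\gamma]}((X-Y)([\gamma]))=0$; the class of $X$ lies in $\mathcal E$ if and only if $L_{[\gamma]}(X([\gamma]))=0$. Moreover $L_{[\gamma]}(X([\gamma]))=-h$ holds if and only if $h$ is the image of the class of $X$ under the composite of $\Phi$ and the isomorphism $T_{[\gamma]}\mathcal M\cong\mathcal F^{1\times n}$ of (1). (3) A family $[\gamma](t)\in\mathcal M$, $t\in I'$, with $[\gamma](0)=[\gamma]$ is an admissible deformation if and only if it has representatives $\gamma(t)$ which are $C^1$ in $t$ (as a map from $I'$ to $C^\infty(I,\mathbb R^n)$) and there is $X\in\mathcal F_{x,t}[\partial_x]$ such that for all such representatives, all $t\in I'$ and all $y(t)$ in the real span of the components of $\gamma(t)$, $$L_{[\gamma](t)}\big((\tfrac{\partial}{\partial t}-X(t))(y(t))\big)=0 .$$ (4)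 Let $[\gamma](t)$, $t\in I'$, be an admissible deformation of $[\gamma]$ with curvature $u(t)$, and $L=L_{[\gamma](t)}$. Let $L^{1/n}=\partial_x+\cdots$ denote the monic formal pseudo-differential $n$-th root of $L$ and $A_+$ the differential part of $A$. We say that a family $B(t)$ of differential operators is an $n$-KdV operator if $B=\sum_{k=0}^m c_k(t)(L^{k/n})_+$ with smooth functions $c_k$ of $t$ alone, and an $n$-KdV operator up to rescaling if $B=f+\sum_{k=0}^m c_k(t)(L^{k/n})_+$ with, in addition, $f\in\mathcal F_{x,t}$; the curvature satisfies the corresponding equation of the $n$-KdV hierarchy (up to rescaling) if $\partial_tL=[B,L]$. Let $P=\sum_{i<N}P_i\lambda^i$ with $P_i\in\mathcal F_{x,t}[\partial_x]$, let $S\subseteq\mathbb R$ be infinite, and for $s\in S$ let $\lambda_s\in C^\infty(I')$, $\lambda_s(0)=s$, be such that the centro-affine curves defined by $L_{[\gamma](t)}\psi=\lambda_s(t)\psi$ form an admissible deformation for which the equation of (3) holds with $X(t)=P(t,\lambda_s(t))$. Put $P(L)=\sum_{i<N} P_iL^i$. Then $\partial_t\lambda_s\equiv0$ for all $s\in S$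 if and only if $P(L)$ is an $n$-KdV operator up to rescaling and $\partial_tL=[P(L),L]$. Also, $\partial_t\lambda_s\equiv0$ for all $s\in S$ and $\partial_tu_{n-1}\equiv0$ if and only if $P(L)$ is an $n$-KdV operator and $\partial_tL=[P(L),L]$. Call $[\gamma](t)$ isospectral if a $P$ as above exists for $S=\mathbb R$ and $\lambda_s(t)\equiv s$. Then $[\gamma](t)$ is isospectral if and only if $u(t)$ satisfies an equation of the $n$-KdV hierarchy up to rescaling; and it is isospectral with $\partial_tu_{n-1}\equiv0$ if and only if $u(t)$ satisfies an equation of the $n$-KdV hierarchy. -/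

import Mathlib

open TopologicalSpace
open scoped ContDiff

noncomputable section

namespace StarShaped

/-! ### Smooth functions on an open set `I ⊆ ℝ` and differential operators -/

/-- Extension by zero of a function on `I` to the real line. -/
def ext {I : Opens ℝ} (f : I → ℝ) (x : ℝ) : ℝ :=
  open Classical in if h : x ∈ I then f ⟨x, h⟩ else 0

theorem ext_coe {I : Opens ℝ} (f : I → ℝ) (x : I) : ext f x = f x := by
  simp [ext]

theorem ext_of_mem {I : Opens ℝ} (f : I → ℝ) {x : ℝ} (h : x ∈ I) : ext f x = f ⟨x, h⟩ := by
  simp [ext, h]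

/-- The smooth functions, as a subalgebra of all functions `I → ℝ`. -/
def smoothSub (I : Opens ℝ) : Subalgebra ℝ (I → ℝ) where
  carrier := {f | ContDiffOn ℝ ∞ (ext f) I}
  mul_mem' {f g} hf hg := by
    refine (ContDiffOn.mul hf hg).congr fun x hx => ?_
    simp [ext_of_mem _ (show x ∈ I from hx)]
  add_mem' {f g} hf hg := by
    refine (ContDiffOn.add hf hg).congr fun x hx => ?_
    simp [ext_of_mem _ (show x ∈ I from hx)]
  algebraMap_mem' r := by
    refine (contDiffOn_const (c := r)).congr fun x hx => ?_
    simp [ext_of_mem _ (show x ∈ I from hx)]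

/-- The algebra `𝓕 = C^∞(I, ℝ)`. -/
def Sm (I : Opens ℝ) : Type := smoothSub I

instance (I : Opens ℝ) : CommRing (Sm I) := inferInstanceAs (CommRing (smoothSub I))

instance (I : Opens ℝ) : Algebra ℝ (Sm I) := inferInstanceAs (Algebra ℝ (smoothSub I))

theorem Sm.add_val {I : Opens ℝ} (f g : Sm I) : (f + g).1 = f.1 + g.1 := rfl

theorem Sm.smul_val {I : Opens ℝ} (r : ℝ) (f : Sm I) : (r • f).1 = r • f.1 := rfl

theorem differentiableAt_ext {I : Opens ℝ} (f : Sm I) (x : I) :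
    DifferentiableAt ℝ (ext f.1) x :=
  ((show ContDiffOn ℝ ∞ (ext f.1) I from f.2).contDiffAt (I.isOpen.mem_nhds x.2)).differentiableAt
    (by simp)

theorem ext_eventuallyEq {I : Opens ℝ} {F : ℝ → ℝ} {f : I → ℝ} (h : ∀ x : I, f x = F x) (x : I) :
    ext f =ᶠ[nhds (x : ℝ)] F := by
  filter_upwards [I.isOpen.mem_nhds x.2] with y hy
  rw [ext_of_mem f hy, h]

/-- The derivative `∂ₓ : 𝓕 → 𝓕`. -/
def D (I : Opens ℝ) : Module.End ℝ (Sm I) where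
  toFun f := ⟨fun x => deriv (ext f.1) x, by
    have hf : ContDiffOn ℝ ∞ (ext f.1) I := f.2
    refine (hf.deriv_of_isOpen I.isOpen (m := ∞) (by simp)).congr fun x hx => ?_
    rw [ext_of_mem _ (show x ∈ I from hx)]⟩
  map_add' f g := by
    refine Subtype.ext (funext fun x => ?_)
    have h : ext (f + g).1 =ᶠ[nhds (x : ℝ)] ext f.1 + ext g.1 :=
      ext_eventuallyEq (fun y => by simp [ext_coe, Sm.add_val]) x
    refine h.deriv_eq.trans ?_
    exact deriv_add (differentiableAt_ext f x) (differentiableAt_ext g x)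
  map_smul' r f := by
    refine Subtype.ext (funext fun x => ?_)
    have h : ext (r • f).1 =ᶠ[nhds (x : ℝ)] r • ext f.1 :=
      ext_eventuallyEq (fun y => by simp [ext_coe, Sm.smul_val]) x
    refine h.deriv_eq.trans ?_
    exact deriv_const_smul r (differentiableAt_ext f x)

/-- Multiplication by a smooth function, as an operator on `𝓕`. -/
abbrev mulOp {I : Opens ℝ} (a : Sm I) : Module.End ℝ (Sm I) := LinearMap.mulLeft ℝ a

/-- The algebra of operators on `𝓕` generated by `∂ₓ` and the multiplications by elements of `𝓕`. -/
def diffOps (I : Opens ℝ) : Subalgebra ℝ (Module.End ℝ (Sm I)) :=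
  Algebra.adjoin ℝ (insert (D I) (Set.range (mulOp (I := I))))

theorem D_mem (I : Opens ℝ) : D I ∈ diffOps I :=
  Algebra.subset_adjoin (Set.mem_insert _ _)

theorem mulOp_mem {I : Opens ℝ} (a : Sm I) : mulOp a ∈ diffOps I :=
  Algebra.subset_adjoin (Set.mem_insert_of_mem _ ⟨a, rfl⟩)

/-- The ring `𝓓ₓ = 𝓕[∂ₓ]` of linear ordinary differential operators with coefficients in `𝓕`. -/
def DOp (I : Opens ℝ) : Type := diffOps I

instance (I : Opens ℝ) : Ring (DOp I) := inferInstanceAs (Ring (diffOps I))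

instance (I : Opens ℝ) : Algebra ℝ (DOp I) := inferInstanceAs (Algebra ℝ (diffOps I))

/-- The operator `∂ₓⁿ + u_{n-1} ∂ₓ^{n-1} + ⋯ + u₁ ∂ₓ + u₀`. -/
def opL {n : ℕ} {I : Opens ℝ} (u : Fin n → Sm I) : DOp I :=
  ⟨D I ^ n + ∑ k : Fin n, mulOp (u k) * D I ^ (k : ℕ),
    add_mem (pow_mem (D_mem I) n)
      (sum_mem fun k _ => mul_mem (mulOp_mem (u k)) (pow_mem (D_mem I) _))⟩

/-- The operator `∑_{k<n} h_k ∂ₓᵏ`. -/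
def opLow {n : ℕ} {I : Opens ℝ} (h : Fin n → Sm I) : DOp I :=
  ⟨∑ k : Fin n, mulOp (h k) * D I ^ (k : ℕ),
    sum_mem fun k _ => mul_mem (mulOp_mem (h k)) (pow_mem (D_mem I) _)⟩

/-! ### Star-shaped curves and centro-affine curves -/

/-- The matrix `W(γ)` with rows `γ, γ⁽¹⁾, …, γ⁽ⁿ⁻¹⁾`. -/
def W {n : ℕ} {I : Opens ℝ} (γ : Fin n → Sm I) : Matrix (Fin n) (Fin n) (Sm I) :=
  Matrix.of fun i j => (D I ^ (i : ℕ)) (γ j)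

/-- Star-shaped curves in `ℝ^{1×n}` over `I`. -/
def StarCurve (n : ℕ) (I : Opens ℝ) : Type :=
  {γ : Fin n → Sm I // ∀ x : I, (Matrix.of fun i j => (W γ i j).1 x).det ≠ 0}

/-- The curve `g · γ = γ g`. -/
def rightMul {n : ℕ} {I : Opens ℝ} (γ : Fin n → Sm I) (g : Matrix (Fin n) (Fin n) ℝ) :
    Fin n → Sm I :=
  fun j => ∑ i, g i j • γ i

theorem rightMul_rightMul {n : ℕ} {I : Opens ℝ} (γ : Fin n → Sm I)
    (g h : Matrix (Fin n) (Fin n) ℝ) :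
    rightMul (rightMul γ g) h = rightMul γ (g * h) := by
  funext j
  simp only [rightMul, Matrix.mul_apply, Finset.sum_smul, Finset.smul_sum, smul_smul]
  rw [Finset.sum_comm]
  simp only [mul_comm]

theorem rightMul_one {n : ℕ} {I : Opens ℝ} (γ : Fin n → Sm I) : rightMul γ 1 = γ := by
  funext j
  simp [rightMul, Matrix.one_apply]

/-- Two star-shaped curves are equivalent if they lie in the same `GLₙ(ℝ)`-orbit. -/
instance starSetoid (n : ℕ) (I : Opens ℝ) : Setoid (StarCurve n I) where
  r γ γ' := ∃ g : GL (Fin n) ℝ, γ'.1 = rightMul γ.1 g.1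
  iseqv :=
    { refl := fun γ => ⟨1, by simp [rightMul_one]⟩
      symm := fun {γ γ'} ⟨g, hg⟩ => ⟨g⁻¹, by
        rw [hg, rightMul_rightMul, ← Units.val_mul, mul_inv_cancel, Units.val_one, rightMul_one]⟩
      trans := fun {γ γ' γ''} ⟨g, hg⟩ ⟨h, hh⟩ => ⟨g * h, by
        rw [hh, hg, rightMul_rightMul, Units.val_mul]⟩ }

/-- The space `𝓜` of centro-affine curves. -/
def CentroAffine (n : ℕ) (I : Opens ℝ) : Type := Quotient (starSetoid n I)

/-- The centro-affine curve `[γ]`. -/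
def StarCurve.cls {n : ℕ} {I : Opens ℝ} (γ : StarCurve n I) : CentroAffine n I :=
  Quotient.mk (starSetoid n I) γ

/-- The solution `u` of `γ⁽ⁿ⁾ = - ∑ u_k γ⁽ᵏ⁾`, namely `u = - γ⁽ⁿ⁾ W(γ)⁻¹`. -/
def curv {n : ℕ} {I : Opens ℝ} (γ : Fin n → Sm I) : Fin n → Sm I :=
  - Matrix.vecMul (fun j => (D I ^ n) (γ j)) (W γ)⁻¹

theorem pow_rightMul {n : ℕ} {I : Opens ℝ} (γ : Fin n → Sm I) (g : Matrix (Fin n) (Fin n) ℝ)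
    (m : ℕ) (j : Fin n) :
    (D I ^ m) (rightMul γ g j) = ∑ i, (D I ^ m) (γ i) * algebraMap ℝ (Sm I) (g i j) := by
  simp only [rightMul, map_sum, map_smul]
  exact Finset.sum_congr rfl fun i _ => by rw [Algebra.smul_def, mul_comm]

theorem curv_rightMul {n : ℕ} {I : Opens ℝ} (γ : Fin n → Sm I) (g : GL (Fin n) ℝ) :
    curv (rightMul γ g.1) = curv γ := by
  have hW : W (rightMul γ g.1) = W γ * g.1.map (algebraMap ℝ (Sm I)) := by
    ext i j : 2
    simp only [W, Matrix.of_apply, Matrix.mul_apply, Matrix.map_apply, pow_rightMul]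
  have hv : (fun j => (D I ^ n) (rightMul γ g.1 j)) =
      Matrix.vecMul (fun j => (D I ^ n) (γ j)) (g.1.map (algebraMap ℝ (Sm I))) := by
    funext j
    simp only [pow_rightMul, Matrix.vecMul, dotProduct, Matrix.map_apply]
  have hu : IsUnit (g.1.map (algebraMap ℝ (Sm I))).det := by
    have := (Matrix.isUnit_iff_isUnit_det _).1 g.isUnit
    have h2 := this.map (algebraMap ℝ (Sm I))
    rwa [RingHom.map_det] at h2
  rw [curv, curv, hW, hv, Matrix.mul_inv_rev, Matrix.vecMul_vecMul, ← Matrix.mul_assoc,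
    Matrix.mul_nonsing_inv _ hu, Matrix.one_mul]

/-- The centro-affine curvature `φ : 𝓜 → 𝓕ⁿ`. -/
def curvature {n : ℕ} {I : Opens ℝ} (c : CentroAffine n I) : Fin n → Sm I :=
  Quotient.lift (fun γ : StarCurve n I => curv γ.1)
    (fun γ γ' (h : ∃ g : GL (Fin n) ℝ, γ'.1 = rightMul γ.1 g.1) => by
      obtain ⟨g, hg⟩ := h
      rw [hg, curv_rightMul]) c

/-- The operator `L_[γ]`. -/
def Lop {n : ℕ} {I : Opens ℝ} (c : CentroAffine n I) : DOp I := opL (curvature c)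

/-! ### Families depending on a parameter `t` -/

/-- `f(t, x)` is smooth on `J × I`, that is, `f ∈ 𝓕_{x,t}`. -/
def JointSmooth {I : Opens ℝ} (J : Opens ℝ) (f : ℝ → Sm I) : Prop :=
  ContDiffOn ℝ ∞ (fun p : ℝ × ℝ => ext (f p.1).1 p.2) ((J : Set ℝ) ×ˢ (I : Set ℝ))

/-- `f` is a `C¹` map from `J` to the Fréchet space `C^∞(I)`, with derivative `f'`. -/
def HasC1Deriv {I : Opens ℝ} (J : Opens ℝ) (f f' : ℝ → Sm I) : Prop :=
  ∀ k : ℕ,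
    (∀ t ∈ J, ∀ x : I,
      HasDerivAt (fun s => ((D I ^ k) (f s)).1 x) (((D I ^ k) (f' t)).1 x) t) ∧
    ContinuousOn (fun p : ℝ × ℝ => ext ((D I ^ k) (f' p.1)).1 p.2) ((J : Set ℝ) ×ˢ (I : Set ℝ))

/-- `X(t) = ∑_{k<N} a_k(t) ∂ₓᵏ` with `a_k ∈ 𝓕_{x,t}`, that is, `X ∈ 𝓕_{x,t}[∂ₓ]`. -/
def SmoothOp {I : Opens ℝ} (J : Opens ℝ) (X : ℝ → DOp I) : Prop :=
  ∃ (N : ℕ) (a : ℕ → ℝ → Sm I), (∀ k, JointSmooth J (a k)) ∧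
    ∀ t ∈ J, (X t).1 = ∑ k ∈ Finset.range N, mulOp (a k t) * D I ^ k

/-- `γ(t)` is a family of star-shaped curves with `γ(t) ∈ c(t)`, smooth in `(t, x)`. -/
def IsSmoothLift {n : ℕ} {I : Opens ℝ} (J : Opens ℝ) (c : ℝ → CentroAffine n I)
    (γ : ℝ → StarCurve n I) : Prop :=
  (∀ j, JointSmooth J fun t => (γ t).1 j) ∧ ∀ t ∈ J, (γ t).cls = c t

/-- The family `c(t)`, `t ∈ J`, of centro-affine curves is smooth. -/
def IsAdmissible {n : ℕ} {I : Opens ℝ} (J : Opens ℝ) (c : ℝ → CentroAffine n I) : Prop :=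
  ∃ γ : ℝ → StarCurve n I, IsSmoothLift J c γ

/-- `γ(t) ∈ c(t)` is a family of star-shaped curves that is continuously differentiable in `t`,
with derivative `γ'`. -/
def IsC1Lift {n : ℕ} {I : Opens ℝ} (J : Opens ℝ) (c : ℝ → CentroAffine n I)
    (γ : ℝ → StarCurve n I) (γ' : ℝ → Fin n → Sm I) : Prop :=
  (∀ j, HasC1Deriv J (fun t => (γ t).1 j) fun t => γ' t j) ∧ ∀ t ∈ J, (γ t).cls = c t

/-- `L_{c(t)} ((∂ₜ - X(t)) y(t)) = 0` for all `t ∈ J` and all `y(t)` in the real span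
of the components of any `t`-differentiable representative `γ(t)` of `c(t)`. -/
def IsEvolutionOp {n : ℕ} {I : Opens ℝ} (J : Opens ℝ) (c : ℝ → CentroAffine n I)
    (X : ℝ → DOp I) : Prop :=
  ∀ γ γ', IsC1Lift J c γ γ' → ∀ a : Fin n → ℝ, ∀ t ∈ J,
    (Lop (c t)).1 ((∑ j, a j • γ' t j) - (X t).1 (∑ j, a j • (γ t).1 j)) = 0

/-! ### The tangent space -/

/-- Admissible deformations of the centro-affine curve `c₀`. -/
structure Deformation {n : ℕ} {I : Opens ℝ} (c₀ : CentroAffine n I) where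
  J : Opens ℝ
  zero_mem : (0 : ℝ) ∈ J
  ordConnected : (J : Set ℝ).OrdConnected
  path : ℝ → CentroAffine n I
  base : path 0 = c₀
  admissible : IsAdmissible J path

/-- The derivative of the curvature at `t = 0`. -/
def Deformation.vel {n : ℕ} {I : Opens ℝ} {c₀ : CentroAffine n I} (Γ : Deformation c₀) :
    Fin n → I → ℝ :=
  fun k x => deriv (fun t => (curvature (Γ.path t) k).1 x) 0

/-- The deformation has a representative `γ(t)` with `∂γ/∂t = X(γ)` at `t = 0`. -/
def Deformation.IsInducedBy {n : ℕ} {I : Opens ℝ} {c₀ : CentroAffine n I} (Γ : Deformation c₀)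
    (X : DOp I) : Prop :=
  ∃ γ, IsSmoothLift Γ.J Γ.path γ ∧
    ∀ j, ∀ x : I, HasDerivAt (fun t => ((γ t).1 j).1 x) ((X.1 ((γ 0).1 j)).1 x) 0

/-- `T_[γ] 𝓜`: deformations modulo equality of the derivative of the curvature at `t = 0`. -/
def Tangent {n : ℕ} {I : Opens ℝ} (c₀ : CentroAffine n I) : Type :=
  Quotient (Setoid.ker (Deformation.vel (c₀ := c₀)))

/-- The tangent vector of a deformation. -/
def Deformation.tangent {n : ℕ} {I : Opens ℝ} {c₀ : CentroAffine n I} (Γ : Deformation c₀) :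
    Tangent c₀ :=
  Quotient.mk (Setoid.ker (Deformation.vel (c₀ := c₀))) Γ

/-- A curve `s ↦ σ(s)`, `s ∈ K`, of tangent vectors at `c₀` is smooth if it is represented
by deformations `t ↦ [γ(s, t)]` of `c₀` with `γ` smooth in `(s, t, x)`. -/
def Tangent.IsSmoothCurve {n : ℕ} {I : Opens ℝ} {c₀ : CentroAffine n I} (K : Opens ℝ)
    (σ : ℝ → Tangent c₀) : Prop :=
  ∃ (J : Opens ℝ) (γ : ℝ → ℝ → StarCurve n I),
    (∀ j, ContDiffOn ℝ ∞ (fun p : ℝ × ℝ × ℝ => ext ((γ p.1 p.2.1).1 j).1 p.2.2)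
      ((K : Set ℝ) ×ˢ (J : Set ℝ) ×ˢ (I : Set ℝ))) ∧
    ∀ s ∈ K, ∃ Γ : Deformation c₀,
      Γ.J = J ∧ (∀ t ∈ J, Γ.path t = (γ s t).cls) ∧ σ s = Γ.tangent

/-- The cyclic left `𝓓ₓ`-module `𝓓ₓ / 𝓓ₓ L_[γ]`. -/
abbrev DMod {n : ℕ} {I : Opens ℝ} (c : CentroAffine n I) : Type :=
  DOp I ⧸ Submodule.span (DOp I) {Lop c}

/-- The coset of an operator in `𝓓ₓ / 𝓓ₓ L_[γ]`. -/
def coset {n : ℕ} {I : Opens ℝ} (c : CentroAffine n I) (X : DOp I) : DMod c :=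
  Submodule.Quotient.mk X

/-- The kernel `{[X] : L_[γ] · [X] = 0}` of the tangent vector mapping. -/
def tangentKer {n : ℕ} {I : Opens ℝ} (c : CentroAffine n I) : Submodule ℝ (DMod c) where
  carrier := {q | Lop c • q = 0}
  add_mem' {p q} hp hq := by
    simp only [Set.mem_ofPred_eq] at *
    rw [smul_add, hp, hq, add_zero]
  zero_mem' := smul_zero _
  smul_mem' r q hq := by
    simp only [Set.mem_ofPred_eq] at *
    rw [smul_comm, hq, smul_zero]

/-- The equation `L_[γ](X([γ])) = -h`. The right-hand side is written in the frame
`γ, γ⁽¹⁾, …, γ⁽ⁿ⁻¹⁾`: it stands for `-∑ h_k γ⁽ᵏ⁾`, for each `γ ∈ [γ]`. -/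
def TangentEq {n : ℕ} {I : Opens ℝ} (c : CentroAffine n I) (X : DOp I)
    (h : Fin n → Sm I) : Prop :=
  ∀ γ : StarCurve n I, γ.cls = c → ∀ j,
    (Lop c).1 (X.1 (γ.1 j)) = - ∑ k : Fin n, h k * (D I ^ (k : ℕ)) (γ.1 j)

/-! ### Formal pseudo-differential operators and the `n`-KdV hierarchy -/

/-- A formal symbol `∑_k a_k ∂ₓᵏ`, `k ∈ ℤ`. The operations below are only
meaningful for symbols with `a_k = 0` for large `k`. -/
abbrev Psi (I : Opens ℝ) : Type := ℤ → Sm I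

/-- The product, from `∂ⁱ ∘ b = ∑_{l ≥ 0} (i choose l) b⁽ˡ⁾ ∂^{i-l}`. -/
def Psi.mul {I : Opens ℝ} (a b : Psi I) : Psi I := fun m =>
  ∑ᶠ p : ℤ × ℕ, Ring.choose p.1 p.2 • (a p.1 * (D I ^ p.2) (b (m - p.1 + p.2)))

/-- The symbol `1`. -/
def Psi.one (I : Opens ℝ) : Psi I := Pi.single 0 1

/-- Powers of a symbol. -/
def Psi.pow {I : Opens ℝ} (a : Psi I) : ℕ → Psi I
  | 0 => Psi.one I
  | k + 1 => Psi.mul a (Psi.pow a k)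

/-- The differential part `(∑_k a_k ∂ₓᵏ)_+ = ∑_{k ≥ 0} a_k ∂ₓᵏ`. -/
def Psi.plus {I : Opens ℝ} (a : Psi I) : Module.End ℝ (Sm I) :=
  ∑ᶠ k : ℕ, mulOp (a k) * D I ^ k

/-- The symbol of `∂ₓⁿ + ∑_{k<n} u_k ∂ₓᵏ`. -/
def symL {n : ℕ} {I : Opens ℝ} (u : Fin n → Sm I) : Psi I :=
  Pi.single (n : ℤ) 1 + ∑ k : Fin n, Pi.single (k : ℤ) (u k)

/-- `R = ∂ₓ + r₀ + r₁ ∂ₓ⁻¹ + ⋯` with `Rⁿ = ∂ₓⁿ + ∑_{k<n} u_k ∂ₓᵏ`, that is, `R = L^{1/n}`. -/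
def IsRootL {n : ℕ} {I : Opens ℝ} (u : Fin n → Sm I) (R : Psi I) : Prop :=
  R 1 = 1 ∧ (∀ k : ℤ, 1 < k → R k = 0) ∧ Psi.pow R n = symL u

/-- `B(t) = ∑_{k<m} c_k(t) (L(t)^{k/n})_+` with smooth functions `c_k` of `t`: the Lax operator
of an equation of the `n`-KdV hierarchy. -/
def IsKdVOp {n : ℕ} {I : Opens ℝ} (J : Opens ℝ) (u : ℝ → Fin n → Sm I)
    (B : ℝ → Module.End ℝ (Sm I)) : Prop :=
  ∃ (m : ℕ) (c : ℕ → ℝ → ℝ) (R : ℝ → Psi I),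
    (∀ k, ContDiffOn ℝ ∞ (c k) J) ∧ (∀ t ∈ J, IsRootL (u t) (R t)) ∧
    ∀ t ∈ J, B t = ∑ k ∈ Finset.range m, c k t • Psi.plus (Psi.pow (R t) k)

/-- `B(t) = ∑_{k<m} c_k(t) (L(t)^{k/n})_+ + f(t)` with `f ∈ 𝓕_{x,t}`: the Lax operator of an
equation of the `n`-KdV hierarchy up to rescalings `ψ(t) ↦ ρ(t) ψ(t)` by functions `ρ ∈ 𝓕_{x,t}`. -/
def IsGaugedKdVOp {n : ℕ} {I : Opens ℝ} (J : Opens ℝ) (u : ℝ → Fin n → Sm I)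
    (B : ℝ → Module.End ℝ (Sm I)) : Prop :=
  ∃ (B₀ : ℝ → Module.End ℝ (Sm I)) (f : ℝ → Sm I), IsKdVOp J u B₀ ∧ JointSmooth J f ∧
    ∀ t ∈ J, B t = B₀ t + mulOp (f t)

/-- The Lax equation `∂L/∂t = [B, L]` for `L(t) = ∂ₓⁿ + ∑_{k<n} u_k(t) ∂ₓᵏ` on `J`. -/
def LaxEq {n : ℕ} {I : Opens ℝ} (J : Opens ℝ) (u : ℝ → Fin n → Sm I)
    (B : ℝ → Module.End ℝ (Sm I)) : Prop :=
  ∀ t ∈ J, ∃ v : Fin n → Sm I,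
    (∀ k, ∀ x : I, HasDerivAt (fun s => (u s k).1 x) ((v k).1 x) t) ∧
    (opLow v).1 = B t * (opL (u t)).1 - (opL (u t)).1 * B t

/-- `cl` is the centro-affine curve defined by `L_c ψ = μ ψ`. -/
def IsSpectralCurve {n : ℕ} {I : Opens ℝ} (c : CentroAffine n I) (μ : ℝ)
    (cl : CentroAffine n I) : Prop :=
  (Lop cl).1 = (Lop c).1 - μ • 1

/-- The operator `∑_{i<N} P_i μⁱ`. -/
def polyOp {I : Opens ℝ} (N : ℕ) (P : ℕ → ℝ → DOp I) (μ : ℝ) (t : ℝ) : DOp I :=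
  ∑ i ∈ Finset.range N, μ ^ i • P i t

/-- The operator `∑_{i<N} P_i Lⁱ` that `∑_{i<N} P_i λⁱ` induces on the solutions of `Lψ = λψ`. -/
def polyOpAtL {n : ℕ} {I : Opens ℝ} (N : ℕ) (P : ℕ → ℝ → DOp I)
    (c : ℝ → CentroAffine n I) (t : ℝ) : Module.End ℝ (Sm I) :=
  (∑ i ∈ Finset.range N, P i t * Lop (c t) ^ i).1

/-- Spectral deformation of `c(t)`, `t ∈ J`: for each initial value `s ∈ S` of the spectral
parameter, a smooth function `λ_s(t)` with `λ_s(0) = s`, such that the centro-affine curves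
defined by `L_{c(t)} ψ = λ_s(t) ψ` form an admissible deformation with evolution operator
`∂ₜ - P(t, λ_s(t))`, where `P = ∑_{i<N} P_i(t) λⁱ ∈ 𝓕_{x,t}[∂ₓ][λ]` does not depend on `s`. -/
def IsSpectralDeformation {n : ℕ} {I : Opens ℝ} (J : Opens ℝ) (c : ℝ → CentroAffine n I)
    (S : Set ℝ) (lam : ℝ → ℝ → ℝ) (N : ℕ) (P : ℕ → ℝ → DOp I) : Prop :=
  (∀ i, SmoothOp J (P i)) ∧
  ∀ s ∈ S, lam s 0 = s ∧ ContDiffOn ℝ ∞ (lam s) J ∧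
    ∃ cl : ℝ → CentroAffine n I, (∀ t ∈ J, IsSpectralCurve (c t) (lam s t) (cl t)) ∧
      IsAdmissible J cl ∧ IsEvolutionOp J cl fun t => polyOp N P (lam s t) t

/-- `c(t)` is isospectral: it has a spectral deformation in which every real
value of the spectral parameter is independent of `t`. -/
def IsIsospectral {n : ℕ} {I : Opens ℝ} (J : Opens ℝ) (c : ℝ → CentroAffine n I) : Prop :=
  ∃ (N : ℕ) (P : ℕ → ℝ → DOp I), IsSpectralDeformation J c Set.univ (fun s _ => s) N P

/-- The coefficient `u_{n-1}(t)` does not depend on `t ∈ J`. -/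
def TopCurvatureConst {n : ℕ} {I : Opens ℝ} (J : Opens ℝ) (c : ℝ → CentroAffine n I) : Prop :=
  ∀ k : Fin n, (k : ℕ) + 1 = n → ∀ t ∈ J, ∀ t' ∈ J, curvature (c t) k = curvature (c t') k

end StarShaped

end

noncomputable section

namespace StarShaped

/-! ### Calculus in `𝓕` -/

variable {I : Opens ℝ}

/-! The components of a star-shaped curve form a basis of solutions of `L y = 0`. Two curves with
the same curvature therefore span the same solution space (`curvature_injective`), and linear
differential equations with smooth parameters realise every smooth family of coefficients by a
smooth family of curves (`exists_starCurve_family`). Hence a centro-affine curve is the same thing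
as its curvature, also in families, and the tangent space is the space of velocities of the
curvature, from which it takes its module structure.

Differentiating `L γ = 0` in `t` gives `L(∂ₜγ) = -(∂ₜL)γ` (`Lop_apply_deriv`), so a deformation with
`∂ₜγ = X(γ)` has velocity `h` exactly when `L(X(γ)) = -∑ h_k γ⁽ᵏ⁾`. Since the Wronskian matrix is
invertible, `X ↦ h` is a well-defined linear map (`tangentMap`). It is surjective by variation of
constants (`StarCurve.exists_opL_eq`), and division by `L` identifies its kernel: `L X` kills `γ` if
and only if it is a left multiple of `L` (`StarCurve.mem_span_iff`).

For part (3), an admissible family has as evolution operator the expansion of `∂ₜγ` in the frame `γ,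
γ⁽¹⁾, …`. Conversely, the lift with Wronskian matrix `1` at a base point satisfies an evolution
equation whose right-hand side is as regular as the lift itself, so a `C¹` lift becomes smooth step
by step (`isAdmissible_of_isEvolutionOp`).

For part (4), `∂ₜL - [P(L), L]` acts on the eigenfunctions of `L` as multiplication by `∂ₜλ`
(`laxDefect_apply_spectral`). An operator that kills the eigenfunctions for infinitely many
eigenvalues vanishes: in its expansion `∑ aᵢLⁱ` with `aᵢ` of order `< n`, the sum `∑ sⁱaᵢ` is a
polynomial in `s` with infinitely many roots (`eq_zero_of_infinite_spectrum`). So constancy of the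
spectral parameters is the Lax equation. That equation forces `[P(L), L]` to have order `< n`, and
the leading coefficients of `P(L)` can be peeled off by differential parts of powers of `L^{1/n}`
until only a function `f` is left (`exists_eq_sum_pos_pow`). The coefficient of `∂ⁿ⁻¹` in the Lax
equation reads `∂ₜu_{n-1} = -n ∂ₓf`, which separates the `n`-KdV equations from those up to
rescaling. -/

theorem Sm.ext_val {f g : Sm I} (h : ∀ x : I, f.1 x = g.1 x) : f = g :=
  Subtype.ext (funext h)

/-- Evaluation at a point. -/
def ev (x : I) : Sm I →ₐ[ℝ] ℝ :=
  (Pi.evalAlgHom ℝ (fun _ : I => ℝ) x).comp (smoothSub I).val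

theorem ev_apply (x : I) (f : Sm I) : ev x f = f.1 x := rfl

theorem Sm.ext_ev {f g : Sm I} (h : ∀ x : I, ev x f = ev x g) : f = g := Sm.ext_val h

theorem ext_eq_ev (f : Sm I) {x : ℝ} (h : x ∈ I) : ext f.1 x = ev ⟨x, h⟩ f := ext_of_mem _ h

theorem Sm.contDiffOn (f : Sm I) : ContDiffOn ℝ ∞ (ext f.1) I := f.2

/-- A smooth function on the real line that is given on `I`. -/
def Sm.mk' (F : ℝ → ℝ) (h : ContDiffOn ℝ ∞ F I) : Sm I :=
  ⟨fun x => F x, h.congr fun x hx => by rw [ext_of_mem _ (show x ∈ I from hx)]⟩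

theorem ev_mk' (F : ℝ → ℝ) (h : ContDiffOn ℝ ∞ F I) (x : I) : ev x (Sm.mk' F h) = F x := rfl

theorem hasDerivAt_ext (f : Sm I) (x : I) : HasDerivAt (ext f.1) (ev x (D I f)) x :=
  (differentiableAt_ext f x).hasDerivAt

theorem ev_D_eq {f : Sm I} {x : I} {F : ℝ → ℝ} {a : ℝ} (h : ∀ y : I, ev y f = F y)
    (hF : HasDerivAt F a x) : ev x (D I f) = a :=
  (hasDerivAt_ext f x).unique (hF.congr_of_eventuallyEq (ext_eventuallyEq h x))

theorem D_mul (f g : Sm I) : D I (f * g) = D I f * g + f * D I g := by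
  refine Sm.ext_ev fun x => ?_
  refine (ev_D_eq (F := fun y => ext f.1 y * ext g.1 y) (fun y => ?_)
    ((hasDerivAt_ext f x).mul (hasDerivAt_ext g x))).trans ?_
  · simp [ext_coe, ev_apply]; rfl
  · simp [ext_coe, ev_apply]; rfl

theorem D_algebraMap (r : ℝ) : D I (algebraMap ℝ (Sm I) r) = 0 :=
  Sm.ext_ev fun x => by
    rw [map_zero]
    exact ev_D_eq (F := fun _ => r) (fun y => by simp) (hasDerivAt_const _ _)

theorem D_one : D I 1 = 0 := by simpa using D_algebraMap (I := I) 1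

theorem D_pow_succ_apply (k : ℕ) (f : Sm I) : (D I ^ (k + 1)) f = D I ((D I ^ k) f) := by
  rw [pow_succ']; rfl

theorem D_pow_succ_apply' (k : ℕ) (f : Sm I) : (D I ^ (k + 1)) f = (D I ^ k) (D I f) := by
  rw [pow_succ]; rfl

theorem D_pow_algebraMap (r : ℝ) {k : ℕ} (hk : k ≠ 0) :
    (D I ^ k) (algebraMap ℝ (Sm I) r) = 0 := by
  obtain ⟨k, rfl⟩ := Nat.exists_eq_succ_of_ne_zero hk
  rw [Nat.succ_eq_add_one, D_pow_succ_apply', D_algebraMap, map_zero]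

theorem eq_algebraMap_of_D_eq_zero (hI : (I : Set ℝ).OrdConnected) {f : Sm I} (h : D I f = 0)
    (x₀ : I) : f = algebraMap ℝ (Sm I) (ev x₀ f) := by
  refine Sm.ext_ev fun x => ?_
  have hd : ∀ y ∈ (I : Set ℝ), HasDerivWithinAt (ext f.1) 0 I y := fun y hy => by
    have := hasDerivAt_ext f ⟨y, hy⟩
    rw [h, map_zero] at this
    exact this.hasDerivWithinAt
  have := hI.convex.norm_image_sub_le_of_norm_hasDerivWithin_le (C := 0) hd (by simp) x₀.2 x.2
  rw [zero_mul, norm_le_zero_iff, sub_eq_zero, ext_coe, ext_coe] at this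
  simpa [ev_apply] using this

theorem exists_D_eq (hI : (I : Set ℝ).OrdConnected) (f : Sm I) : ∃ F, D I F = f := by
  rcases (I : Set ℝ).eq_empty_or_nonempty with h0 | ⟨x₀, hx₀⟩
  · exact ⟨0, Sm.ext_ev fun x => (Set.notMem_empty x.1 (h0 ▸ x.2)).elim⟩
  have hd : ∀ x ∈ (I : Set ℝ), HasDerivAt (fun x => ∫ y in x₀..x, ext f.1 y) (ext f.1 x) x := by
    intro x hx
    have hsub : Set.uIcc x₀ x ⊆ I := hI.uIcc_subset hx₀ hx
    refine intervalIntegral.integral_hasDerivAt_right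
      ((f.contDiffOn.continuousOn.mono hsub).intervalIntegrable) ?_
      (f.contDiffOn.continuousOn.continuousAt (I.isOpen.mem_nhds hx))
    exact f.contDiffOn.continuousOn.stronglyMeasurableAtFilter I.isOpen x hx
  have hs : ContDiffOn ℝ ∞ (fun x => ∫ y in x₀..x, ext f.1 y) I := by
    rw [contDiffOn_infty_iff_deriv_of_isOpen I.isOpen]
    refine ⟨fun x hx => (hd x hx).differentiableAt.differentiableWithinAt, ?_⟩
    exact f.contDiffOn.congr fun x hx => (hd x hx).deriv
  refine ⟨Sm.mk' _ hs, Sm.ext_ev fun x => ?_⟩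
  rw [ev_D_eq (fun y => ev_mk' _ hs y) (hd x x.2), ext_coe, ev_apply]

theorem isUnit_of_ev_ne_zero {f : Sm I} (h : ∀ x, ev x f ≠ 0) : IsUnit f := by
  have hs : ContDiffOn ℝ ∞ (fun x => (ext f.1 x)⁻¹) I :=
    f.contDiffOn.inv fun x hx => by rw [ext_eq_ev f hx]; exact h _
  refine IsUnit.of_mul_eq_one (Sm.mk' _ hs) (Sm.ext_ev fun x => ?_)
  rw [map_mul, ev_mk', ext_eq_ev f x.2, map_one]
  exact mul_inv_cancel₀ (h x)

/-- The coordinate function `x - x₀`. -/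
def coordAt (x₀ : ℝ) : Sm I :=
  Sm.mk' (fun x => x - x₀) (contDiff_id.sub contDiff_const).contDiffOn

theorem D_coordAt (x₀ : ℝ) : D I (coordAt x₀) = 1 :=
  Sm.ext_ev fun x => by
    rw [map_one]
    exact ev_D_eq (F := fun x => x - x₀) (fun y => ev_mk' _ _ y) ((hasDerivAt_id _).sub_const _)

theorem ev_coordAt (x₀ : I) : ev x₀ (coordAt (I := I) x₀) = 0 := by
  rw [coordAt, ev_mk', sub_self]

theorem D_mul_pow_coordAt (x₀ : ℝ) (m : ℕ) :
    D I (coordAt x₀ ^ (m + 1)) = (m + 1 : ℝ) • coordAt x₀ ^ m := by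
  induction m with
  | zero => simp [D_coordAt]
  | succ m ih =>
    rw [pow_succ, D_mul, ih, D_coordAt, mul_one, smul_mul_assoc, ← pow_succ]
    push_cast
    module

/-- The powers of `x - x₀` are dual, up to factorials, to the derivatives at `x₀`. They separate the
coefficients of a differential operator in `PsiDO.eq_zero_of_toEnd_eq_zero`. -/
theorem ev_D_pow_coordAt (x₀ : I) (k m : ℕ) :
    ev x₀ ((D I ^ k) (coordAt x₀ ^ m)) = if k = m then (m.factorial : ℝ) else 0 := by
  induction k generalizing m with
  | zero =>
    rw [pow_zero, Module.End.one_apply, map_pow, ev_coordAt]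
    rcases m with _ | m
    · simp
    · simp
  | succ k ih =>
    rcases m with _ | m
    · rw [pow_zero, D_pow_succ_apply', D_one, map_zero, map_zero, if_neg (by simp)]
    · rw [D_pow_succ_apply', D_mul_pow_coordAt, map_smul, map_smul, ih]
      simp only [Nat.add_right_cancel_iff, Nat.factorial_succ, smul_eq_mul]
      split_ifs <;> simp

/-! ### Families depending smoothly on parameters -/

variable {E : Type*} [NormedAddCommGroup E] [NormedSpace ℝ E] {U : Set E} {r : WithTop ℕ∞}

/-- All `x`-derivatives of the family are jointly `C^r`. -/
def JointC (r : WithTop ℕ∞) (U : Set E) (f : E → Sm I) : Prop :=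
  ∀ k : ℕ, ContDiffOn ℝ r (fun p : E × ℝ => ext ((D I ^ k) (f p.1)).1 p.2) (U ×ˢ (I : Set ℝ))

theorem JointC.D {f : E → Sm I} (h : JointC r U f) : JointC r U fun p => D I (f p) := fun k => by
  simpa only [D_pow_succ_apply'] using h (k + 1)

theorem JointC.D_pow {f : E → Sm I} (h : JointC r U f) (m : ℕ) :
    JointC r U fun p => (StarShaped.D I ^ m) (f p) := by
  induction m with
  | zero => exact h
  | succ m ih => simpa only [D_pow_succ_apply] using ih.D

theorem JointC.congr {f g : E → Sm I} (h : JointC r U f) (hfg : ∀ p ∈ U, g p = f p) :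
    JointC r U g := fun k =>
  (h k).congr fun p hp => by rw [hfg _ hp.1]

theorem JointC.mono {f : E → Sm I} {V : Set E} (h : JointC r U f) (hV : V ⊆ U) :
    JointC r V f := fun k => (h k).mono (Set.prod_mono hV subset_rfl)

theorem JointC.add {f g : E → Sm I} (hf : JointC r U f) (hg : JointC r U g) :
    JointC r U fun p => f p + g p := fun k =>
  ((hf k).add (hg k)).congr fun p hp => by
    simp only [ext_eq_ev _ (show p.2 ∈ I from hp.2), map_add]

theorem JointC.neg {f : E → Sm I} (hf : JointC r U f) : JointC r U fun p => - f p := fun k =>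
  (hf k).neg.congr fun p hp => by
    simp only [ext_eq_ev _ (show p.2 ∈ I from hp.2), map_neg]

theorem JointC.sub {f g : E → Sm I} (hf : JointC r U f) (hg : JointC r U g) :
    JointC r U fun p => f p - g p := by
  simpa only [sub_eq_add_neg] using hf.add hg.neg

theorem jointC_zero : JointC r U fun _ => (0 : Sm I) := fun k =>
  (contDiffOn_const (c := (0 : ℝ))).congr fun p hp => by
    simp only [ext_eq_ev _ (show p.2 ∈ I from hp.2), map_zero]

theorem JointC.sum {ι : Type*} {s : Finset ι} {f : ι → E → Sm I}
    (h : ∀ i ∈ s, JointC r U (f i)) : JointC r U fun p => ∑ i ∈ s, f i p := by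
  classical
  induction s using Finset.induction_on with
  | empty => simpa using jointC_zero
  | insert a s ha ih =>
    simp only [Finset.sum_insert ha]
    exact (h a (by simp)).add (ih fun i hi => h i (by simp [hi]))

theorem JointC.mul {f g : E → Sm I} (hf : JointC r U f) (hg : JointC r U g) :
    JointC r U fun p => f p * g p := by
  intro k
  induction k generalizing f g with
  | zero =>
    refine ((hf 0).mul (hg 0)).congr fun p hp => ?_
    simp only [ext_eq_ev _ (show p.2 ∈ I from hp.2), pow_zero, Module.End.one_apply, map_mul]
  | succ k ih =>
    refine ((ih hf.D hg).add (ih hf hg.D)).congr fun p hp => ?_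
    simp only [ext_eq_ev _ (show p.2 ∈ I from hp.2), D_pow_succ_apply', D_mul, map_add]

theorem jointC_const_of_contDiffOn (hr : r ≤ ∞) (f : Sm I) : JointC r U fun _ => f := fun k =>
  (((D I ^ k) f).contDiffOn.of_le hr).comp contDiff_snd.contDiffOn fun _ hp => hp.2

theorem jointC_algebraMap {c : E → ℝ} (h : ContDiffOn ℝ r c U) :
    JointC r U fun p => algebraMap ℝ (Sm I) (c p) := by
  intro k
  rcases eq_or_ne k 0 with rfl | hk
  · refine (h.comp contDiff_fst.contDiffOn fun p hp => hp.1).congr fun p hp => ?_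
    simp [ext_eq_ev _ (show p.2 ∈ I from hp.2)]
  · refine (contDiffOn_const (c := (0 : ℝ))).congr fun p hp => ?_
    simp only [ext_eq_ev _ (show p.2 ∈ I from hp.2), D_pow_algebraMap _ hk, map_zero]

theorem JointC.smul {f : E → Sm I} {c : E → ℝ} (hc : ContDiffOn ℝ r c U) (hf : JointC r U f) :
    JointC r U fun p => c p • f p := by
  simpa only [Algebra.smul_def] using (jointC_algebraMap hc).mul hf

theorem JointC.const_smul {f : E → Sm I} (c : ℝ) (hf : JointC r U f) :
    JointC r U fun p => c • f p := hf.smul contDiffOn_const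

theorem JointC.zsmul {f : E → Sm I} (c : ℤ) (hf : JointC r U f) :
    JointC r U fun p => c • f p := by
  simpa only [Int.cast_smul_eq_zsmul] using hf.const_smul (c : ℝ)

theorem JointC.prod {ι : Type*} {s : Finset ι} {f : ι → E → Sm I}
    (h : ∀ i ∈ s, JointC r U (f i)) : JointC r U fun p => ∏ i ∈ s, f i p := by
  classical
  induction s using Finset.induction_on with
  | empty => simpa using jointC_algebraMap (I := I) (contDiffOn_const (c := (1 : ℝ)))
  | insert a s ha ih =>
    simp only [Finset.prod_insert ha]
    exact (h a (by simp)).mul (ih fun i hi => h i (by simp [hi]))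

theorem JointC.det {n : ℕ} {M : E → Matrix (Fin n) (Fin n) (Sm I)}
    (h : ∀ i j, JointC r U fun p => M p i j) : JointC r U fun p => (M p).det := by
  simp only [Matrix.det_apply, Units.smul_def]
  exact JointC.sum fun σ _ => (JointC.prod fun i _ => h _ _).zsmul _

theorem JointC.contDiffOn_ev {f : E → Sm I} (h : JointC r U f) (x : I) :
    ContDiffOn ℝ r (fun p => ev x (f p)) U := by
  have := (h 0).comp (f := fun p : E => (p, (x : ℝ)))
    (contDiff_id.prodMk contDiff_const).contDiffOn (fun p hp => ⟨hp, x.2⟩)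
  refine this.congr fun p _ => ?_
  simp [ext_coe, ev_apply]

theorem contDiffOn_partial_snd {U : Set E} (hU : IsOpen U) {V : Set ℝ} (hV : IsOpen V)
    {F F' : E × ℝ → ℝ} (h : ContDiffOn ℝ ∞ F (U ×ˢ V))
    (hF : ∀ p ∈ U, ∀ x ∈ V, HasDerivAt (fun y => F (p, y)) (F' (p, x)) x) :
    ContDiffOn ℝ ∞ F' (U ×ˢ V) := by
  have h1 : ContDiffOn ℝ ∞ (fun q => fderiv ℝ F q (0, 1)) (U ×ˢ V) :=
    (h.fderiv_of_isOpen (hU.prod hV) (m := ∞) (by simp)).clm_apply contDiffOn_const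
  refine h1.congr fun q hq => ?_
  have hd : HasFDerivAt F (fderiv ℝ F q) q :=
    ((h.differentiableOn (by simp)).differentiableAt ((hU.prod hV).mem_nhds hq)).hasFDerivAt
  have h2 : HasDerivAt (fun y : ℝ => (q.1, y)) ((0 : E), (1 : ℝ)) q.2 :=
    (hasDerivAt_const _ _).prodMk (hasDerivAt_id _)
  exact (hF q.1 hq.1 q.2 hq.2).unique (HasFDerivAt.comp_hasDerivAt (f := fun y : ℝ => (q.1, y)) q.2 hd h2)

/-- For `r = ∞` the `x`-derivatives are partial derivatives of a smooth function, so the condition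
on them is automatic. For finite `r` it is a genuine extra requirement, and it is what keeps
differential operators from losing regularity. -/
theorem jointC_infty_iff (hU : IsOpen U) {f : E → Sm I} :
    JointC ∞ U f ↔ ContDiffOn ℝ ∞ (fun p : E × ℝ => ext (f p.1).1 p.2) (U ×ˢ (I : Set ℝ)) := by
  refine ⟨fun h => h 0, fun h k => ?_⟩
  induction k with
  | zero => exact h
  | succ k ih =>
    refine contDiffOn_partial_snd hU I.isOpen ih fun p _ x hx => ?_
    rw [D_pow_succ_apply, ext_eq_ev _ (show x ∈ I from hx)]
    exact hasDerivAt_ext ((D I ^ k) (f p)) ⟨x, hx⟩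

theorem jointC_iff_jointSmooth {J : Opens ℝ} {f : ℝ → Sm I} :
    JointC ∞ (J : Set ℝ) f ↔ JointSmooth J f := jointC_infty_iff J.isOpen

theorem JointC.ringInverse (hU : IsOpen U) {f : E → Sm I} (h : JointC ∞ U f)
    (h0 : ∀ p ∈ U, ∀ x, ev x (f p) ≠ 0) : JointC ∞ U fun p => Ring.inverse (f p) := by
  rw [jointC_infty_iff hU]
  refine ((h 0).inv (fun p hp => ?_)).congr fun p hp => ?_
  · rw [ext_eq_ev _ (show p.2 ∈ I from hp.2)]; exact h0 _ hp.1 _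
  · have hx : p.2 ∈ I := hp.2
    simp only [Pi.inv_apply, ext_eq_ev _ hx]
    refine eq_inv_of_mul_eq_one_left ?_
    rw [pow_zero, Module.End.one_apply, ← map_mul,
      Ring.inverse_mul_cancel _ (isUnit_of_ev_ne_zero (h0 _ hp.1)), map_one]

theorem JointC.adjugate {n : ℕ} {M : E → Matrix (Fin n) (Fin n) (Sm I)}
    (h : ∀ i j, JointC r U fun p => M p i j) (i j : Fin n) :
    JointC r U fun p => (M p).adjugate i j := by
  simp only [Matrix.adjugate_apply]
  refine JointC.det fun a b => ?_
  simp only [Matrix.updateRow_apply]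
  split_ifs
  · rcases eq_or_ne b i with rfl | hb
    · simpa using jointC_algebraMap (I := I) (contDiffOn_const (c := (1 : ℝ)))
    · simpa [Pi.single_apply, hb] using jointC_zero
  · exact h a b

/-- Cramer's rule: the entries of the inverse are polynomials in the entries times the inverse of a
nowhere vanishing determinant. -/
theorem JointC.matrixInv (hU : IsOpen U) {n : ℕ} {M : E → Matrix (Fin n) (Fin n) (Sm I)}
    (h : ∀ i j, JointC ∞ U fun p => M p i j)
    (h0 : ∀ p ∈ U, ∀ x, ev x (M p).det ≠ 0) (i j : Fin n) :
    JointC ∞ U fun p => (M p)⁻¹ i j := by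
  simp only [Matrix.inv_def, Matrix.smul_apply, smul_eq_mul]
  exact (JointC.ringInverse hU (JointC.det h) h0).mul (JointC.adjugate h i j)

theorem JointC.W {n : ℕ} {γ : E → Fin n → Sm I} (h : ∀ j, JointC r U fun p => γ p j)
    (i j : Fin n) : JointC r U fun p => W (γ p) i j := (h j).D_pow i

theorem ev_det_W {n : ℕ} (γ : Fin n → Sm I) (x : I) :
    ev x (W γ).det = (Matrix.of fun i j => (W γ i j).1 x).det := by
  rw [AlgHom.map_det]; rfl

theorem JointC.curv (hU : IsOpen U) {n : ℕ} {γ : E → Fin n → Sm I}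
    (h : ∀ j, JointC ∞ U fun p => γ p j) (h0 : ∀ p ∈ U, ∀ x, ev x (StarShaped.W (γ p)).det ≠ 0)
    (k : Fin n) : JointC ∞ U fun p => curv (γ p) k := by
  simp only [StarShaped.curv, Pi.neg_apply, Matrix.vecMul, dotProduct]
  exact (JointC.sum fun i _ => ((h i).D_pow n).mul (JointC.matrixInv hU (JointC.W h) h0 i k)).neg

/-! ### Differential operators -/

section Operators

variable {I : Opens ℝ} {n : ℕ}

theorem opL_apply (u : Fin n → Sm I) (f : Sm I) :
    (opL u).1 f = (D I ^ n) f + ∑ k, u k * (D I ^ (k : ℕ)) f := by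
  simp [opL, LinearMap.sum_apply, Module.End.mul_apply]

theorem opLow_apply (h : Fin n → Sm I) (f : Sm I) :
    (opLow h).1 f = ∑ k, h k * (D I ^ (k : ℕ)) f := by
  simp [opLow, LinearMap.sum_apply, Module.End.mul_apply]

theorem DOp.ext_val {X Y : DOp I} (h : X.1 = Y.1) : X = Y := Subtype.ext h

theorem DOp.add_val (X Y : DOp I) : (X + Y).1 = X.1 + Y.1 := rfl

theorem DOp.sub_val (X Y : DOp I) : (X - Y).1 = X.1 - Y.1 := rfl

theorem DOp.one_val : (1 : DOp I).1 = 1 := rfl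

theorem DOp.smul_val (r : ℝ) (X : DOp I) : (r • X).1 = r • X.1 := rfl

theorem DOp.pow_val (X : DOp I) (k : ℕ) : (X ^ k).1 = X.1 ^ k := rfl

theorem DOp.sum_val {ι : Type*} (s : Finset ι) (X : ι → DOp I) :
    (∑ i ∈ s, X i).1 = ∑ i ∈ s, (X i).1 :=
  map_sum (diffOps I).val.toAddMonoidHom X s

theorem DOp.mul_apply (X Y : DOp I) (f : Sm I) : (X * Y).1 f = X.1 (Y.1 f) := rfl

/-- `∂ₓ` as an element of `𝓓ₓ`. -/
def DOp.d (I : Opens ℝ) : DOp I := ⟨D I, D_mem I⟩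

/-- A function as an element of `𝓓ₓ`. -/
def DOp.m (a : Sm I) : DOp I := ⟨mulOp a, mulOp_mem a⟩

theorem DOp.d_val : (DOp.d I).1 = D I := rfl

theorem DOp.m_val (a : Sm I) : (DOp.m a).1 = mulOp a := rfl

theorem DOp.d_mul_m (a : Sm I) : DOp.d I * DOp.m a = DOp.m (D I a) + DOp.m a * DOp.d I :=
  DOp.ext_val (LinearMap.ext fun f => D_mul a f)

theorem DOp.m_mul_m (a b : Sm I) : DOp.m a * DOp.m b = DOp.m (a * b) :=
  DOp.ext_val (LinearMap.ext fun f => (mul_assoc a b f).symm)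

theorem DOp.m_one : DOp.m (1 : Sm I) = 1 :=
  DOp.ext_val (LinearMap.ext fun f => one_mul f)

theorem DOp.m_add (a b : Sm I) : DOp.m (a + b) = DOp.m a + DOp.m b :=
  DOp.ext_val (LinearMap.ext fun f => add_mul a b f)

theorem DOp.m_smul_one (r : ℝ) : DOp.m (algebraMap ℝ (Sm I) r) = r • 1 :=
  DOp.ext_val (LinearMap.ext fun f => (Algebra.smul_def r f).symm)

theorem opLow_eq (h : Fin n → Sm I) : opLow h = ∑ k : Fin n, DOp.m (h k) * DOp.d I ^ (k : ℕ) :=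
  DOp.ext_val (by rw [DOp.sum_val]; rfl)

theorem opL_eq (u : Fin n → Sm I) : opL u = DOp.d I ^ n + opLow u :=
  DOp.ext_val rfl

theorem opLow_add (h k : Fin n → Sm I) : opLow (h + k) = opLow h + opLow k := by
  simp [opLow_eq, DOp.m_add, add_mul, Finset.sum_add_distrib]

theorem opLow_zero : opLow (0 : Fin n → Sm I) = 0 := by
  have := opLow_add (0 : Fin n → Sm I) 0
  simpa using this

theorem opLow_smul (r : ℝ) (h : Fin n → Sm I) : opLow (r • h) = r • opLow h := by
  refine DOp.ext_val (LinearMap.ext fun f => ?_)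
  simp [DOp.smul_val, opLow_apply, Finset.smul_sum]

theorem opLow_single (k : Fin n) (a : Sm I) : opLow (Pi.single k a) = DOp.m a * DOp.d I ^ (k : ℕ) := by
  refine DOp.ext_val (LinearMap.ext fun f => ?_)
  rw [opLow_apply, Finset.sum_eq_single k]
  · simp [DOp.mul_apply, DOp.m_val, DOp.pow_val, DOp.d_val]
  · intro b _ hb; simp [hb]
  · simp

/-- An operator in the algebra generated by `∂ₓ` and the functions, as an element of `𝓓ₓ`. -/
def DOp.mk (T : Module.End ℝ (Sm I)) (hT : T ∈ diffOps I) : DOp I := ⟨T, hT⟩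

/-- Induction over `𝓓ₓ`, by left multiplication with generators. -/
theorem DOp.induction_left {p : DOp I → Prop} (one : p 1) (add : ∀ X Y, p X → p Y → p (X + Y))
    (d : ∀ X, p X → p (DOp.d I * X)) (m : ∀ a X, p X → p (DOp.m a * X)) (X : DOp I) : p X := by
  -- The property "left multiplication by `T` preserves `p`" is stable under products of operators,
  -- whereas `p` itself need not be. It is applied at the end to `Z = 1`.
  have key : ∀ (T : Module.End ℝ (Sm I)) (hT : T ∈ diffOps I) (Z : DOp I), p Z →
      p (DOp.mk T hT * Z) := by
    intro T hT
    induction hT using Algebra.adjoin_induction with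
    | mem T hT =>
      rcases hT with rfl | ⟨a, rfl⟩
      · exact d
      · exact m a
    | algebraMap r =>
      intro Z hZ
      convert m (algebraMap ℝ (Sm I) r) Z hZ using 1
      rw [DOp.m_smul_one]
      refine DOp.ext_val (LinearMap.ext fun f => ?_)
      rfl
    | add S T hS hT ihS ihT =>
      intro Z hZ
      exact (congrArg p (add_mul (DOp.mk S hS) (DOp.mk T hT) Z)).mpr (add _ _ (ihS Z hZ) (ihT Z hZ))
    | mul S T hS hT ihS ihT =>
      intro Z hZ
      exact (congrArg p (mul_assoc (DOp.mk S hS) (DOp.mk T hT) Z)).mpr (ihS _ (ihT Z hZ))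
  simpa using! key X.1 X.2 1 one

/-- `∑ᵢ aᵢ Lⁱ`, where each `aᵢ` is the list of coefficients of an operator of order `< n`. -/
def adicSum (L : DOp I) : (ℕ →₀ (Fin n → Sm I)) →+ DOp I :=
  Finsupp.liftAddHom fun i => (AddMonoidHom.mulRight (L ^ i)).comp
    { toFun := opLow, map_zero' := opLow_zero, map_add' := opLow_add }

theorem adicSum_single (L : DOp I) (i : ℕ) (v : Fin n → Sm I) :
    adicSum L (Finsupp.single i v) = opLow v * L ^ i := by
  rw [adicSum, Finsupp.liftAddHom_apply_single]
  rfl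

theorem adicSum_eq_sum (L : DOp I) (a : ℕ →₀ (Fin n → Sm I)) :
    adicSum L a = ∑ i ∈ a.support, opLow (a i) * L ^ i := by
  rfl

/-- The operators `a ∂ᵏ Lⁱ` with `k < n` span a subgroup stable under left multiplication by
functions and by `∂`. Only `∂ · ∂ⁿ⁻¹` leaves the range of exponents, and there `∂ⁿ = L - ∑ u_j ∂ʲ`
trades the excess for one more power of `L`. -/
theorem exists_adicSum (hn : 0 < n) (u : Fin n → Sm I) (X : DOp I) :
    ∃ a : ℕ →₀ (Fin n → Sm I), X = adicSum (opL u) a := by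
  set L := opL u
  have mem1 : ∀ (a : Sm I) (k i : ℕ), k < n →
      DOp.m a * DOp.d I ^ k * L ^ i ∈ (adicSum (n := n) L).range := fun a k i hk =>
    ⟨Finsupp.single i (Pi.single ⟨k, hk⟩ a), by rw [adicSum_single, opLow_single]⟩
  have mem2 : ∀ (a : Sm I) (k i : ℕ), k ≤ n →
      DOp.m a * DOp.d I ^ k * L ^ i ∈ (adicSum (n := n) L).range := by
    intro a k i hk
    rcases hk.lt_or_eq with hk | rfl
    · exact mem1 a k i hk
    have h : DOp.m a * DOp.d I ^ k * L ^ i = DOp.m a * DOp.d I ^ 0 * L ^ (i + 1) -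
        ∑ j : Fin k, DOp.m (a * u j) * DOp.d I ^ (j : ℕ) * L ^ i := by
      have h2 : DOp.d I ^ k = L - opLow u := by rw [eq_sub_iff_add_eq, ← opL_eq]
      rw [h2, opLow_eq, mul_sub, Finset.mul_sum, sub_mul, Finset.sum_mul, pow_zero, mul_one,
        pow_succ', mul_assoc]
      simp only [← mul_assoc, DOp.m_mul_m]
    rw [h]
    exact sub_mem (mem1 a 0 _ hn) (sum_mem fun j _ => mem1 _ _ _ j.2)
  suffices h : X ∈ (adicSum (n := n) L).range by
    obtain ⟨a, ha⟩ := h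
    exact ⟨a, ha.symm⟩
  induction X using DOp.induction_left with
  | one => simpa [DOp.m_one] using mem1 1 0 0 hn
  | add X Y hX hY => exact add_mem hX hY
  | d X hX =>
    obtain ⟨a, rfl⟩ := hX
    rw [adicSum_eq_sum, Finset.mul_sum]
    refine sum_mem fun i _ => ?_
    rw [opLow_eq, Finset.sum_mul, Finset.mul_sum]
    refine sum_mem fun k _ => ?_
    rw [← mul_assoc, ← mul_assoc, DOp.d_mul_m, add_mul, add_mul, mul_assoc (DOp.m _) (DOp.d I),
      ← pow_succ']
    exact add_mem (mem1 _ _ _ k.2) (mem2 _ _ _ k.2)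
  | m b X hX =>
    obtain ⟨a, rfl⟩ := hX
    rw [adicSum_eq_sum, Finset.mul_sum]
    refine sum_mem fun i _ => ?_
    rw [opLow_eq, Finset.sum_mul, Finset.mul_sum]
    refine sum_mem fun k _ => ?_
    rw [← mul_assoc, ← mul_assoc, DOp.m_mul_m]
    exact mem1 _ _ _ k.2

/-- Division with remainder by `L`. -/
theorem exists_eq_opLow_add_mul (hn : 0 < n) (u : Fin n → Sm I) (X : DOp I) :
    ∃ (v : Fin n → Sm I) (Q : DOp I), X = opLow v + Q * opL u := by
  obtain ⟨a, rfl⟩ := exists_adicSum hn u X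
  induction a using Finsupp.induction_linear with
  | zero => exact ⟨0, 0, by simp [opLow_zero]⟩
  | add f g hf hg =>
    obtain ⟨v, Q, h⟩ := hf
    obtain ⟨v', Q', h'⟩ := hg
    exact ⟨v + v', Q + Q', by rw [map_add, h, h', opLow_add, add_mul]; abel⟩
  | single i v =>
    rw [adicSum_single]
    rcases i with _ | i
    · exact ⟨v, 0, by simp⟩
    · exact ⟨0, opLow v * opL u ^ i, by rw [opLow_zero, zero_add, pow_succ, mul_assoc]⟩

theorem pow_apply_of_eigen {L : DOp I} {y : Sm I} {s : ℝ} (h : L.1 y = s • y) (i : ℕ) :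
    (L ^ i).1 y = s ^ i • y := by
  induction i with
  | zero => simp [DOp.one_val]
  | succ i ih => rw [pow_succ, DOp.mul_apply, h, map_smul, ih, smul_smul, pow_succ']

/-- On an eigenfunction each power of `L` becomes a scalar, so an operator of any order collapses to
one of order `< n`, which a star-shaped curve can detect. -/
theorem adicSum_apply_of_eigen {L : DOp I} {y : Sm I} {s : ℝ} (h : L.1 y = s • y)
    (a : ℕ →₀ (Fin n → Sm I)) :
    (adicSum L a).1 y = (opLow (∑ i ∈ a.support, s ^ i • a i)).1 y := by
  rw [adicSum_eq_sum, DOp.sum_val, LinearMap.sum_apply]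
  have h2 : opLow (∑ i ∈ a.support, s ^ i • a i) = ∑ i ∈ a.support, s ^ i • opLow (a i) := by
    have := map_sum ({ toFun := opLow, map_zero' := opLow_zero, map_add' := opLow_add } :
      (Fin n → Sm I) →+ DOp I) (fun i => s ^ i • a i) a.support
    simpa only [AddMonoidHom.coe_mk, ZeroHom.coe_mk, opLow_smul] using this
  rw [h2, DOp.sum_val, LinearMap.sum_apply]
  refine Finset.sum_congr rfl fun i _ => ?_
  rw [DOp.mul_apply, pow_apply_of_eigen h, map_smul, DOp.smul_val, LinearMap.smul_apply]

end Operators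

/-! ### Star-shaped curves -/

section Curves

variable {I : Opens ℝ} {n : ℕ}

theorem StarCurve.ev_det_ne_zero (γ : StarCurve n I) (x : I) : ev x (W γ.1).det ≠ 0 := by
  rw [ev_det_W]; exact γ.2 x

theorem StarCurve.isUnit_det (γ : StarCurve n I) : IsUnit (W γ.1).det :=
  isUnit_of_ev_ne_zero γ.ev_det_ne_zero

/-- The coordinates of `y` in the frame `γ, γ⁽¹⁾, …`. -/
def frameCoord (γ y : Fin n → Sm I) : Fin n → Sm I := Matrix.vecMul y (W γ)⁻¹

theorem sum_mul_eq_vecMul (γ a : Fin n → Sm I) (j : Fin n) :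
    ∑ k, a k * (D I ^ (k : ℕ)) (γ j) = Matrix.vecMul a (W γ) j := rfl

theorem StarCurve.frameCoord_spec (γ : StarCurve n I) (y : Fin n → Sm I) (j : Fin n) :
    ∑ k, frameCoord γ.1 y k * (D I ^ (k : ℕ)) (γ.1 j) = y j := by
  rw [sum_mul_eq_vecMul, frameCoord, Matrix.vecMul_vecMul, Matrix.nonsing_inv_mul _ γ.isUnit_det,
    Matrix.vecMul_one]

theorem StarCurve.frameCoord_unique (γ : StarCurve n I) {a y : Fin n → Sm I}
    (h : ∀ j, ∑ k, a k * (D I ^ (k : ℕ)) (γ.1 j) = y j) : a = frameCoord γ.1 y := by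
  have h2 : Matrix.vecMul a (W γ.1) = y := funext h
  rw [← h2, frameCoord, Matrix.vecMul_vecMul, Matrix.mul_nonsing_inv _ γ.isUnit_det,
    Matrix.vecMul_one]

/-- The values on the components of `γ` are the coefficient row multiplied by the invertible matrix
`W(γ)`. -/
theorem StarCurve.opLow_inj (γ : StarCurve n I) {a b : Fin n → Sm I}
    (h : ∀ j, (opLow a).1 (γ.1 j) = (opLow b).1 (γ.1 j)) : a = b := by
  rw [γ.frameCoord_unique (a := a) (y := fun j => (opLow a).1 (γ.1 j))
      fun j => (opLow_apply _ _).symm, γ.frameCoord_unique (a := b) (y := fun j => (opLow b).1 (γ.1 j))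
      fun j => (opLow_apply _ _).symm, funext h]

theorem curv_eq_neg_frameCoord (γ : Fin n → Sm I) :
    curv γ = - frameCoord γ fun j => (D I ^ n) (γ j) := rfl

theorem StarCurve.opL_curv_apply (γ : StarCurve n I) (j : Fin n) :
    (opL (curv γ.1)).1 (γ.1 j) = 0 := by
  rw [opL_apply, curv_eq_neg_frameCoord]
  simp only [Pi.neg_apply, neg_mul, Finset.sum_neg_distrib]
  rw [γ.frameCoord_spec, add_neg_cancel]

theorem StarCurve.curv_eq_of_opL (γ : StarCurve n I) {u : Fin n → Sm I}
    (h : ∀ j, (opL u).1 (γ.1 j) = 0) : curv γ.1 = u := by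
  rw [curv_eq_neg_frameCoord, neg_eq_iff_eq_neg]
  symm
  refine γ.frameCoord_unique fun j => ?_
  have := h j
  rw [opL_apply] at this
  simp only [Pi.neg_apply, neg_mul, Finset.sum_neg_distrib]
  rw [neg_eq_iff_add_eq_zero, add_comm]
  exact this

theorem Lop_cls (γ : StarCurve n I) : Lop γ.cls = opL (curv γ.1) := rfl

theorem curvature_cls (γ : StarCurve n I) : curvature γ.cls = curv γ.1 := rfl

theorem StarCurve.Lop_apply {γ : StarCurve n I} {c : CentroAffine n I} (h : γ.cls = c)
    (j : Fin n) : (Lop c).1 (γ.1 j) = 0 := by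
  subst h; exact γ.opL_curv_apply j

theorem exists_cls_eq (c : CentroAffine n I) : ∃ γ : StarCurve n I, γ.cls = c :=
  Quotient.exists_rep c

theorem StarCurve.exists_mulVec (γ : StarCurve n I) (Y : Fin n → Sm I) :
    Matrix.mulVec (W γ.1) (Matrix.mulVec (W γ.1)⁻¹ Y) = Y := by
  rw [Matrix.mulVec_mulVec, Matrix.mul_nonsing_inv _ γ.isUnit_det, Matrix.one_mulVec]

theorem StarCurve.mulVec_inj (γ : StarCurve n I) {Y : Fin n → Sm I}
    (h : Matrix.mulVec (W γ.1) Y = 0) : Y = 0 := by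
  have := congrArg (Matrix.mulVec (W γ.1)⁻¹) h
  rwa [Matrix.mulVec_mulVec, Matrix.nonsing_inv_mul _ γ.isUnit_det, Matrix.one_mulVec,
    Matrix.mulVec_zero] at this

/-- The solutions of `L y = 0` are the real linear combinations of the components of `γ`. -/
theorem StarCurve.exists_eq_sum_of_opL_eq_zero (hI : (I : Set ℝ).OrdConnected) (x₀ : I)
    (γ : StarCurve n I) {y : Sm I} (h : (opL (curv γ.1)).1 y = 0) :
    ∃ m : Fin n → ℝ, y = ∑ i, m i • γ.1 i := by
  rcases Nat.eq_zero_or_pos n with rfl | hn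
  · rw [opL_apply] at h
    exact ⟨0, by simpa using h⟩
  -- Variation of constants: these are the coefficients for which `y` and `∑ γ_j m_j` agree together
  -- with formal derivatives up to order `n - 1`. The aim is that the `m_j` are constant.
  set m := Matrix.mulVec (W γ.1)⁻¹ fun i => (D I ^ (i : ℕ)) y with hm
  have hm0 : ∀ i, i < n → ∑ j, (D I ^ i) (γ.1 j) * m j = (D I ^ i) y := fun i hi =>
    congrFun (γ.exists_mulVec fun i => (D I ^ (i : ℕ)) y) ⟨i, hi⟩
  -- Both sides solve the same equation of order `n`, so the relation extends to the row `i = n`,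
  -- which differentiation of the row `n - 1` requires.
  have hm1 : ∑ j, (D I ^ n) (γ.1 j) * m j = (D I ^ n) y := by
    have h1 : ∀ f : Sm I, (opL (curv γ.1)).1 f = 0 →
        (D I ^ n) f = - ∑ k, curv γ.1 k * (D I ^ (k : ℕ)) f := fun f hf => by
      rw [opL_apply] at hf; exact eq_neg_of_add_eq_zero_left hf
    simp only [h1 _ h, h1 _ (γ.opL_curv_apply _), neg_mul, Finset.sum_neg_distrib, Finset.sum_mul]
    rw [Finset.sum_comm]
    simp only [mul_assoc, ← Finset.mul_sum]
    congr 1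
    exact Finset.sum_congr rfl fun k _ => by rw [hm0 k k.2]
  have hm2 : ∀ i, i ≤ n → ∑ j, (D I ^ i) (γ.1 j) * m j = (D I ^ i) y := fun i hi => by
    rcases hi.lt_or_eq with hi | rfl
    · exact hm0 i hi
    · exact hm1
  -- Differentiating row `i` and subtracting row `i + 1` leaves `W(γ) m' = 0`.
  have hD : (fun j => D I (m j)) = 0 := by
    refine γ.mulVec_inj (funext fun i => ?_)
    have h1 := congrArg (D I) (hm0 i i.2)
    simp only [map_sum, D_mul, Finset.sum_add_distrib, ← D_pow_succ_apply] at h1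
    rw [hm2 (i + 1) i.2, add_eq_left] at h1
    exact h1
  refine ⟨fun j => ev x₀ (m j), ?_⟩
  have h0 := hm0 0 hn
  simp only [pow_zero, Module.End.one_apply] at h0
  rw [← h0]
  refine Finset.sum_congr rfl fun j _ => ?_
  rw [Algebra.smul_def, ← eq_algebraMap_of_D_eq_zero hI (congrFun hD j) x₀, mul_comm]

/-- The inhomogeneous equation `L y = f` has a solution. -/
theorem StarCurve.exists_opL_eq (hI : (I : Set ℝ).OrdConnected) (hn : 0 < n)
    (γ : StarCurve n I) (f : Sm I) : ∃ y, (opL (curv γ.1)).1 y = f := by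
  -- Variation of constants: `y = ∑ γ_j C_j` with `W(γ) C' = (0, …, 0, f)`, so that `f` first
  -- appears in the `n`-th derivative of `y`.
  set v : Fin n → Sm I := Matrix.mulVec (W γ.1)⁻¹ (Pi.single ⟨n - 1, by omega⟩ f)
  have hv : ∀ i (hi : i < n), ∑ j, (D I ^ i) (γ.1 j) * v j = if i = n - 1 then f else 0 := by
    intro i hi
    refine (congrFun (γ.exists_mulVec (Pi.single ⟨n - 1, by omega⟩ f)) ⟨i, hi⟩).trans ?_
    rw [Pi.single_apply]
    simp [Fin.ext_iff]
  choose C hC using fun j => exists_D_eq hI (v j)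
  set y := ∑ j, γ.1 j * C j
  have hlow : ∀ i, i < n → (D I ^ i) y = ∑ j, (D I ^ i) (γ.1 j) * C j := by
    intro i
    induction i with
    | zero => intro; rfl
    | succ i ih =>
      intro hi
      rw [D_pow_succ_apply, ih (by omega), map_sum]
      simp only [D_mul, Finset.sum_add_distrib, hC]
      rw [hv i (by omega), if_neg (by omega), add_zero]
      simp only [D_pow_succ_apply]
  have htop : (D I ^ n) y = (∑ j, (D I ^ n) (γ.1 j) * C j) + f := by
    have hD : ∀ g : Sm I, (D I ^ n) g = D I ((D I ^ (n - 1)) g) := fun g => by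
      rw [← D_pow_succ_apply, Nat.sub_add_cancel hn]
    rw [hD, hlow (n - 1) (by omega), map_sum]
    simp only [D_mul, Finset.sum_add_distrib, hC]
    rw [hv (n - 1) (by omega), if_pos rfl]
    simp only [hD]
  refine ⟨y, ?_⟩
  rw [opL_apply, htop]
  simp only [hlow _ (Fin.is_lt _), Finset.mul_sum]
  rw [Finset.sum_comm, add_right_comm, ← Finset.sum_add_distrib, add_eq_right]
  refine Finset.sum_eq_zero fun j _ => ?_
  have := γ.opL_curv_apply j
  rw [opL_apply] at this
  simp only [← mul_assoc]
  rw [← Finset.sum_mul, ← add_mul, this, zero_mul]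

/-- An operator that annihilates the components of `γ` is a left multiple of `L`. -/
theorem StarCurve.mem_span_iff (hn : 0 < n) (γ : StarCurve n I) (X : DOp I) :
    X ∈ Submodule.span (DOp I) {opL (curv γ.1)} ↔ ∀ j, X.1 (γ.1 j) = 0 := by
  rw [Submodule.mem_span_singleton]
  constructor
  · rintro ⟨Q, rfl⟩ j
    rw [smul_eq_mul, DOp.mul_apply, γ.opL_curv_apply, map_zero]
  · intro h
    obtain ⟨v, Q, rfl⟩ := exists_eq_opLow_add_mul hn (curv γ.1) X
    refine ⟨Q, ?_⟩
    have : v = 0 := γ.opLow_inj fun j => by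
      have := h j
      rw [DOp.add_val, LinearMap.add_apply, DOp.mul_apply, γ.opL_curv_apply, map_zero,
        add_zero] at this
      rw [this, opLow_zero]
      rfl
    rw [this, opLow_zero, zero_add, smul_eq_mul]

theorem W_rightMul (γ : Fin n → Sm I) (g : Matrix (Fin n) (Fin n) ℝ) :
    W (rightMul γ g) = W γ * g.map (algebraMap ℝ (Sm I)) := by
  ext i j : 2
  simp only [W, Matrix.of_apply, Matrix.mul_apply, Matrix.map_apply, pow_rightMul]

theorem cls_eq_iff (γ γ' : StarCurve n I) :
    γ.cls = γ'.cls ↔ ∃ g : GL (Fin n) ℝ, γ'.1 = rightMul γ.1 g.1 :=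
  Quotient.eq

/-- A star-shaped curve transformed by an invertible matrix. -/
def StarCurve.transform (γ : StarCurve n I) (g : GL (Fin n) ℝ) : StarCurve n I :=
  ⟨rightMul γ.1 g.1, fun x => by
    rw [← ev_det_W, W_rightMul, Matrix.det_mul, map_mul]
    refine mul_ne_zero (γ.ev_det_ne_zero x) ?_
    rw [← RingHom.mapMatrix_apply, ← RingHom.map_det]
    simpa using ((Matrix.isUnit_iff_isUnit_det _).1 g.isUnit).ne_zero⟩

theorem StarCurve.cls_transform (γ : StarCurve n I) (g : GL (Fin n) ℝ) :
    (γ.transform g).cls = γ.cls :=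
  ((cls_eq_iff _ _).2 ⟨g, rfl⟩).symm

theorem StarCurve.exists_eq_rightMul (hI : (I : Set ℝ).OrdConnected) (x₀ : I)
    (γ : StarCurve n I) {y : Fin n → Sm I} (h : ∀ j, (opL (curv γ.1)).1 (y j) = 0) :
    ∃ m : Matrix (Fin n) (Fin n) ℝ, y = rightMul γ.1 m := by
  choose m hm using fun j => γ.exists_eq_sum_of_opL_eq_zero hI x₀ (h j)
  exact ⟨Matrix.of fun i j => m j i, funext fun j => hm j⟩

/-- Equal curvature means that the components of one curve solve the equation of the other, hence
are real combinations of its components. The transition matrix is invertible because the Wronskian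
of the second curve at `x₀` is nonzero. -/
theorem curvature_injective (hI : (I : Set ℝ).OrdConnected) (x₀ : I) :
    Function.Injective (curvature (n := n) (I := I)) := by
  intro c c' h
  obtain ⟨γ, rfl⟩ := exists_cls_eq c
  obtain ⟨γ', rfl⟩ := exists_cls_eq c'
  rw [curvature_cls, curvature_cls] at h
  obtain ⟨m, hm⟩ := γ.exists_eq_rightMul hI x₀ (y := γ'.1) fun j => by
    rw [h]; exact γ'.opL_curv_apply j
  have hdet : IsUnit m.det := by
    have := γ'.ev_det_ne_zero x₀
    rw [hm, W_rightMul, Matrix.det_mul, map_mul, ← RingHom.mapMatrix_apply, ← RingHom.map_det]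
      at this
    simpa using right_ne_zero_of_mul this
  exact (cls_eq_iff _ _).2 ⟨Matrix.nonsingInvUnit m hdet, hm⟩

end Curves

/-! ### Linear differential equations depending on parameters -/

section UnitIntervalFunctions

open unitInterval BoundedContinuousFunction

/-- The Banach space of continuous functions on `[0, 1]`. -/
def CI (V : Type) [NormedAddCommGroup V] : Type := I →ᵇ V

variable {V : Type} [NormedAddCommGroup V]

instance : NormedAddCommGroup (CI V) := inferInstanceAs (NormedAddCommGroup (I →ᵇ V))

instance [NormedSpace ℝ V] : NormedSpace ℝ (CI V) := inferInstanceAs (NormedSpace ℝ (I →ᵇ V))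

instance [CompleteSpace V] : CompleteSpace (CI V) := inferInstanceAs (CompleteSpace (I →ᵇ V))

instance : FunLike (CI V) I V := inferInstanceAs (FunLike (I →ᵇ V) I V)

theorem CI.continuous (f : CI V) : Continuous f := BoundedContinuousFunction.continuous f

/-- A continuous function on `[0, 1]` as an element of the Banach space. -/
def CI.mk (f : I → V) (hf : Continuous f) : CI V := mkOfCompact ⟨f, hf⟩

theorem CI.mk_apply (f : I → V) (hf : Continuous f) (θ : I) : CI.mk f hf θ = f θ := rfl

theorem CI.ext {f g : CI V} (h : ∀ θ, f θ = g θ) : f = g := BoundedContinuousFunction.ext h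

theorem CI.sub_apply (f g : CI V) (θ : I) : (f - g) θ = f θ - g θ := rfl

theorem CI.norm_le {f : CI V} {C : ℝ} (hC : 0 ≤ C) (h : ∀ θ, ‖f θ‖ ≤ C) : ‖f‖ ≤ C :=
  (BoundedContinuousFunction.norm_le hC).2 h

theorem CI.norm_apply_le (f : CI V) (θ : I) : ‖f θ‖ ≤ ‖f‖ :=
  BoundedContinuousFunction.norm_coe_le_norm f θ

theorem CI.tendsto_iff {ι : Type*} {F : ι → CI V} {f : CI V} {l : Filter ι} :
    Filter.Tendsto F l (nhds f) ↔ TendstoUniformly (fun i => (F i : I → V)) f l :=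
  BoundedContinuousFunction.tendsto_iff_tendstoUniformly

end UnitIntervalFunctions

/-! ### Smooth dependence on parameters of functions on `[0, 1]` -/

section Slice

open unitInterval

/-- The function `θ ↦ B(q, θ)` on `[0, 1]`; zero if it is not continuous. -/
def slice {E V : Type} [NormedAddCommGroup V] (B : E × ℝ → V) (q : E) : CI V :=
  open Classical in
  if h : Continuous fun θ : I => B (q, θ) then CI.mk _ h else 0

variable {E V : Type} [NormedAddCommGroup E] [NormedSpace ℝ E] [NormedAddCommGroup V]
  [NormedSpace ℝ V]

theorem slice_apply {O : Set (E × ℝ)} {B : E × ℝ → V} (hB : ContinuousOn B O) {q : E}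
    (hq : ∀ θ : I, (q, (θ : ℝ)) ∈ O) (θ : I) : slice B q θ = B (q, θ) := by
  have h : Continuous fun θ : I => B (q, θ) :=
    hB.comp_continuous (by fun_prop) hq
  simp [slice, h, CI.mk_apply]

/-- Since `[0, 1]` is compact, joint continuity gives uniform convergence in `θ`; this is the
continuity of currying into `C([0, 1], V)`. -/
theorem continuousOn_slice {O : Set (E × ℝ)} {B : E × ℝ → V} (hB : ContinuousOn B O) {Q : Set E}
    (hQ : ∀ q ∈ Q, ∀ θ : I, (q, (θ : ℝ)) ∈ O) : ContinuousOn (slice B) Q := by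
  let G : C(Q × I, V) := ⟨fun p => B (p.1, p.2),
    hB.comp_continuous (by fun_prop) fun p => hQ _ p.1.2 _⟩
  rw [continuousOn_iff_continuous_domRestrict, continuous_iff_continuousAt]
  intro q
  have h1 := ContinuousMap.tendsto_iff_tendstoUniformly.1 (G.curry.continuous.tendsto q)
  refine CI.tendsto_iff.2 ?_
  convert h1 using 1
  · funext q' θ
    exact slice_apply hB (hQ q' q'.2) θ
  · funext θ
    exact slice_apply hB (hQ q q.2) θ

/-- `φ ↦ (e ↦ (θ ↦ φ(θ) e))`. -/
def pointwiseApply (E V : Type) [NormedAddCommGroup E] [NormedSpace ℝ E] [NormedAddCommGroup V]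
    [NormedSpace ℝ V] : CI (E →L[ℝ] V) →L[ℝ] (E →L[ℝ] CI V) :=
  LinearMap.mkContinuous₂
    (LinearMap.mk₂ ℝ (fun (φ : CI (E →L[ℝ] V)) (e : E) => CI.mk (fun θ => φ θ e) (φ.continuous.clm_apply continuous_const))
      (fun _ _ _ => rfl) (fun _ _ _ => rfl) (fun φ _ _ => CI.ext fun θ => (φ θ).map_add _ _)
      (fun _ φ _ => CI.ext fun θ => (φ θ).map_smul _ _)) 1 fun φ e => by
    refine CI.norm_le (by positivity) ?_
    intro θ
    rw [one_mul]
    exact ((φ θ).le_opNorm e).trans (by gcongr; exact φ.norm_apply_le θ)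

theorem pointwiseApply_apply (φ : CI (E →L[ℝ] V)) (e : E) (θ : I) :
    pointwiseApply E V φ e θ = φ θ e := rfl

/-- The mean value inequality on a small ball bounds the remainder at each `θ` by the oscillation of
`B'(·, θ)`, and continuity of `slice B'` makes this oscillation small uniformly in `θ`. -/
theorem hasFDerivAt_slice {O : Set (E × ℝ)} {B : E × ℝ → V} {B' : E × ℝ → E →L[ℝ] V}
    (hB : ContinuousOn B O) (hB' : ContinuousOn B' O)
    (hd : ∀ p ∈ O, HasFDerivAt (fun q => B (q, p.2)) (B' p) p.1) {Q : Set E} (hQo : IsOpen Q)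
    (hQ : ∀ q ∈ Q, ∀ θ : I, (q, (θ : ℝ)) ∈ O) {q : E} (hq : q ∈ Q) :
    HasFDerivAt (slice B) (pointwiseApply E V (slice B' q)) q := by
  rw [hasFDerivAt_iff_isLittleO, Asymptotics.isLittleO_iff]
  intro ε hε
  have hc : ContinuousAt (slice B') q := (continuousOn_slice hB' hQ).continuousAt (hQo.mem_nhds hq)
  obtain ⟨δ, hδ, h⟩ := Metric.eventually_nhds_iff_ball.1
    ((hc.eventually (Metric.ball_mem_nhds (slice B' q) hε)).and (hQo.mem_nhds hq))
  filter_upwards [Metric.ball_mem_nhds q hδ] with q' hq'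
  refine CI.norm_le (by positivity) ?_
  intro θ
  simp only [CI.sub_apply, pointwiseApply_apply]
  rw [slice_apply hB (hQ _ (h q' hq').2), slice_apply hB (hQ _ hq)]
  refine (convex_ball q δ).norm_image_sub_le_of_norm_hasFDerivWithin_le'
    (f := fun q => B (q, θ)) (f' := fun q => B' (q, θ))
    (fun x hx => (hd (x, θ) (hQ x (h x hx).2 θ)).hasFDerivWithinAt) (fun x hx => ?_)
    (Metric.mem_ball_self hδ) hq'
  have h1 := (h x hx).1
  rw [dist_eq_norm] at h1
  have h2 := (slice B' x - slice B' q).norm_apply_le θ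
  rw [CI.sub_apply, slice_apply hB' (hQ _ (h x hx).2)] at h2
  exact h2.trans h1.le

/-- Induction on the order of differentiability with the target `V` left free, because the
derivative of a slice is the slice of a function with values in `E →L[ℝ] V`. -/
theorem contDiffOn_slice (m : ℕ) {O : Set (E × ℝ)} (hO : IsOpen O) {B : E × ℝ → V}
    (hB : ContDiffOn ℝ m B O) {Q : Set E} (hQo : IsOpen Q)
    (hQ : ∀ q ∈ Q, ∀ θ : I, (q, (θ : ℝ)) ∈ O) : ContDiffOn ℝ m (slice B) Q := by
  induction m generalizing V with
  | zero =>
    exact contDiffOn_zero.2 (continuousOn_slice hB.continuousOn hQ)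
  | succ m ih =>
    have h1 : ContDiffOn ℝ m (fun p => (fderiv ℝ B p).comp (ContinuousLinearMap.inl ℝ E ℝ)) O :=
      (hB.fderiv_of_isOpen hO (m := m) (by simp)).clm_comp contDiffOn_const
    have hpa := ContinuousLinearMap.contDiff (n := m) (pointwiseApply E V)
    push_cast
    rw [contDiffOn_succ_iff_hasFDerivWithinAt_of_uniqueDiffOn hQo.uniqueDiffOn]
    refine ⟨by simp, fun q => pointwiseApply E V
      (slice (fun p => (fderiv ℝ B p).comp (ContinuousLinearMap.inl ℝ E ℝ)) q),
      hpa.comp_contDiffOn (ih h1), fun q hq => ?_⟩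
    refine (hasFDerivAt_slice hB.continuousOn h1.continuousOn (fun p hp => ?_) hQo hQ
      hq).hasFDerivWithinAt
    have hd : HasFDerivAt B (fderiv ℝ B p) p :=
      ((hB.differentiableOn (by simp)).differentiableAt (hO.mem_nhds hp)).hasFDerivAt
    exact HasFDerivAt.comp (g := B) (f := fun q : E => (q, p.2)) p.1 hd (hasFDerivAt_prodMk_left _ _)

end Slice

/-! ### Volterra integral equations on `[0, 1]` -/

section Volterra

open unitInterval

variable {V : Type} [NormedAddCommGroup V] [NormedSpace ℝ V]

/-- A continuous function on `[0, 1]`, extended to the real line. -/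
def lineExtend (f : CI V) (s : ℝ) : V := f (Set.projIcc 0 1 zero_le_one s)

theorem continuous_lineExtend (f : CI V) : Continuous (lineExtend f) :=
  f.continuous.comp continuous_projIcc

theorem lineExtend_coe (f : CI V) (θ : I) : lineExtend f θ = f θ := by
  rw [lineExtend, Set.projIcc_val]

theorem lineExtend_of_mem (f : CI V) {s : ℝ} (hs : s ∈ I) : lineExtend f s = f ⟨s, hs⟩ :=
  lineExtend_coe f ⟨s, hs⟩

theorem norm_lineExtend_le (f : CI V) (s : ℝ) : ‖lineExtend f s‖ ≤ ‖f‖ :=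
  f.norm_apply_le _

/-- The operator `f ↦ ∫₀^θ f`. -/
def primitive (V : Type) [NormedAddCommGroup V] [NormedSpace ℝ V] : CI V →L[ℝ] CI V :=
  LinearMap.mkContinuous
    { toFun := fun f => CI.mk (fun θ => ∫ s in (0 : ℝ)..θ, lineExtend f s)
        ((intervalIntegral.continuous_primitive
          (fun _ _ => (continuous_lineExtend f).intervalIntegrable _ _) 0).comp
            continuous_subtype_val)
      map_add' := fun f g => by
        refine CI.ext fun θ => ?_
        exact intervalIntegral.integral_add ((continuous_lineExtend f).intervalIntegrable _ _)
          ((continuous_lineExtend g).intervalIntegrable _ _)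
      map_smul' := fun r f => by
        refine CI.ext fun θ => ?_
        exact intervalIntegral.integral_smul r (lineExtend f) } 1 fun f => by
    refine CI.norm_le (by positivity) ?_
    intro θ
    refine (intervalIntegral.norm_integral_le_of_norm_le_const
      (fun s _ => norm_lineExtend_le f s)).trans ?_
    rw [sub_zero, abs_of_nonneg θ.2.1, mul_comm]
    exact mul_le_mul_of_nonneg_right θ.2.2 (norm_nonneg _)

/-- Pointwise application of operators to vectors. -/
def applyOp (V : Type) [NormedAddCommGroup V] [NormedSpace ℝ V] :
    CI (V →L[ℝ] V) →L[ℝ] (CI V →L[ℝ] CI V) :=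
  LinearMap.mkContinuous₂
    (LinearMap.mk₂ ℝ (fun (φ : CI (V →L[ℝ] V)) (f : CI V) => CI.mk (fun θ => φ θ (f θ)) (φ.continuous.clm_apply f.continuous))
      (fun _ _ _ => rfl) (fun _ _ _ => rfl) (fun φ _ _ => CI.ext fun θ => (φ θ).map_add _ _)
      (fun _ φ _ => CI.ext fun θ => (φ θ).map_smul _ _)) 1 fun φ f => by
    refine CI.norm_le (by positivity) ?_
    intro θ
    rw [one_mul]
    exact ((φ θ).le_opNorm _).trans
      (mul_le_mul (φ.norm_apply_le θ) (f.norm_apply_le θ) (norm_nonneg _) (norm_nonneg φ))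

/-- The Volterra operator `f ↦ ∫₀^θ B f`. -/
def volterra (V : Type) [NormedAddCommGroup V] [NormedSpace ℝ V] :
    CI (V →L[ℝ] V) →L[ℝ] (CI V →L[ℝ] CI V) :=
  (ContinuousLinearMap.compL ℝ (CI V) (CI V) (CI V) (primitive V)).comp (applyOp V)

theorem volterra_apply (B : CI (V →L[ℝ] V)) (f : CI V) (θ : I) :
    volterra V B f θ = ∫ s in (0 : ℝ)..θ, lineExtend B s (lineExtend f s) := rfl

/-- The `m`-th power is an iterated integral over a simplex of volume `θᵐ / m!`. The factorial makes
the Neumann series converge for every `B`, with no smallness condition, so the equation is solvable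
on the whole interval. -/
theorem norm_volterra_pow_apply_le (B : CI (V →L[ℝ] V)) (m : ℕ) (f : CI V) (θ : I) :
    ‖(volterra V B ^ m) f θ‖ ≤ ‖B‖ ^ m * ‖f‖ * ((θ : ℝ) ^ m / m.factorial) := by
  induction m generalizing θ with
  | zero => simpa using f.norm_apply_le θ
  | succ m ih =>
    rw [pow_succ', mul_apply_eq_comp, volterra_apply]
    have hcont : Continuous fun s : ℝ => ‖B‖ ^ (m + 1) * ‖f‖ * (s ^ m / m.factorial) := by
      fun_prop
    refine (intervalIntegral.norm_integral_le_of_norm_le θ.2.1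
      (Filter.Eventually.of_forall fun s hs => ?_) (hcont.intervalIntegrable _ _)).trans_eq ?_
    · have hs' : s ∈ I := ⟨hs.1.le, hs.2.trans θ.2.2⟩
      refine (ContinuousLinearMap.le_opNorm _ _).trans ?_
      refine (mul_le_mul (norm_lineExtend_le B s) ?_ (norm_nonneg _) (norm_nonneg _)).trans_eq
        (b := ‖B‖ * (‖B‖ ^ m * ‖f‖ * (s ^ m / m.factorial))) (by ring)
      rw [lineExtend_of_mem _ hs']
      exact ih ⟨s, hs'⟩
    · rw [intervalIntegral.integral_const_mul, intervalIntegral.integral_div, integral_pow,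
        Nat.factorial_succ]
      push_cast
      rw [zero_pow (Nat.succ_ne_zero m), sub_zero, div_div]

theorem isUnit_one_sub_volterra [CompleteSpace V] (B : CI (V →L[ℝ] V)) :
    IsUnit (1 - volterra V B) := by
  have hs : Summable fun m => volterra V B ^ m := by
    refine Summable.of_norm_bounded (Real.summable_pow_div_factorial ‖B‖) fun m => ?_
    refine ContinuousLinearMap.opNorm_le_bound _ (by positivity) fun f => ?_
    refine CI.norm_le (by positivity) ?_
    intro θ
    refine (norm_volterra_pow_apply_le B m f θ).trans ?_
    have : (θ : ℝ) ^ m ≤ 1 := pow_le_one₀ θ.2.1 θ.2.2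
    calc ‖B‖ ^ m * ‖f‖ * ((θ : ℝ) ^ m / m.factorial) ≤ ‖B‖ ^ m * ‖f‖ * (1 / m.factorial) := by
          gcongr
      _ = _ := by ring
  exact ⟨⟨_, _, hs.one_sub_mul_tsum_pow, hs.tsum_pow_mul_one_sub⟩, rfl⟩

/-- The solution of `z(θ) = v + ∫₀^θ B z`. -/
def volterraSol (v : V) (B : CI (V →L[ℝ] V)) : CI V :=
  Ring.inverse (1 - volterra V B) (CI.mk (fun _ => v) continuous_const)

variable [CompleteSpace V]

theorem volterraSol_apply (v : V) (B : CI (V →L[ℝ] V)) (θ : I) :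
    volterraSol v B θ = v + ∫ s in (0 : ℝ)..θ, lineExtend B s (lineExtend (volterraSol v B) s) := by
  have h : (1 - volterra V B) (volterraSol v B) = CI.mk (fun _ => v) continuous_const := by
    rw [volterraSol, ← mul_apply_eq_comp,
      Ring.mul_inverse_cancel _ (isUnit_one_sub_volterra B), one_apply_eq_self]
  have h2 := congrArg (fun f => f θ) h
  simp only [sub_apply, one_apply_eq_self,
    CI.sub_apply, CI.mk_apply, volterra_apply] at h2
  exact sub_eq_iff_eq_add.1 h2

theorem eq_volterraSol {v : V} {B : CI (V →L[ℝ] V)} {z : CI V}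
    (hz : ∀ θ : I, z θ = v + ∫ s in (0 : ℝ)..θ, lineExtend B s (lineExtend z s)) :
    z = volterraSol v B := by
  have h : (1 - volterra V B) z = CI.mk (fun _ => v) continuous_const := by
    refine CI.ext fun θ => ?_
    simp only [sub_apply, one_apply_eq_self,
      CI.sub_apply, CI.mk_apply, volterra_apply]
    exact sub_eq_iff_eq_add.2 (hz θ)
  rw [volterraSol, ← h, ← mul_apply_eq_comp,
    Ring.inverse_mul_cancel _ (isUnit_one_sub_volterra B), one_apply_eq_self]

/-- Inversion is smooth at the units of a Banach algebra, and the Volterra operator is linear and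
continuous in its coefficient. This is the source of all smooth dependence on parameters. -/
theorem contDiff_volterraSol (v : V) : ContDiff ℝ ∞ (volterraSol v) := by
  rw [contDiff_iff_contDiffAt]
  intro B
  obtain ⟨w, hw⟩ := isUnit_one_sub_volterra B
  have h1 : ContDiffAt ℝ ∞ Ring.inverse (1 - volterra V B) := hw ▸ contDiffAt_ringInverse ℝ w
  have h2 : ContDiffAt ℝ ∞ (fun B => 1 - volterra V B) B :=
    have h := ContinuousLinearMap.contDiff (n := ∞) (volterra V)
    contDiffAt_const.sub h.contDiffAt
  exact (h1.comp B h2).clm_apply contDiffAt_const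

end Volterra

/-- A linear differential equation whose coefficients depend smoothly on parameters has solutions
that depend smoothly on the parameters. -/
theorem exists_linearODE_solution {E V : Type} [NormedAddCommGroup E] [NormedSpace ℝ E]
    [NormedAddCommGroup V] [NormedSpace ℝ V] [CompleteSpace V] {U : Set E} (hU : IsOpen U)
    {I : Set ℝ} (hIo : IsOpen I) (hI : I.OrdConnected) {x₀ : ℝ} (hx₀ : x₀ ∈ I)
    {A : E × ℝ → V →L[ℝ] V} (hA : ContDiffOn ℝ ∞ A (U ×ˢ I)) (v : V) :
    ∃ y : E × ℝ → V, ContDiffOn ℝ ∞ y (U ×ˢ I) ∧ ∀ p ∈ U, y (p, x₀) = v ∧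
      ∀ x ∈ I, HasDerivAt (fun x => y (p, x)) (A (p, x) (y (p, x))) x := by
  -- The segment from `x₀` to `x` is rescaled to `[0, 1]`: `z(θ) = y(x₀ + (x - x₀)θ)` satisfies `z'
  -- = B z`. The endpoint `x` thereby becomes one more parameter, and smoothness in `(p, x)` is
  -- obtained at once.
  let B : (E × ℝ) × ℝ → V →L[ℝ] V := fun r =>
    (r.1.2 - x₀) • A (r.1.1, x₀ + (r.1.2 - x₀) * r.2)
  let κ : (E × ℝ) × ℝ → E × ℝ := fun r => (r.1.1, x₀ + (r.1.2 - x₀) * r.2)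
  have hκ : ContDiff ℝ ∞ κ := by fun_prop
  have hO : IsOpen (κ ⁻¹' (U ×ˢ I)) := (hU.prod hIo).preimage hκ.continuous
  have hB : ContDiffOn ℝ ∞ B (κ ⁻¹' (U ×ˢ I)) := by
    have h1 : ContDiff ℝ ∞ fun r : (E × ℝ) × ℝ => r.1.2 - x₀ := by fun_prop
    exact h1.contDiffOn.smul (hA.comp hκ.contDiffOn fun r hr => hr)
  have hseg : ∀ x ∈ I, ∀ θ : unitInterval, x₀ + (x - x₀) * θ ∈ I := fun x hx θ => by
    have := hI.convex.add_smul_sub_mem hx₀ hx θ.2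
    rwa [smul_eq_mul, mul_comm] at this
  have hQ : ∀ q ∈ U ×ˢ I, ∀ θ : unitInterval, (q, (θ : ℝ)) ∈ κ ⁻¹' (U ×ˢ I) := fun q hq θ =>
    ⟨hq.1, hseg _ hq.2 θ⟩
  have hslice : ContDiffOn ℝ ∞ (slice B) (U ×ˢ I) := contDiffOn_infty.2 fun m =>
    contDiffOn_slice m hO (hB.of_le (by exact_mod_cast le_top)) (hU.prod hIo) hQ
  have hBext : ∀ q ∈ U ×ˢ I, ∀ s ∈ unitInterval, lineExtend (slice B q) s = B (q, s) :=
    fun q hq s hs => by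
      rw [lineExtend_of_mem _ hs, slice_apply hB.continuousOn (hQ q hq)]
  let z : E × ℝ → CI V := fun q => volterraSol v (slice B q)
  have hz : ContDiffOn ℝ ∞ z (U ×ˢ I) := (contDiff_volterraSol v).comp_contDiffOn hslice
  have hzeq : ∀ q ∈ U ×ˢ I, ∀ θ : unitInterval,
      z q θ = v + ∫ s in (0 : ℝ)..θ, B (q, s) (lineExtend (z q) s) := fun q hq θ => by
    refine (volterraSol_apply v (slice B q) θ).trans ?_
    congr 1
    refine intervalIntegral.integral_congr fun s hs => ?_
    rw [Set.uIcc_of_le θ.2.1] at hs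
    simp only [hBext q hq s ⟨hs.1, hs.2.trans θ.2.2⟩]
    rfl
  let y : E × ℝ → V := fun q => z q 1
  have hev : ContDiff ℝ ∞ fun f : CI V => f (1 : unitInterval) :=
    IsBoundedLinearMap.contDiff ⟨⟨fun _ _ => rfl, fun _ _ => rfl⟩, 1, one_pos, fun f => by
      rw [one_mul]; exact f.norm_apply_le 1⟩
  have hy : ContDiffOn ℝ ∞ y (U ×ˢ I) := hev.comp_contDiffOn hz
  -- By uniqueness, the rescaled solution for the endpoint `x`, restricted to `[0, c]`, is the one
  -- for the endpoint `x₀ + (x - x₀)c`. This turns the equation in `θ` into an integral equation for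
  -- `y` itself.
  have hscale : ∀ p ∈ U, ∀ x ∈ I, ∀ c : unitInterval, y (p, x₀ + (x - x₀) * c) = z (p, x) c := by
    intro p hp x hx c
    have hc : (p, x₀ + (x - x₀) * c) ∈ U ×ˢ I := ⟨hp, hseg x hx c⟩
    let zc : CI V := CI.mk (fun θ => z (p, x) (c * θ))
      ((z (p, x)).continuous.comp (by fun_prop))
    have : zc = z (p, x₀ + (x - x₀) * c) := by
      refine eq_volterraSol fun θ => ?_
      refine (hzeq (p, x) ⟨hp, hx⟩ (c * θ)).trans ?_
      congr 1
      have h1 := intervalIntegral.smul_integral_comp_mul_left (a := 0) (b := θ)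
        (fun s => B ((p, x), s) (lineExtend (z (p, x)) s)) (c : ℝ)
      rw [mul_zero] at h1
      rw [Set.Icc.coe_mul, ← h1, ← intervalIntegral.integral_smul]
      refine intervalIntegral.integral_congr fun s hs => ?_
      rw [Set.uIcc_of_le θ.2.1] at hs
      have hs' : s ∈ unitInterval := ⟨hs.1, hs.2.trans θ.2.2⟩
      have h2 : (c : ℝ) * s ∈ unitInterval := (c * ⟨s, hs'⟩).2
      simp only [hBext _ hc s hs']
      rw [lineExtend_of_mem _ h2, lineExtend_of_mem _ hs']
      simp only [B, add_sub_cancel_left]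
      have h3 : zc ⟨s, hs'⟩ = z (p, x) ⟨c * s, h2⟩ := rfl
      rw [h3, ← mul_assoc (x - x₀)]
      simp only [smul_apply]
      rw [smul_smul, mul_comm (c : ℝ) (x - x₀)]
    have h4 := congrArg (fun f => f 1) this
    simp only [zc, CI.mk_apply, mul_one] at h4
    exact h4.symm
  have hyint : ∀ p ∈ U, ∀ x ∈ I, y (p, x) = v + ∫ s in x₀..x, A (p, s) (y (p, s)) := by
    intro p hp x hx
    refine (hzeq (p, x) ⟨hp, hx⟩ 1).trans ?_
    congr 1
    have h1 := intervalIntegral.smul_integral_comp_add_mul (a := 0) (b := 1)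
      (fun s => A (p, s) (y (p, s))) (x - x₀) x₀
    rw [mul_zero, add_zero, mul_one, add_sub_cancel] at h1
    rw [← h1, ← intervalIntegral.integral_smul, Set.Icc.coe_one]
    refine intervalIntegral.integral_congr fun s hs => ?_
    rw [Set.uIcc_of_le zero_le_one] at hs
    rw [lineExtend_of_mem _ hs]
    simp only [B, smul_apply]
    rw [← hscale p hp x hx ⟨s, hs⟩]
  refine ⟨y, hy, fun p hp => ⟨by simpa using hyint p hp x₀ hx₀, fun x hx => ?_⟩⟩
  have hc : ContinuousOn (fun s => A (p, s) (y (p, s))) I := by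
    have h1 : ContinuousOn (fun s : ℝ => (p, s)) I := by fun_prop
    have h2 : Set.MapsTo (fun s : ℝ => (p, s)) I (U ×ˢ I) := fun s hs => ⟨hp, hs⟩
    exact (hA.continuousOn.comp h1 h2).clm_apply (hy.continuousOn.comp h1 h2)
  have hd := intervalIntegral.integral_hasDerivAt_right (a := x₀) (b := x)
    ((hc.mono (hI.uIcc_subset hx₀ hx)).intervalIntegrable)
    (hc.stronglyMeasurableAtFilter hIo x hx) (hc.continuousAt (hIo.mem_nhds hx))
  refine (hd.const_add v).congr_of_eventuallyEq ?_
  filter_upwards [hIo.mem_nhds hx] with x' hx'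
  exact hyint p hp x' hx'

/-! ### Star-shaped curves with prescribed curvature -/

section Prescribed

variable {n : ℕ}

/-- The shift `y ↦ (y₁, …, y_{n-1}, 0)`. -/
def companionShift (n : ℕ) : (Fin n → ℝ) →L[ℝ] (Fin n → ℝ) :=
  LinearMap.toContinuousLinearMap
    { toFun := fun y i => if h : (i : ℕ) + 1 < n then y ⟨i + 1, h⟩ else 0
      map_add' := fun y z => by funext i; by_cases h : (i : ℕ) + 1 < n <;> simp [h]
      map_smul' := fun r y => by funext i; by_cases h : (i : ℕ) + 1 < n <;> simp [h] }

/-- The map `y ↦ (0, …, 0, -y_k)`. -/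
def companionRow (k : Fin n) : (Fin n → ℝ) →L[ℝ] (Fin n → ℝ) :=
  LinearMap.toContinuousLinearMap
    { toFun := fun y i => if (i : ℕ) + 1 < n then 0 else - y k
      map_add' := fun y z => by
        funext i; by_cases h : (i : ℕ) + 1 < n <;> simp [h]; ring
      map_smul' := fun r y => by funext i; by_cases h : (i : ℕ) + 1 < n <;> simp [h] }

theorem companionShift_apply (y : Fin n → ℝ) (i : Fin n) :
    companionShift n y i = if h : (i : ℕ) + 1 < n then y ⟨i + 1, h⟩ else 0 := rfl

theorem companionRow_apply (k : Fin n) (y : Fin n → ℝ) (i : Fin n) :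
    companionRow k y i = if (i : ℕ) + 1 < n then 0 else - y k := rfl

/-- The matrix of the first-order system equivalent to a scalar equation with coefficients `a`. -/
def companion (a : Fin n → ℝ) : (Fin n → ℝ) →L[ℝ] (Fin n → ℝ) :=
  companionShift n + ∑ k, a k • companionRow k

theorem companion_apply_of_lt (a y : Fin n → ℝ) (i : Fin n) (h : (i : ℕ) + 1 < n) :
    companion a y i = y ⟨i + 1, h⟩ := by
  simp [companion, companionShift_apply, companionRow_apply, h]

theorem companion_apply_last (a y : Fin n → ℝ) (i : Fin n) (h : (i : ℕ) + 1 = n) :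
    companion a y i = - ∑ k, a k * y k := by
  have hlt : ¬ (i : ℕ) + 1 < n := by omega
  simp [companion, companionShift_apply, companionRow_apply, hlt]

/-- A solution of a linear differential equation that vanishes somewhere is zero. -/
theorem linearODE_eq_zero {V : Type} [NormedAddCommGroup V] [NormedSpace ℝ V] [CompleteSpace V]
    {I : Set ℝ} (hIo : IsOpen I) (hI : I.OrdConnected) {A : ℝ → V →L[ℝ] V}
    (hA : ContDiffOn ℝ ∞ A I) {y : ℝ → V} (hy : ∀ x ∈ I, HasDerivAt y (A x (y x)) x)
    {x₀ x₁ : ℝ} (hx₀ : x₀ ∈ I) (hx₁ : x₁ ∈ I) (h : y x₁ = 0) : y x₀ = 0 := by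
  -- `Z` solves the adjoint equation `Z' = -Z A` with `Z(x₀) = 1`, so that `Z y` is constant. The
  -- parameter space is a dummy, evaluated at `0`.
  obtain ⟨Z, -, hZ⟩ := exists_linearODE_solution (E := ℝ) (U := Set.univ) isOpen_univ hIo hI hx₀
    (A := fun p => - (ContinuousLinearMap.compL ℝ V V V).flip (A p.2))
    (by
      have h1 : ContDiffOn ℝ ∞ (fun p : ℝ × ℝ => A p.2) (Set.univ ×ˢ I) :=
        hA.comp contDiff_snd.contDiffOn fun p hp => hp.2
      exact (((ContinuousLinearMap.compL ℝ V V V).flip).contDiff.comp_contDiffOn h1).neg)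
    (ContinuousLinearMap.id ℝ V)
  obtain ⟨hZ0, hZ1⟩ := hZ 0 trivial
  have hd : ∀ x ∈ I, HasDerivWithinAt (fun x => Z (0, x) (y x)) 0 I x := fun x hx => by
    have h2 := (hZ1 x hx).clm_apply (hy x hx)
    simp only [_root_.neg_apply, ContinuousLinearMap.flip_apply,
      ContinuousLinearMap.compL_apply, ContinuousLinearMap.comp_apply, neg_add_cancel] at h2
    exact h2.hasDerivWithinAt
  have := hI.convex.norm_image_sub_le_of_norm_hasDerivWithin_le (C := 0) hd (by simp) hx₁ hx₀
  rw [zero_mul, norm_le_zero_iff, sub_eq_zero, hZ0, h, map_zero] at this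
  exact this

/-- A smooth family of coefficients is the curvature of a smooth family of star-shaped curves. -/
theorem exists_starCurve_family {E : Type} [NormedAddCommGroup E] [NormedSpace ℝ E] {U : Set E}
    (hU : IsOpen U) {I : Opens ℝ} (hI : (I : Set ℝ).OrdConnected) (x₀ : I) (hn : 0 < n)
    (γ₀ : StarCurve n I) {u : E → Fin n → Sm I} (hu : ∀ k, JointC ∞ U fun p => u p k) :
    ∃ γ : E → StarCurve n I, (∀ j, JointC ∞ U fun p => (γ p).1 j) ∧
      ∀ p ∈ U, curv (γ p).1 = u p := by
  classical
  let A : E × ℝ → (Fin n → ℝ) →L[ℝ] (Fin n → ℝ) := fun p =>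
    companion fun k => ext (u p.1 k).1 p.2
  have hA : ContDiffOn ℝ ∞ A (U ×ˢ (I : Set ℝ)) :=
    contDiffOn_const.add (ContDiffOn.sum fun k _ => (hu k 0).smul contDiffOn_const)
  -- The `j`-th solution of the companion system starts at the `j`-th basis vector at `x₀`, and its
  -- `i`-th entry will be the `i`-th derivative of `γ_j`.
  choose Y hYs hY using fun j : Fin n =>
    exists_linearODE_solution hU I.isOpen hI x₀.2 hA (Pi.single j 1)
  have hYc : ∀ j i, ContDiffOn ℝ ∞ (fun q => Y j q i) (U ×ˢ (I : Set ℝ)) := fun j i =>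
    contDiffOn_pi.1 (hYs j) i
  have hYx : ∀ p ∈ U, ∀ j i, ContDiffOn ℝ ∞ (fun x => Y j (p, x) i) I := fun p hp j i =>
    (hYc j i).comp (contDiff_const.prodMk contDiff_id).contDiffOn fun x hx => ⟨hp, hx⟩
  have hYd : ∀ p ∈ U, ∀ j, ∀ x ∈ (I : Set ℝ), ∀ i,
      HasDerivAt (fun x => Y j (p, x) i) (A (p, x) (Y j (p, x)) i) x := fun p hp j x hx i =>
    hasDerivAt_pi.1 ((hY j p hp).2 x hx) i
  -- The curve `γ₀` only supplies a value off `U`, where nothing is claimed.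
  let g : E → Fin n → Sm I := fun p j =>
    if hp : p ∈ U then Sm.mk' (fun x => Y j (p, x) ⟨0, hn⟩) (hYx p hp j _) else γ₀.1 j
  have hg : ∀ p ∈ U, ∀ j (i : ℕ) (hi : i < n) (x : I),
      ev x ((D I ^ i) (g p j)) = Y j (p, x) ⟨i, hi⟩ := by
    intro p hp j i
    induction i with
    | zero =>
      intro hi x
      simp only [g, dif_pos hp]
      exact ev_mk' _ _ x
    | succ i ih =>
      intro hi x
      rw [D_pow_succ_apply, ev_D_eq (ih (by omega)) (hYd p hp j x x.2 _)]
      exact companion_apply_of_lt _ _ _ hi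
  have htop : ∀ p ∈ U, ∀ j, (opL (u p)).1 (g p j) = 0 := by
    intro p hp j
    refine Sm.ext_ev fun x => ?_
    have h1 : ev x ((D I ^ n) (g p j)) = - ∑ k, ev x (u p k) * Y j (p, x) k := by
      have hD : (D I ^ n) (g p j) = D I ((D I ^ (n - 1)) (g p j)) := by
        rw [← D_pow_succ_apply, Nat.sub_add_cancel hn]
      rw [hD, ev_D_eq (hg p hp j (n - 1) (by omega)) (hYd p hp j x x.2 _)]
      refine (companion_apply_last _ _ _ (Nat.sub_add_cancel hn)).trans ?_
      simp only [ext_coe, ev_apply]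
    rw [opL_apply, map_add, h1, map_sum]
    simp only [map_mul, hg p hp j _ (Fin.is_lt _)]
    simp
  -- A kernel vector `v` of the Wronskian matrix at `x` gives a solution of the system that vanishes
  -- at `x`, hence also at `x₀`; but there its value is `v`.
  have hdet : ∀ p ∈ U, ∀ x : I, (Matrix.of fun i j => (W (g p) i j).1 x).det ≠ 0 := by
    intro p hp x hdet
    obtain ⟨v, hv0, hv⟩ := Matrix.exists_mulVec_eq_zero_iff.2 hdet
    have hsol : ∀ x ∈ (I : Set ℝ), HasDerivAt (fun x => ∑ j, v j • Y j (p, x))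
        (A (p, x) (∑ j, v j • Y j (p, x))) x := by
      intro x hx
      rw [map_sum]
      simp only [map_smul]
      exact HasDerivAt.fun_sum fun j _ => ((hY j p hp).2 x hx).const_smul (v j)
    have hAx : ContDiffOn ℝ ∞ (fun x => A (p, x)) I :=
      hA.comp (contDiff_const.prodMk contDiff_id).contDiffOn fun x hx => ⟨hp, hx⟩
    have h0 : ∑ j, v j • Y j (p, x) = 0 := by
      funext i
      have h1 := congrFun hv i
      simp only [Matrix.mulVec, dotProduct, Matrix.of_apply, Pi.zero_apply] at h1
      rw [Finset.sum_apply, Pi.zero_apply, ← h1]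
      refine Finset.sum_congr rfl fun j _ => ?_
      rw [Pi.smul_apply, smul_eq_mul, mul_comm, ← hg p hp j i i.2 x]
      rfl
    have h2 := linearODE_eq_zero I.isOpen hI hAx hsol x₀.2 x.2 h0
    refine hv0 (funext fun i => ?_)
    have h3 := congrFun h2 i
    rw [Finset.sum_apply] at h3
    simp only [(hY _ p hp).1] at h3
    simpa [Pi.single_apply] using h3
  let γ : E → StarCurve n I := fun p => if hp : p ∈ U then ⟨g p, hdet p hp⟩ else γ₀
  have hγ : ∀ p ∈ U, (γ p).1 = g p := fun p hp => by
    have h : γ p = (⟨g p, hdet p hp⟩ : StarCurve n I) := dif_pos hp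
    rw [h]
  refine ⟨γ, fun j => ?_, fun p hp => ?_⟩
  · refine JointC.congr (f := fun p => g p j) ?_ fun p hp => congrFun (hγ p hp) j
    rw [jointC_infty_iff hU]
    refine (hYc j ⟨0, hn⟩).congr fun q hq => ?_
    rw [ext_eq_ev _ (show q.2 ∈ I from hq.2)]
    exact hg q.1 hq.1 j 0 hn _
  · exact (γ p).curv_eq_of_opL fun j => by rw [hγ p hp]; exact htop p hp j

end Prescribed

/-! ### Derivatives in the parameter -/

section TimeDerivative

variable {I J : Opens ℝ}

theorem JointC.comp {E E' : Type*} [NormedAddCommGroup E] [NormedSpace ℝ E]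
    [NormedAddCommGroup E'] [NormedSpace ℝ E'] {r : WithTop ℕ∞} {U : Set E} {U' : Set E'}
    {f : E → Sm I} (hf : JointC r U f) {φ : E' → E} (hφ : ContDiffOn ℝ r φ U')
    (hU : Set.MapsTo φ U' U) : JointC r U' fun p => f (φ p) := fun k =>
  (hf k).comp (f := fun p : E' × ℝ => (φ p.1, p.2))
    ((hφ.comp contDiff_fst.contDiffOn fun _ hp => hp.1).prodMk contDiff_snd.contDiffOn)
    fun _ hp => ⟨hU hp.1, hp.2⟩

theorem hasDerivAt_fst_of_contDiffOn {O : Set (ℝ × ℝ)} (hO : IsOpen O) {F : ℝ × ℝ → ℝ}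
    (hF : ContDiffOn ℝ ∞ F O) {q : ℝ × ℝ} (hq : q ∈ O) :
    HasDerivAt (fun t => F (t, q.2)) (fderiv ℝ F q (1, 0)) q.1 := by
  have hd : HasFDerivAt F (fderiv ℝ F q) q :=
    ((hF.differentiableOn (by simp)).differentiableAt (hO.mem_nhds hq)).hasFDerivAt
  exact HasFDerivAt.comp_hasDerivAt (f := fun t : ℝ => (t, q.2)) q.1 hd
    ((hasDerivAt_id _).prodMk (hasDerivAt_const _ _))

theorem hasDerivAt_snd_of_contDiffOn {O : Set (ℝ × ℝ)} (hO : IsOpen O) {F : ℝ × ℝ → ℝ}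
    (hF : ContDiffOn ℝ ∞ F O) {q : ℝ × ℝ} (hq : q ∈ O) :
    HasDerivAt (fun x => F (q.1, x)) (fderiv ℝ F q (0, 1)) q.2 := by
  have hd : HasFDerivAt F (fderiv ℝ F q) q :=
    ((hF.differentiableOn (by simp)).differentiableAt (hO.mem_nhds hq)).hasFDerivAt
  exact HasFDerivAt.comp_hasDerivAt (f := fun x : ℝ => (q.1, x)) q.2 hd
    ((hasDerivAt_const _ _).prodMk (hasDerivAt_id _))

theorem fderiv_apply_comm {O : Set (ℝ × ℝ)} (hO : IsOpen O) {F : ℝ × ℝ → ℝ}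
    (hF : ContDiffOn ℝ ∞ F O) {q : ℝ × ℝ} (hq : q ∈ O) (v w : ℝ × ℝ) :
    fderiv ℝ (fun p => fderiv ℝ F p v) q w = fderiv ℝ (fun p => fderiv ℝ F p w) q v := by
  have hat : ContDiffAt ℝ ∞ F q := hF.contDiffAt (hO.mem_nhds hq)
  have hd : DifferentiableAt ℝ (fderiv ℝ F) q :=
    (hat.fderiv_right (m := ∞) (by simp)).differentiableAt (by simp)
  have h1 : ∀ v w : ℝ × ℝ, fderiv ℝ (fun p => fderiv ℝ F p v) q w =
      fderiv ℝ (fderiv ℝ F) q w v := fun v w => by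
    rw [fderiv_clm_apply hd (differentiableAt_const _)]
    simp
  rw [h1, h1]
  exact (hat.isSymmSndFDerivAt (by
    simpa using! WithTop.coe_le_coe.2 (le_top : (2 : ℕ∞) ≤ ⊤))).eq w v

/-- The symmetry of second derivatives lets `∂ₜ` pass through every power of `∂ₓ`. So a jointly
smooth family is a `C¹` curve in `C^∞(I)`, and its derivative is again jointly smooth. -/
theorem JointC.exists_timeDeriv {f : ℝ → Sm I} (hf : JointC ∞ (J : Set ℝ) f) :
    ∃ f' : ℝ → Sm I, JointC ∞ (J : Set ℝ) f' ∧ HasC1Deriv J f f' := by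
  classical
  set O : Set (ℝ × ℝ) := (J : Set ℝ) ×ˢ (I : Set ℝ) with hOdef
  have hO : IsOpen O := J.isOpen.prod I.isOpen
  set F : ℕ → ℝ × ℝ → ℝ := fun k p => ext ((StarShaped.D I ^ k) (f p.1)).1 p.2 with hF
  have hFs : ∀ k, ContDiffOn ℝ ∞ (F k) O := hf
  have hG : ∀ k v, ContDiffOn ℝ ∞ (fun p => fderiv ℝ (F k) p v) O := fun k v =>
    ((hFs k).fderiv_of_isOpen hO (m := ∞) (by simp)).clm_apply contDiffOn_const
  have hFx : ∀ k, ∀ q ∈ O, fderiv ℝ (F k) q (0, 1) = F (k + 1) q := by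
    intro k q hq
    have hx : q.2 ∈ I := hq.2
    refine (hasDerivAt_snd_of_contDiffOn hO (hFs k) hq).unique ?_
    have h1 := hasDerivAt_ext ((StarShaped.D I ^ k) (f q.1)) ⟨q.2, hx⟩
    simp only [hF, D_pow_succ_apply, ext_eq_ev _ hx]
    exact h1
  let f' : ℝ → Sm I := fun t =>
    if ht : t ∈ J then Sm.mk' (fun x => fderiv ℝ (F 0) (t, x) (1, 0))
      ((hG 0 (1, 0)).comp (contDiff_const.prodMk contDiff_id).contDiffOn fun x hx => ⟨ht, hx⟩)
    else 0
  have hf' : ∀ q ∈ O, ext (f' q.1).1 q.2 = fderiv ℝ (F 0) q (1, 0) := fun q hq => by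
    have hx : q.2 ∈ I := hq.2
    have ht : q.1 ∈ J := hq.1
    rw [ext_eq_ev _ hx]
    simp only [f', dif_pos ht]
    exact ev_mk' _ _ _
  have hs' : JointC ∞ (J : Set ℝ) f' := by
    rw [jointC_infty_iff J.isOpen]
    exact (hG 0 (1, 0)).congr hf'
  have hk : ∀ k, ∀ q ∈ O, ext ((StarShaped.D I ^ k) (f' q.1)).1 q.2 = fderiv ℝ (F k) q (1, 0) := by
    intro k
    induction k with
    | zero => exact hf'
    | succ k ih =>
      intro q hq
      have hx : q.2 ∈ I := hq.2
      have h1 : HasDerivAt (fun x => ext ((StarShaped.D I ^ k) (f' q.1)).1 x)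
          (ext ((StarShaped.D I ^ (k + 1)) (f' q.1)).1 q.2) q.2 := by
        simp only [D_pow_succ_apply, ext_eq_ev _ hx]
        exact hasDerivAt_ext ((StarShaped.D I ^ k) (f' q.1)) ⟨q.2, hx⟩
      have h2 := hasDerivAt_snd_of_contDiffOn hO (hG k (1, 0)) hq
      have h3 : (fun x => fderiv ℝ (F k) (q.1, x) (1, 0)) =ᶠ[nhds q.2]
          fun x => ext ((StarShaped.D I ^ k) (f' q.1)).1 x := by
        filter_upwards [I.isOpen.mem_nhds hx] with x hx'
        exact (ih (q.1, x) ⟨hq.1, hx'⟩).symm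
      rw [h1.unique (h2.congr_of_eventuallyEq h3.symm), fderiv_apply_comm hO (hFs k) hq]
      have h4 : (fun p => fderiv ℝ (F k) p (0, 1)) =ᶠ[nhds q] F (k + 1) := by
        filter_upwards [hO.mem_nhds hq] with p hp using hFx k p hp
      rw [h4.fderiv_eq]
  refine ⟨f', hs', fun k => ⟨fun t ht x => ?_, (hs' k).continuousOn⟩⟩
  have h1 := hasDerivAt_fst_of_contDiffOn hO (hFs k) (q := (t, x)) ⟨ht, x.2⟩
  rw [← hk k (t, x) ⟨ht, x.2⟩] at h1
  simp only [hF, ext_coe] at h1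
  exact h1

theorem HasC1Deriv.hasDerivAt {f f' : ℝ → Sm I} (h : HasC1Deriv J f f') {t : ℝ} (ht : t ∈ J)
    (k : ℕ) (x : I) :
    HasDerivAt (fun s => ev x ((D I ^ k) (f s))) (ev x ((D I ^ k) (f' t))) t :=
  (h k).1 t ht x

end TimeDerivative

/-! ### The derivative of the curvature -/

section Curvature

variable {I J : Opens ℝ} {n : ℕ}

theorem IsSmoothLift.jointC {c : ℝ → CentroAffine n I} {γ : ℝ → StarCurve n I}
    (h : IsSmoothLift J c γ) (j : Fin n) : JointC ∞ (J : Set ℝ) fun t => (γ t).1 j :=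
  jointC_iff_jointSmooth.2 (h.1 j)

theorem IsAdmissible.jointC_curvature {c : ℝ → CentroAffine n I} (h : IsAdmissible J c)
    (k : Fin n) : JointC ∞ (J : Set ℝ) fun t => curvature (c t) k := by
  obtain ⟨γ, hγ⟩ := h
  refine JointC.congr (JointC.curv J.isOpen hγ.jointC (fun t _ => (γ t).ev_det_ne_zero) k)
    fun t ht => ?_
  rw [← hγ.2 t ht]
  rfl

theorem IsSmoothLift.exists_isC1Lift {c : ℝ → CentroAffine n I} {γ : ℝ → StarCurve n I}
    (h : IsSmoothLift J c γ) : ∃ γ' : ℝ → Fin n → Sm I,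
      (∀ j, JointC ∞ (J : Set ℝ) fun t => γ' t j) ∧ IsC1Lift J c γ γ' := by
  choose g hg hg' using fun j => (h.jointC j).exists_timeDeriv
  exact ⟨fun t j => g j t, hg, hg', h.2⟩

/-- Differentiating `L γ = 0` in the parameter. -/
theorem Lop_apply_deriv {c : ℝ → CentroAffine n I} {γ : ℝ → StarCurve n I}
    {t : ℝ} (hc : ∀ᶠ s in nhds t, (γ s).cls = c s) {v : Fin n → Sm I}
    (hv : ∀ k, ∀ x : I, HasDerivAt (fun s => ev x (curvature (c s) k)) (ev x (v k)) t)
    {y : Sm I} {j : Fin n}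
    (hy : ∀ k, ∀ x : I, HasDerivAt (fun s => ev x ((D I ^ k) ((γ s).1 j))) (ev x ((D I ^ k) y)) t) :
    (Lop (c t)).1 y = - (opLow v).1 ((γ t).1 j) := by
  refine Sm.ext_ev fun x => ?_
  have h0 : (fun s => ev x ((Lop (c s)).1 ((γ s).1 j))) =ᶠ[nhds t] fun _ => 0 := by
    filter_upwards [hc] with s hs
    rw [StarCurve.Lop_apply hs, map_zero]
  have h1 : HasDerivAt (fun s => ev x ((D I ^ n) ((γ s).1 j)) +
      ∑ k : Fin n, ev x (curvature (c s) k) * ev x ((D I ^ (k : ℕ)) ((γ s).1 j)))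
      (ev x ((D I ^ n) y) + ∑ k : Fin n, (ev x (v k) * ev x ((D I ^ (k : ℕ)) ((γ t).1 j)) +
        ev x (curvature (c t) k) * ev x ((D I ^ (k : ℕ)) y))) t :=
    (hy n x).add (HasDerivAt.fun_sum fun k _ => (hv k x).mul (hy k x))
  have h2 : (fun s => ev x ((Lop (c s)).1 ((γ s).1 j))) = (fun s => ev x ((D I ^ n) ((γ s).1 j)) +
      ∑ k : Fin n, ev x (curvature (c s) k) * ev x ((D I ^ (k : ℕ)) ((γ s).1 j))) := by
    funext s
    simp only [Lop, opL_apply, map_add, map_sum, map_mul]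
  rw [h2] at h0
  have h3 := h1.unique ((hasDerivAt_const t (0 : ℝ)).congr_of_eventuallyEq h0)
  rw [Finset.sum_add_distrib] at h3
  simp only [Lop, opL_apply, opLow_apply, map_add, map_sum, map_mul, map_neg]
  linarith

theorem IsC1Lift.Lop_apply_deriv {c : ℝ → CentroAffine n I} {γ : ℝ → StarCurve n I}
    {γ' : ℝ → Fin n → Sm I} (h : IsC1Lift J c γ γ') {t : ℝ} (ht : t ∈ J) {v : Fin n → Sm I}
    (hv : ∀ k, ∀ x : I, HasDerivAt (fun s => ev x (curvature (c s) k)) (ev x (v k)) t)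
    (j : Fin n) : (Lop (c t)).1 (γ' t j) = - (opLow v).1 ((γ t).1 j) :=
  StarShaped.Lop_apply_deriv
    (Filter.eventually_of_mem (J.isOpen.mem_nhds ht) h.2) hv
    fun k x => (h.1 j).hasDerivAt ht k x

end Curvature

/-! ### The tangent space -/

section TangentSpace

variable {I : Opens ℝ} {n : ℕ} {c₀ : CentroAffine n I}

theorem Deformation.exists_hasDerivAt (Γ : Deformation c₀) :
    ∃ v : Fin n → Sm I, ∀ k, ∀ x : I,
      HasDerivAt (fun t => ev x (curvature (Γ.path t) k)) (ev x (v k)) 0 := by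
  choose v _ hv using fun k => (Γ.admissible.jointC_curvature k).exists_timeDeriv
  exact ⟨fun k => v k 0, fun k x => (hv k).hasDerivAt Γ.zero_mem 0 x⟩

/-- The derivative of the curvature at `t = 0`, as a smooth function. -/
def Deformation.velocity (Γ : Deformation c₀) : Fin n → Sm I := Γ.exists_hasDerivAt.choose

theorem Deformation.hasDerivAt_velocity (Γ : Deformation c₀) (k : Fin n) (x : I) :
    HasDerivAt (fun t => ev x (curvature (Γ.path t) k)) (ev x (Γ.velocity k)) 0 :=
  Γ.exists_hasDerivAt.choose_spec k x

theorem Deformation.vel_eq (Γ : Deformation c₀) :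
    Γ.vel = fun k => (Γ.velocity k).1 :=
  funext fun k => funext fun x => (Γ.hasDerivAt_velocity k x).deriv

theorem Deformation.velocity_eq_iff (Γ Γ' : Deformation c₀) :
    Γ.velocity = Γ'.velocity ↔ Γ.tangent = Γ'.tangent := by
  have h : Γ.tangent = Γ'.tangent ↔ Γ.vel = Γ'.vel :=
    Quotient.eq (r := Setoid.ker (Deformation.vel (c₀ := c₀)))
  rw [h, vel_eq, vel_eq]
  exact ⟨fun h => by rw [h], fun h => funext fun k => Subtype.ext (congrFun h k)⟩

/-- The derivative of the curvature as a map on the tangent space. -/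
def Tangent.velocity (τ : Tangent c₀) : Fin n → Sm I :=
  Quotient.lift Deformation.velocity
    (fun Γ Γ' h => (Γ.velocity_eq_iff Γ').2 (Quotient.sound h)) τ

theorem Tangent.velocity_tangent (Γ : Deformation c₀) : Γ.tangent.velocity = Γ.velocity := rfl

theorem Tangent.exists_rep (τ : Tangent c₀) : ∃ Γ : Deformation c₀, Γ.tangent = τ :=
  Quotient.exists_rep τ

theorem Tangent.velocity_injective : Function.Injective (Tangent.velocity (c₀ := c₀)) := by
  intro τ τ' h
  obtain ⟨Γ, rfl⟩ := τ.exists_rep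
  obtain ⟨Γ', rfl⟩ := τ'.exists_rep
  exact (Deformation.velocity_eq_iff _ _).1 h

/-- A parametric family of deformations with curvature `u + t h`. -/
theorem exists_linear_deformation (hI : (I : Set ℝ).OrdConnected) (x₀ : I) (hn : 0 < n)
    {K : Set ℝ} (hK : IsOpen K) {h : ℝ → Fin n → Sm I} (hh : ∀ k, JointC ∞ K fun s => h s k) :
    ∃ γ : ℝ → ℝ → StarCurve n I,
      (∀ j, JointC ∞ (K ×ˢ (Set.univ : Set ℝ)) fun q : ℝ × ℝ => (γ q.1 q.2).1 j) ∧
      ∀ s ∈ K, ∀ t, curv (γ s t).1 = curvature c₀ + t • h s := by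
  obtain ⟨γ₀, hγ₀⟩ := exists_cls_eq c₀
  obtain ⟨γ, hγ, hu⟩ := exists_starCurve_family (hK.prod isOpen_univ) hI x₀ hn γ₀
    (u := fun q : ℝ × ℝ => curvature c₀ + q.2 • h q.1) fun k =>
      (jointC_const_of_contDiffOn le_rfl _).add (JointC.smul contDiff_snd.contDiffOn
        ((hh k).comp contDiff_fst.contDiffOn fun q hq => hq.1))
  exact ⟨fun s t => γ (s, t), hγ, fun s hs t => hu (s, t) ⟨hs, trivial⟩⟩

/-- The deformation of `c₀` defined by a smooth family of curves with curvature `u + t h`. -/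
def linearDeformation (hI : (I : Set ℝ).OrdConnected) (x₀ : I) (J : Opens ℝ) (hJ : (0 : ℝ) ∈ J)
    (hJc : (J : Set ℝ).OrdConnected) {h : Fin n → Sm I} (γ : ℝ → StarCurve n I)
    (hγ : ∀ j, JointC ∞ (J : Set ℝ) fun t => (γ t).1 j)
    (hu : ∀ t, curv (γ t).1 = curvature c₀ + t • h) : Deformation c₀ where
  J := J
  zero_mem := hJ
  ordConnected := hJc
  path t := (γ t).cls
  base := curvature_injective hI x₀ (by rw [curvature_cls, hu, zero_smul, add_zero])
  admissible := ⟨γ, fun j => jointC_iff_jointSmooth.1 (hγ j), fun _ _ => rfl⟩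

theorem linearDeformation_velocity (hI : (I : Set ℝ).OrdConnected) (x₀ : I) (J : Opens ℝ)
    (hJ : (0 : ℝ) ∈ J) (hJc : (J : Set ℝ).OrdConnected) {h : Fin n → Sm I}
    (γ : ℝ → StarCurve n I) (hγ : ∀ j, JointC ∞ (J : Set ℝ) fun t => (γ t).1 j)
    (hu : ∀ t, curv (γ t).1 = curvature c₀ + t • h) :
    (linearDeformation hI x₀ J hJ hJc γ hγ hu).velocity = h := by
  refine funext fun k => Sm.ext_ev fun x => ?_
  refine (Deformation.hasDerivAt_velocity _ k x).unique ?_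
  have h1 : HasDerivAt (fun t : ℝ => ev x (curvature c₀ k) + t * ev x (h k)) (ev x (h k)) 0 := by
    simpa using ((hasDerivAt_id (0 : ℝ)).mul_const (ev x (h k))).const_add (ev x (curvature c₀ k))
  have h2 : (fun t => ev x (curvature ((linearDeformation hI x₀ J hJ hJc γ hγ hu).path t) k)) =
      fun t : ℝ => ev x (curvature c₀ k) + t * ev x (h k) := by
    funext t
    simp [linearDeformation, curvature_cls, hu]
  rw [h2]
  exact h1

theorem Tangent.velocity_surjective (hI : (I : Set ℝ).OrdConnected) (x₀ : I) (hn : 0 < n) :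
    Function.Surjective (Tangent.velocity (c₀ := c₀)) := by
  intro h
  obtain ⟨γ, hγ, hu⟩ := exists_linear_deformation (c₀ := c₀) hI x₀ hn isOpen_univ
    (h := fun _ => h) fun k => jointC_const_of_contDiffOn le_rfl _
  have hγ' : ∀ j, JointC ∞ ((⊤ : Opens ℝ) : Set ℝ) fun t => (γ 0 t).1 j := fun j =>
    (hγ j).comp (φ := fun t : ℝ => ((0 : ℝ), t)) (contDiff_const.prodMk contDiff_id).contDiffOn
      fun _ _ => ⟨trivial, trivial⟩
  exact ⟨(linearDeformation hI x₀ ⊤ trivial Set.ordConnected_univ (γ 0) hγ' (hu 0 trivial)).tangent,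
    linearDeformation_velocity hI x₀ ⊤ trivial Set.ordConnected_univ (γ 0) hγ' (hu 0 trivial)⟩

/-- The tangent space is in bijection with `𝓕ⁿ`. -/
def velocityEquiv (c₀ : CentroAffine n I) (hI : (I : Set ℝ).OrdConnected) (x₀ : I) (hn : 0 < n) :
    Tangent c₀ ≃ (Fin n → Sm I) :=
  Equiv.ofBijective _ ⟨Tangent.velocity_injective, Tangent.velocity_surjective hI x₀ hn⟩

/-- In one direction the velocity is the partial derivative at `t = 0` of the curvature of `γ(s,
t)`, which is smooth in all variables. In the other, the curvatures `u + t h(s)` are realised by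
curves that depend smoothly on `s` and `t` together. -/
theorem isSmoothCurve_iff (hI : (I : Set ℝ).OrdConnected) (x₀ : I) (hn : 0 < n) (K : Opens ℝ)
    (σ : ℝ → Tangent c₀) :
    Tangent.IsSmoothCurve K σ ↔ ∀ k, JointSmooth K fun s => (σ s).velocity k := by
  constructor
  · rintro ⟨J, γ, hγ, hσ⟩ k
    -- For empty `K` there is no deformation to guarantee that `0 ∈ J`.
    rcases (K : Set ℝ).eq_empty_or_nonempty with hK | ⟨s₀, hs₀⟩
    · rw [JointSmooth, hK, Set.empty_prod]
      exact contDiffOn_empty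
    have hJ0 : (0 : ℝ) ∈ J := by
      obtain ⟨Γ, rfl, -⟩ := hσ s₀ hs₀
      exact Γ.zero_mem
    have hKJ : IsOpen ((K : Set ℝ) ×ˢ (J : Set ℝ)) := K.isOpen.prod J.isOpen
    have hγ' : ∀ j, JointC ∞ ((K : Set ℝ) ×ˢ (J : Set ℝ)) fun q : ℝ × ℝ => (γ q.1 q.2).1 j := by
      intro j
      rw [jointC_infty_iff hKJ]
      have hre : ContDiff ℝ ∞ fun p : (ℝ × ℝ) × ℝ => (p.1.1, p.1.2, p.2) := by fun_prop
      exact (hγ j).comp hre.contDiffOn fun p hp => ⟨hp.1.1, hp.1.2, hp.2⟩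
    have hcurv := (JointC.curv hKJ hγ' (fun q _ => (γ q.1 q.2).ev_det_ne_zero) k) 0
    set G : (ℝ × ℝ) × ℝ → ℝ := fun p => ext ((D I ^ 0) (curv (γ p.1.1 p.1.2).1 k)).1 p.2
    have hO : IsOpen (((K : Set ℝ) ×ˢ (J : Set ℝ)) ×ˢ (I : Set ℝ)) := hKJ.prod I.isOpen
    have hG' : ContDiffOn ℝ ∞ (fun p => fderiv ℝ G p ((0, 1), 0)) _ :=
      (hcurv.fderiv_of_isOpen hO (m := ∞) (by simp)).clm_apply contDiffOn_const
    have hre : ContDiff ℝ ∞ fun p : ℝ × ℝ => ((p.1, (0 : ℝ)), p.2) := by fun_prop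
    have hmap : Set.MapsTo (fun p : ℝ × ℝ => ((p.1, (0 : ℝ)), p.2)) ((K : Set ℝ) ×ˢ (I : Set ℝ))
        (((K : Set ℝ) ×ˢ (J : Set ℝ)) ×ˢ (I : Set ℝ)) := fun p hp => ⟨⟨hp.1, hJ0⟩, hp.2⟩
    refine (hG'.comp hre.contDiffOn hmap).congr fun p hp => ?_
    have hx : p.2 ∈ I := hp.2
    obtain ⟨Γ, hΓJ, hΓ, hs⟩ := hσ p.1 hp.1
    simp only [hs, Tangent.velocity_tangent, ext_eq_ev _ hx]
    refine (Γ.hasDerivAt_velocity k ⟨p.2, hx⟩).unique ?_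
    have hd : HasFDerivAt G (fderiv ℝ G ((p.1, 0), p.2)) ((p.1, 0), p.2) :=
      ((hcurv.differentiableOn (by simp)).differentiableAt
        (hO.mem_nhds (hmap hp))).hasFDerivAt
    have h1 := HasFDerivAt.comp_hasDerivAt (f := fun t : ℝ => ((p.1, t), p.2)) 0 hd
      (((hasDerivAt_const _ _).prodMk (hasDerivAt_id _)).prodMk (hasDerivAt_const _ _))
    refine h1.congr_of_eventuallyEq ?_
    filter_upwards [J.isOpen.mem_nhds hJ0] with t ht
    rw [hΓ t ht, curvature_cls]
    exact (ext_eq_ev _ hx).symm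
  · intro h
    obtain ⟨γ, hγ, hu⟩ := exists_linear_deformation (c₀ := c₀) hI x₀ hn K.isOpen
      (h := fun s => (σ s).velocity) fun k => jointC_iff_jointSmooth.2 (h k)
    refine ⟨⊤, γ, fun j => ?_, fun s hs => ?_⟩
    · have hre : ContDiff ℝ ∞ fun p : ℝ × ℝ × ℝ => ((p.1, p.2.1), p.2.2) := by fun_prop
      exact (hγ j 0).comp hre.contDiffOn fun p hp => ⟨⟨hp.1, hp.2.1⟩, hp.2.2⟩
    · have hγ' : ∀ j, JointC ∞ ((⊤ : Opens ℝ) : Set ℝ) fun t => (γ s t).1 j := fun j =>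
        (hγ j).comp (φ := fun t : ℝ => (s, t)) (contDiff_const.prodMk contDiff_id).contDiffOn
          fun _ _ => ⟨hs, trivial⟩
      refine ⟨linearDeformation hI x₀ ⊤ trivial Set.ordConnected_univ (γ s) hγ' (hu s hs),
        rfl, fun _ _ => rfl, Tangent.velocity_injective ?_⟩
      exact (linearDeformation_velocity hI x₀ ⊤ trivial Set.ordConnected_univ (γ s) hγ'
        (hu s hs)).symm

end TangentSpace

/-! ### The tangent vector mapping -/

section TangentMap

variable {I : Opens ℝ} {n : ℕ} {c₀ : CentroAffine n I}

/-- The solution `h` of `L(X(γ)) = -∑ h_k γ⁽ᵏ⁾`. -/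
def tangentMap (γ : StarCurve n I) : DOp I →ₗ[ℝ] (Fin n → Sm I) where
  toFun X := - frameCoord γ.1 fun j => (opL (curv γ.1)).1 (X.1 (γ.1 j))
  map_add' X Y := by
    have h : (fun j => (opL (curv γ.1)).1 ((X + Y).1 (γ.1 j))) =
        (fun j => (opL (curv γ.1)).1 (X.1 (γ.1 j))) + fun j => (opL (curv γ.1)).1 (Y.1 (γ.1 j)) := by
      funext j
      simp [DOp.add_val]
    rw [h, frameCoord, Matrix.add_vecMul, neg_add]
    rfl
  map_smul' r X := by
    have h : (fun j => (opL (curv γ.1)).1 ((r • X).1 (γ.1 j))) =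
        r • fun j => (opL (curv γ.1)).1 (X.1 (γ.1 j)) := by
      funext j
      simp [DOp.smul_val]
    rw [h, frameCoord, Matrix.smul_vecMul, ← smul_neg]
    rfl

theorem tangentMap_eq_iff (γ : StarCurve n I) (X : DOp I) (h : Fin n → Sm I) :
    tangentMap γ X = h ↔
      ∀ j, (opL (curv γ.1)).1 (X.1 (γ.1 j)) = - (opLow h).1 (γ.1 j) := by
  constructor
  · rintro rfl j
    simp only [tangentMap, LinearMap.coe_mk, AddHom.coe_mk, opLow_apply, Pi.neg_apply, neg_mul,
      Finset.sum_neg_distrib, neg_neg]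
    rw [γ.frameCoord_spec]
  · intro hX
    simp only [tangentMap, LinearMap.coe_mk, AddHom.coe_mk]
    rw [neg_eq_iff_eq_neg]
    symm
    refine γ.frameCoord_unique fun j => ?_
    simp only [hX, opLow_apply, Pi.neg_apply, neg_mul, Finset.sum_neg_distrib]

/-- All operators involved are `ℝ`-linear, so the equation for one representative passes to its
images under constant matrices. -/
theorem tangentEq_iff {γ : StarCurve n I} (hγ : γ.cls = c₀) (X : DOp I) (h : Fin n → Sm I) :
    TangentEq c₀ X h ↔ tangentMap γ X = h := by
  rw [tangentMap_eq_iff]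
  subst hγ
  constructor
  · intro hX j
    rw [opLow_apply]
    exact hX γ rfl j
  · intro hX γ' hγ' j
    obtain ⟨g, hg⟩ := (cls_eq_iff _ _).1 hγ'.symm
    rw [← opLow_apply, hg]
    simp only [rightMul, map_sum, map_smul]
    rw [← Finset.sum_neg_distrib]
    refine Finset.sum_congr rfl fun i _ => ?_
    rw [← smul_neg, ← hX i]
    rfl

/-- The inhomogeneous equation is solved separately for each component of `γ`. The operator of order
`< n` that takes `γ` to these solutions is read off in the frame. -/
theorem tangentMap_surjective (hI : (I : Set ℝ).OrdConnected) (hn : 0 < n) (γ : StarCurve n I) :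
    Function.Surjective (tangentMap γ) := by
  intro h
  choose y hy using fun j => γ.exists_opL_eq hI hn (- (opLow h).1 (γ.1 j))
  refine ⟨opLow (frameCoord γ.1 y), (tangentMap_eq_iff _ _ _).2 fun j => ?_⟩
  rw [opLow_apply (frameCoord γ.1 y), γ.frameCoord_spec, hy]

/-- The condition `L · [X] = 0` says that `L X` is a left multiple of `L`, which by division with
remainder means that `L X` kills every component of `γ`. -/
theorem tangentMap_eq_zero_iff (hn : 0 < n) (γ : StarCurve n I) (X : DOp I) :
    tangentMap γ X = 0 ↔ coset γ.cls X ∈ tangentKer γ.cls := by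
  rw [tangentMap_eq_iff]
  have h1 : coset γ.cls X ∈ tangentKer γ.cls ↔
      (opL (curv γ.1) * X) ∈ Submodule.span (DOp I) {opL (curv γ.1)} := by
    refine Iff.trans ?_ (Submodule.Quotient.mk_eq_zero _)
    rfl
  rw [h1, γ.mem_span_iff hn]
  refine forall_congr' fun j => ?_
  rw [DOp.mul_apply, opLow_zero]
  have : (0 : DOp I).1 (γ.1 j) = 0 := rfl
  rw [this, neg_zero]

/-- The tangent vector mapping on `𝓓ₓ/𝓓ₓL`. -/
def tangentMapQuot (hn : 0 < n) (γ : StarCurve n I) : DMod γ.cls →ₗ[ℝ] (Fin n → Sm I) :=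
  (((Submodule.span (DOp I) {Lop γ.cls}).restrictScalars ℝ).liftQ (tangentMap γ) (by
    intro X hX
    have hX' : X ∈ Submodule.span (DOp I) {opL (curv γ.1)} := hX
    rw [γ.mem_span_iff hn] at hX'
    rw [LinearMap.mem_ker, tangentMap_eq_iff]
    intro j
    rw [hX', map_zero, opLow_zero]
    exact neg_zero.symm)).comp
  (Submodule.Quotient.restrictScalarsEquiv ℝ (Submodule.span (DOp I) {Lop γ.cls})).symm.toLinearMap

theorem tangentMapQuot_coset (hn : 0 < n) (γ : StarCurve n I) (X : DOp I) :
    tangentMapQuot hn γ (coset γ.cls X) = tangentMap γ X := rfl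

theorem exists_coset_eq (c : CentroAffine n I) (q : DMod c) : ∃ X, coset c X = q :=
  Submodule.Quotient.mk_surjective _ q

theorem ker_tangentMapQuot (hn : 0 < n) (γ : StarCurve n I) :
    LinearMap.ker (tangentMapQuot hn γ) = tangentKer γ.cls := by
  ext q
  obtain ⟨X, rfl⟩ := exists_coset_eq _ q
  rw [LinearMap.mem_ker, tangentMapQuot_coset, tangentMap_eq_zero_iff hn]

/-- The quotient of `𝓓ₓ/𝓓ₓL` by the kernel of the tangent vector mapping is `𝓕ⁿ`. -/
def tangentMapEquiv (hI : (I : Set ℝ).OrdConnected) (hn : 0 < n) (γ : StarCurve n I) :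
    (DMod γ.cls ⧸ tangentKer γ.cls) ≃ₗ[ℝ] (Fin n → Sm I) :=
  (Submodule.quotEquivOfEq _ _ (ker_tangentMapQuot hn γ).symm).trans
    ((tangentMapQuot hn γ).quotKerEquivOfSurjective fun h => by
      obtain ⟨X, hX⟩ := tangentMap_surjective hI hn γ h
      exact ⟨coset _ X, hX⟩)

theorem tangentMapEquiv_mk (hI : (I : Set ℝ).OrdConnected) (hn : 0 < n) (γ : StarCurve n I)
    (X : DOp I) :
    tangentMapEquiv hI hn γ (Submodule.Quotient.mk (coset γ.cls X)) = tangentMap γ X := rfl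

/-- This is `L(∂ₜγ) = -(∂ₜL)γ` at `t = 0`. The inducing lift may start at another representative
than `γ`, whence the passage through `TangentEq`. -/
theorem Deformation.IsInducedBy.velocity_eq {γ : StarCurve n I} {Γ : Deformation γ.cls}
    {X : DOp I} (h : Γ.IsInducedBy X) : Γ.velocity = tangentMap γ X := by
  obtain ⟨g, hg, hX⟩ := h
  obtain ⟨g', -, hg'⟩ := hg.exists_isC1Lift
  have h0 : (g 0).cls = γ.cls := (hg.2 0 Γ.zero_mem).trans Γ.base
  symm
  rw [← tangentEq_iff rfl, tangentEq_iff h0, tangentMap_eq_iff]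
  intro j
  have h1 := hg'.Lop_apply_deriv Γ.zero_mem Γ.hasDerivAt_velocity j
  have h2 : g' 0 j = X.1 ((g 0).1 j) := Sm.ext_ev fun x =>
    ((hg'.1 j).hasDerivAt Γ.zero_mem 0 x).unique (hX j x)
  have h3 : Lop (Γ.path 0) = opL (curv (g 0).1) := by rw [Γ.base, ← Lop_cls, h0]
  rw [h2, h3] at h1
  exact h1

/-- Start from a deformation whose curvature has the velocity prescribed by `X`. Then `∂ₜγ - X(γ)`
at `t = 0` is annihilated by `L`, so it equals `γ M` for a constant matrix `M`. Replacing `γ(t)` by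
`γ(t)(1 - tM)` removes it without changing the centro-affine curves, on an interval short enough for
`1 - tM` to stay invertible. -/
theorem exists_isInducedBy (hI : (I : Set ℝ).OrdConnected) (x₀ : I) (hn : 0 < n)
    (c₀ : CentroAffine n I) (X : DOp I) : ∃ Γ : Deformation c₀, Γ.IsInducedBy X := by
  classical
  obtain ⟨γ₀, hγ₀⟩ := exists_cls_eq c₀
  obtain ⟨γ, hγ, hu⟩ := exists_linear_deformation (c₀ := c₀) hI x₀ hn isOpen_univ
    (h := fun _ => tangentMap γ₀ X) fun k => jointC_const_of_contDiffOn le_rfl _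
  have hγ' : ∀ j, JointC ∞ ((⊤ : Opens ℝ) : Set ℝ) fun t => (γ 0 t).1 j := fun j =>
    (hγ j).comp (φ := fun t : ℝ => ((0 : ℝ), t)) (contDiff_const.prodMk contDiff_id).contDiffOn
      fun _ _ => ⟨trivial, trivial⟩
  have hu' := hu 0 trivial
  set Γ₁ := linearDeformation hI x₀ ⊤ trivial Set.ordConnected_univ (γ 0) hγ' hu' with hΓ₁
  have hvel : Γ₁.velocity = tangentMap γ₀ X :=
    linearDeformation_velocity hI x₀ ⊤ trivial Set.ordConnected_univ (γ 0) hγ' hu'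
  have hlift : IsSmoothLift ⊤ Γ₁.path (γ 0) :=
    ⟨fun j => jointC_iff_jointSmooth.1 (hγ' j), fun _ _ => rfl⟩
  obtain ⟨g', -, hg'⟩ := hlift.exists_isC1Lift
  have hbase : (γ 0 0).cls = c₀ := Γ₁.base
  have hT : tangentMap (γ 0 0) X = tangentMap γ₀ X := by
    rw [← tangentEq_iff hbase, tangentEq_iff hγ₀]
  have hker : ∀ j, (opL (curv (γ 0 0).1)).1 (g' 0 j - X.1 ((γ 0 0).1 j)) = 0 := by
    intro j
    have h1 := hg'.Lop_apply_deriv (t := 0) trivial Γ₁.hasDerivAt_velocity j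
    have h2 := (tangentMap_eq_iff _ _ _).1 hT j
    have h3 : Lop (Γ₁.path 0) = opL (curv (γ 0 0).1) := rfl
    rw [h3] at h1
    rw [map_sub, h1, h2, hvel, sub_self]
  obtain ⟨M, hM⟩ := (γ 0 0).exists_eq_rightMul hI x₀
    (y := fun j => g' 0 j - X.1 ((γ 0 0).1 j)) hker
  have hcont : Continuous fun t : ℝ => (1 - t • M).det :=
    Continuous.matrix_det (continuous_const.sub (continuous_id.smul continuous_const))
  have hne : ∀ᶠ t in nhds (0 : ℝ), (1 - t • M).det ≠ 0 :=
    hcont.continuousAt.eventually_ne (by simp)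
  obtain ⟨δ, hδ, hball⟩ := Metric.eventually_nhds_iff_ball.1 hne
  let J : Opens ℝ := ⟨Metric.ball 0 δ, Metric.isOpen_ball⟩
  have hJ0 : (0 : ℝ) ∈ J := Metric.mem_ball_self hδ
  let η : ℝ → StarCurve n I := fun t =>
    if h : (1 - t • M).det ≠ 0 then
      (γ 0 t).transform (Matrix.nonsingInvUnit (1 - t • M) (isUnit_iff_ne_zero.2 h))
    else γ 0 t
  have hη : ∀ t ∈ J, ∀ j, (η t).1 j = (γ 0 t).1 j - t • ∑ i, M i j • (γ 0 t).1 i := by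
    intro t ht j
    have h1 : η t = (γ 0 t).transform
        (Matrix.nonsingInvUnit (1 - t • M) (isUnit_iff_ne_zero.2 (hball t ht))) :=
      dif_pos (hball t ht)
    rw [h1]
    change rightMul (γ 0 t).1 (1 - t • M) j = _
    simp only [rightMul, Matrix.sub_apply, Matrix.smul_apply, sub_smul, Finset.sum_sub_distrib,
      smul_assoc, ← Finset.smul_sum]
    congr 1
    exact congrFun (rightMul_one (γ 0 t).1) j
  have hcls : ∀ t ∈ J, (η t).cls = Γ₁.path t := by
    intro t ht
    have h1 : η t = (γ 0 t).transform
        (Matrix.nonsingInvUnit (1 - t • M) (isUnit_iff_ne_zero.2 (hball t ht))) :=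
      dif_pos (hball t ht)
    rw [h1, StarCurve.cls_transform]
    rfl
  have hηs : ∀ j, JointC ∞ (J : Set ℝ) fun t => (η t).1 j := fun j =>
    JointC.congr (((hγ' j).mono (Set.subset_univ _)).sub (JointC.smul contDiff_id.contDiffOn
      (JointC.sum fun i _ => ((hγ' i).mono (Set.subset_univ _)).const_smul (M i j))))
      fun t ht => hη t ht j
  refine ⟨{ J := J, zero_mem := hJ0, ordConnected := (convex_ball 0 δ).ordConnected,
            path := Γ₁.path, base := Γ₁.base,
            admissible := ⟨η, fun j => jointC_iff_jointSmooth.1 (hηs j), hcls⟩ },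
    η, ⟨fun j => jointC_iff_jointSmooth.1 (hηs j), hcls⟩, fun j x => ?_⟩
  have hd : ∀ i, HasDerivAt (fun t => ev x ((γ 0 t).1 i)) (ev x (g' 0 i)) 0 := fun i =>
    (hg'.1 i).hasDerivAt (t := 0) trivial 0 x
  have hη0 : (η 0).1 j = (γ 0 0).1 j := by rw [hη 0 hJ0, zero_smul, sub_zero]
  have hval : X.1 ((η 0).1 j) = g' 0 j - ∑ i, M i j • (γ 0 0).1 i := by
    have h1 := congrFun hM j
    simp only [rightMul] at h1
    rw [hη0, ← h1, sub_sub_cancel]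
  have h2 : HasDerivAt (fun t => ev x ((γ 0 t).1 j) - t * ∑ i, M i j * ev x ((γ 0 t).1 i))
      (ev x (X.1 ((η 0).1 j))) 0 := by
    have h3 := (hd j).sub ((hasDerivAt_id (0 : ℝ)).mul
      (HasDerivAt.fun_sum (u := Finset.univ) fun i _ => (hd i).const_mul (M i j)))
    have h4 : ev x (X.1 ((η 0).1 j)) = ev x (g' 0 j) -
        (1 * ∑ i, M i j * ev x ((γ 0 0).1 i) + id 0 * ∑ i, M i j * ev x (g' 0 i)) := by
      rw [hval]
      simp
    rw [h4]
    exact h3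
  refine h2.congr_of_eventuallyEq ?_
  filter_upwards [J.isOpen.mem_nhds hJ0] with t ht
  rw [← ev_apply, hη t ht j]
  simp

end TangentMap


theorem exists_tangentSpace_module (n : ℕ) (hn : 2 ≤ n) (I : TopologicalSpace.Opens ℝ)
    (hI : (I : Set ℝ).OrdConnected) (hI₀ : (I : Set ℝ).Nonempty)
    (c₀ : StarShaped.CentroAffine n I) :
    (∃ (_ : AddCommGroup (StarShaped.Tangent c₀))
        (_ : Module (StarShaped.Sm I) (StarShaped.Tangent c₀))
        (e : StarShaped.Tangent c₀ ≃ₗ[StarShaped.Sm I] (Fin n → StarShaped.Sm I))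
        (Φ : (StarShaped.DMod c₀ ⧸ StarShaped.tangentKer c₀) ≃+ StarShaped.Tangent c₀),
      (∀ (Γ : StarShaped.Deformation c₀) (k : Fin n) (x : I),
        HasDerivAt (fun t => (StarShaped.curvature (Γ.path t) k).1 x)
          ((e Γ.tangent k).1 x) 0) ∧
      (∀ (K : TopologicalSpace.Opens ℝ) (σ : ℝ → StarShaped.Tangent c₀),
        StarShaped.Tangent.IsSmoothCurve K σ ↔
          ∀ k, StarShaped.JointSmooth K fun s => e (σ s) k) ∧
      Submodule.span (StarShaped.DOp I) {StarShaped.coset c₀ 1} = ⊤ ∧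
      (∀ (r : ℝ) (q : StarShaped.DMod c₀ ⧸ StarShaped.tangentKer c₀),
        Φ (r • q) = algebraMap ℝ (StarShaped.Sm I) r • Φ q) ∧
      (∀ X : StarShaped.DOp I, ∃ Γ : StarShaped.Deformation c₀, Γ.IsInducedBy X) ∧
      (∀ (X : StarShaped.DOp I) (Γ : StarShaped.Deformation c₀), Γ.IsInducedBy X →
        Φ (Submodule.Quotient.mk (StarShaped.coset c₀ X)) = Γ.tangent) ∧
      (∀ (X : StarShaped.DOp I) (h : Fin n → StarShaped.Sm I),
        StarShaped.TangentEq c₀ X h ↔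
          e (Φ (Submodule.Quotient.mk (StarShaped.coset c₀ X))) = h) ∧
      (∀ h : Fin n → StarShaped.Sm I, ∃ X, StarShaped.TangentEq c₀ X h) ∧
      (∀ (h : Fin n → StarShaped.Sm I) (X Y : StarShaped.DOp I),
        StarShaped.TangentEq c₀ X h →
          (StarShaped.TangentEq c₀ Y h ↔ StarShaped.TangentEq c₀ (X - Y) 0)) ∧
      (∀ X : StarShaped.DOp I,
        StarShaped.coset c₀ X ∈ StarShaped.tangentKer c₀ ↔ StarShaped.TangentEq c₀ X 0)) := by
  obtain ⟨x₀, hx₀⟩ := hI₀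
  have hn' : 0 < n := by omega
  obtain ⟨γ, rfl⟩ := exists_cls_eq c₀
  -- The module structure is transported along this bijection, which makes the bijection linear by
  -- construction.
  let v := velocityEquiv γ.cls hI ⟨x₀, hx₀⟩ hn'
  let instG : AddCommGroup (Tangent γ.cls) := v.addCommGroup
  let instM : Module (Sm I) (Tangent γ.cls) := v.module (Sm I)
  let e : Tangent γ.cls ≃ₗ[Sm I] (Fin n → Sm I) := v.linearEquiv (Sm I)
  -- Both sides are already identified with `𝓕ⁿ`, by the tangent vector mapping and by the velocity;
  -- `Φ` matches them.
  let Φ : (DMod γ.cls ⧸ tangentKer γ.cls) ≃+ Tangent γ.cls :=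
    (tangentMapEquiv hI hn' γ).toAddEquiv.trans e.symm.toAddEquiv
  have he : ∀ τ, e τ = τ.velocity := fun _ => rfl
  have heΦ : ∀ q, e (Φ q) = tangentMapEquiv hI hn' γ q := fun q => e.apply_symm_apply _
  refine ⟨instG, instM, e, Φ, fun Γ k x => Γ.hasDerivAt_velocity k x,
    fun K σ => isSmoothCurve_iff hI ⟨x₀, hx₀⟩ hn' K σ, ?_, fun r q => ?_,
    exists_isInducedBy hI ⟨x₀, hx₀⟩ hn' γ.cls, fun X Γ h => ?_, fun X h => ?_, fun h => ?_,
    fun h X Y hX => ?_, fun X => ?_⟩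
  · rw [eq_top_iff]
    intro q _
    obtain ⟨X, rfl⟩ := exists_coset_eq _ q
    refine Submodule.mem_span_singleton.2 ⟨X, ?_⟩
    exact congrArg (coset γ.cls) (mul_one X)
  · apply e.injective
    rw [heΦ, e.map_smul, heΦ, map_smul]
    funext k
    exact Algebra.smul_def (R := ℝ) (A := Sm I) r _
  · apply e.injective
    rw [heΦ, tangentMapEquiv_mk, he, Tangent.velocity_tangent, h.velocity_eq]
  · rw [heΦ, tangentMapEquiv_mk, tangentEq_iff rfl]
  · obtain ⟨X, hX⟩ := tangentMap_surjective hI hn' γ h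
    exact ⟨X, (tangentEq_iff rfl _ _).2 hX⟩
  · rw [tangentEq_iff rfl] at hX ⊢
    rw [tangentEq_iff rfl, map_sub, hX, sub_eq_zero, eq_comm]
  · rw [tangentEq_iff rfl, tangentMap_eq_zero_iff hn']

/-! ### Evolution operators -/

section Regularity

theorem contDiffOn_succ_of_partial {O : Set (ℝ × ℝ)} (hO : IsOpen O) {F Ft Fx : ℝ × ℝ → ℝ} {r : ℕ}
    (ht : ∀ q ∈ O, HasDerivAt (fun t => F (t, q.2)) (Ft q) q.1)
    (hx : ∀ q ∈ O, HasDerivAt (fun x => F (q.1, x)) (Fx q) q.2)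
    (hFt : ContDiffOn ℝ r Ft O) (hFx : ContDiffOn ℝ r Fx O) : ContDiffOn ℝ (r + 1) F O := by
  set T : ℝ → ℝ →L[ℝ] ℝ := fun y => ContinuousLinearMap.toSpanSingleton ℝ y
  have hT : ContDiff ℝ r T := (ContinuousLinearMap.toSpanSingletonCLE (𝕜 := ℝ) (E := ℝ)).contDiff
  rw [contDiffOn_succ_iff_hasFDerivWithinAt_of_uniqueDiffOn hO.uniqueDiffOn]
  refine ⟨by simp, fun q => (T (Ft q)).coprod (T (Fx q)), ?_, fun q hq => ?_⟩
  · have h1 : ContDiffOn ℝ r (fun q => ((T (Ft q)).comp (ContinuousLinearMap.fst ℝ ℝ ℝ)) +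
        (T (Fx q)).comp (ContinuousLinearMap.snd ℝ ℝ ℝ)) O :=
      ((hT.comp_contDiffOn hFt).clm_comp contDiffOn_const).add
        ((hT.comp_contDiffOn hFx).clm_comp contDiffOn_const)
    refine h1.congr fun q _ => ?_
    ext <;> simp
  · have h2 := hasStrictFDerivAt_uncurry_coprod (𝕜 := ℝ) (u := q) (f := fun t x => F (t, x))
      (f₁ := fun t x => T (Ft (t, x))) (f₂ := fun t x => T (Fx (t, x)))
      (by filter_upwards [hO.mem_nhds hq] with p hp using (ht p hp).hasFDerivAt)
      (by filter_upwards [hO.mem_nhds hq] with p hp using (hx p hp).hasFDerivAt)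
      ((hT.comp_contDiffOn hFt).continuousOn.continuousAt (hO.mem_nhds hq))
      ((hT.comp_contDiffOn hFx).continuousOn.continuousAt (hO.mem_nhds hq))
    exact h2.hasFDerivAt.hasFDerivWithinAt

variable {I J : Opens ℝ}

theorem HasC1Deriv.hasDerivAt_fst {f f' : ℝ → Sm I} (h : HasC1Deriv J f f') (k : ℕ) {q : ℝ × ℝ}
    (hq : q ∈ (J : Set ℝ) ×ˢ (I : Set ℝ)) :
    HasDerivAt (fun t => ext ((D I ^ k) (f t)).1 q.2) (ext ((D I ^ k) (f' q.1)).1 q.2) q.1 := by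
  simp only [ext_eq_ev _ (show q.2 ∈ I from hq.2)]
  exact h.hasDerivAt hq.1 k _

theorem hasDerivAt_ext_D_pow (f : Sm I) (k : ℕ) {x : ℝ} (hx : x ∈ I) :
    HasDerivAt (ext ((D I ^ k) f).1) (ext ((D I ^ (k + 1)) f).1 x) x := by
  rw [D_pow_succ_apply, ext_eq_ev _ hx]
  exact hasDerivAt_ext ((D I ^ k) f) ⟨x, hx⟩

/-- Only the derivative is assumed to be jointly continuous. It is locally bounded, so the family is
Lipschitz in `t` with a constant uniform in nearby `x`; together with continuity in `x` this gives
joint continuity. -/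
theorem HasC1Deriv.continuousOn {f f' : ℝ → Sm I} (h : HasC1Deriv J f f') (k : ℕ) :
    ContinuousOn (fun p : ℝ × ℝ => ext ((D I ^ k) (f p.1)).1 p.2)
      ((J : Set ℝ) ×ˢ (I : Set ℝ)) := by
  have hO : IsOpen ((J : Set ℝ) ×ˢ (I : Set ℝ)) := J.isOpen.prod I.isOpen
  intro q hq
  refine ContinuousAt.continuousWithinAt ?_
  have hc := (h k).2.continuousAt (hO.mem_nhds hq)
  obtain ⟨K, hK⟩ : ∃ K : ℝ, |ext ((D I ^ k) (f' q.1)).1 q.2| < K := exists_gt _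
  have hev := (hc.abs.eventually (gt_mem_nhds hK)).and (hO.mem_nhds hq)
  obtain ⟨ε, hε, hb⟩ := Metric.eventually_nhds_iff_ball.1 hev
  rw [← ball_prod_same] at hb
  have hK0 : 0 ≤ K := (abs_nonneg _).trans hK.le
  refine ContinuousOn.continuousAt (s := Metric.ball q.1 ε ×ˢ Metric.ball q.2 ε) ?_
    (prod_mem_nhds (Metric.ball_mem_nhds _ hε) (Metric.ball_mem_nhds _ hε))
  refine continuousOn_prod_of_continuousOn_lipschitzOnWith _ ⟨K, hK0⟩ (fun t ht x hx => ?_)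
    fun x hx => ?_
  · exact (hasDerivAt_ext_D_pow _ k (hb (t, x) ⟨ht, hx⟩).2.2).continuousAt.continuousWithinAt
  · refine (convex_ball _ _).lipschitzOnWith_of_nnnorm_hasDerivWithin_le
      (f' := fun t => ext ((D I ^ k) (f' t)).1 x)
      (fun t ht => (h.hasDerivAt_fst k (hb (t, x) ⟨ht, hx⟩).2).hasDerivWithinAt) fun t ht => ?_
    exact NNReal.coe_le_coe.1 (hb (t, x) ⟨ht, hx⟩).1.le

theorem HasC1Deriv.jointC_zero {f f' : ℝ → Sm I} (h : HasC1Deriv J f f') :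
    JointC (0 : ℕ) (J : Set ℝ) f := fun k => contDiffOn_zero.2 (h.continuousOn k)

/-- The bootstrap step: a function with both partial derivatives of class `Cʳ` is of class `Cʳ⁺¹`,
and the `x`-derivatives are covered because `JointC` speaks of all of them. -/
theorem HasC1Deriv.jointC_succ {f f' : ℝ → Sm I} (h : HasC1Deriv J f f') {r : ℕ}
    (hf : JointC r (J : Set ℝ) f) (hf' : JointC r (J : Set ℝ) f') :
    JointC (r + 1 : ℕ) (J : Set ℝ) f := fun k => by
  refine contDiffOn_succ_of_partial (J.isOpen.prod I.isOpen) (fun q hq => h.hasDerivAt_fst k hq)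
    (fun q hq => hasDerivAt_ext_D_pow (f q.1) k hq.2) (hf' k) (hf (k + 1))

theorem HasC1Deriv.jointC_one {f f' : ℝ → Sm I} (h : HasC1Deriv J f f') :
    JointC (1 : ℕ) (J : Set ℝ) f :=
  h.jointC_succ h.jointC_zero fun k => contDiffOn_zero.2 (h k).2

theorem hasC1Deriv_of_jointC_zero {f f' : ℝ → Sm I}
    (h : ∀ k, ∀ t ∈ J, ∀ x : I,
      HasDerivAt (fun s => ev x ((D I ^ k) (f s))) (ev x ((D I ^ k) (f' t))) t)
    (h' : JointC (0 : ℕ) (J : Set ℝ) f') : HasC1Deriv J f f' :=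
  fun k => ⟨h k, (h' k).continuousOn⟩

theorem HasC1Deriv.smul {g g' : ℝ → ℝ} (hg : ∀ t ∈ J, HasDerivAt g (g' t) t)
    (hg' : ContinuousOn g' J) {f f' : ℝ → Sm I} (h : HasC1Deriv J f f') :
    HasC1Deriv J (fun t => g t • f t) fun t => g' t • f t + g t • f' t := by
  have hgc : ContinuousOn g J := fun t ht => (hg t ht).continuousAt.continuousWithinAt
  refine hasC1Deriv_of_jointC_zero (fun k t ht x => ?_) ?_
  · simp only [map_smul, map_add, smul_eq_mul]
    exact (hg t ht).mul (h.hasDerivAt ht k x)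
  · exact (JointC.smul (contDiffOn_zero.2 hg') h.jointC_zero).add
      (JointC.smul (contDiffOn_zero.2 hgc) fun k => contDiffOn_zero.2 (h k).2)

theorem HasC1Deriv.sum {ι : Type*} {s : Finset ι} {f f' : ι → ℝ → Sm I}
    (h : ∀ i ∈ s, HasC1Deriv J (f i) (f' i)) :
    HasC1Deriv J (fun t => ∑ i ∈ s, f i t) fun t => ∑ i ∈ s, f' i t := by
  refine hasC1Deriv_of_jointC_zero (fun k t ht x => ?_) (JointC.sum fun i hi k =>
    contDiffOn_zero.2 (h i hi k).2)
  simp only [map_sum]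
  exact HasDerivAt.fun_sum fun i hi => (h i hi).hasDerivAt ht k x

end Regularity

/-! ### Evolution operators and the regularity of normalised lifts -/

section Evolution

variable {I J : Opens ℝ} {n : ℕ}

theorem JointC.frameCoord {E : Type*} [NormedAddCommGroup E] [NormedSpace ℝ E] {U : Set E}
    (hU : IsOpen U) {γ y : E → Fin n → Sm I}
    (h : ∀ j, JointC ∞ U fun p => γ p j) (hy : ∀ j, JointC ∞ U fun p => y p j)
    (h0 : ∀ p ∈ U, ∀ x, ev x (StarShaped.W (γ p)).det ≠ 0)
    (k : Fin n) : JointC ∞ U fun p => frameCoord (γ p) (y p) k := by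
  simp only [StarShaped.frameCoord, Matrix.vecMul, dotProduct]
  exact JointC.sum fun i _ => (hy i).mul (JointC.matrixInv hU (JointC.W h) h0 i k)

theorem smoothOp_opLow {a : ℝ → Fin n → Sm I} (h : ∀ k, JointC ∞ (J : Set ℝ) fun t => a t k) :
    SmoothOp J fun t => opLow (a t) := by
  refine ⟨n, fun k t => if hk : k < n then a t ⟨k, hk⟩ else 0, fun k => ?_, fun t _ => ?_⟩
  · rw [← jointC_iff_jointSmooth]
    by_cases hk : k < n
    · simpa only [hk, dif_pos] using h ⟨k, hk⟩
    · simpa only [hk, dif_neg, not_false_eq_true] using StarShaped.jointC_zero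
  · rw [Finset.sum_range]
    simp only [Fin.is_lt, dif_pos]
    rfl

theorem JointC.smoothOp_apply {X : ℝ → DOp I} (hX : SmoothOp J X) {r : ℕ} {y : ℝ → Sm I}
    (hy : JointC r (J : Set ℝ) y) : JointC r (J : Set ℝ) fun t => (X t).1 (y t) := by
  obtain ⟨N, a, ha, hX⟩ := hX
  have h1 : JointC r (J : Set ℝ) fun t => ∑ k ∈ Finset.range N, a k t * (StarShaped.D I ^ k) (y t) :=
    JointC.sum fun k _ => JointC.mul
      (fun m => ((jointC_iff_jointSmooth.2 (ha k)) m).of_le (by exact_mod_cast le_top))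
      (hy.D_pow k)
  refine h1.congr fun t ht => ?_
  rw [hX t ht, LinearMap.sum_apply]
  rfl

/-- An operator with the right action on one lift is an evolution operator. -/
theorem isEvolutionOp_of_lift {c : ℝ → CentroAffine n I} {X : ℝ → DOp I}
    {γ : ℝ → StarCurve n I} (hγ : ∀ t ∈ J, (γ t).cls = c t) {v : ℝ → Fin n → Sm I}
    (hv : ∀ t ∈ J, ∀ k, ∀ x : I,
      HasDerivAt (fun s => ev x (curvature (c s) k)) (ev x (v t k)) t)
    (hX : ∀ t ∈ J, ∀ j,
      (Lop (c t)).1 ((X t).1 ((γ t).1 j)) = - (opLow (v t)).1 ((γ t).1 j)) :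
    IsEvolutionOp J c X := by
  intro β β' hβ a t ht
  -- The transition matrix is needed at the single time `t` and its derivative never enters, since
  -- `L(β') = -(∂ₜL)β` holds for every `C¹` lift.
  obtain ⟨g, hg⟩ := (cls_eq_iff (γ t) (β t)).1 ((hγ t ht).trans (hβ.2 t ht).symm)
  have h1 : ∀ j, (Lop (c t)).1 ((X t).1 ((β t).1 j)) = - (opLow (v t)).1 ((β t).1 j) := by
    intro j
    simp only [hg, rightMul, map_sum, map_smul, hX t ht, smul_neg, Finset.sum_neg_distrib]
  simp only [map_sub, map_sum, map_smul, h1, hβ.Lop_apply_deriv ht (hv t ht), sub_self]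

/-- The operator is the one of order `< n` with `X(γ) = ∂ₜγ` for a smooth lift `γ`; its coefficients
are the coordinates of `∂ₜγ` in the frame. -/
theorem IsAdmissible.exists_isEvolutionOp {c : ℝ → CentroAffine n I} (h : IsAdmissible J c) :
    (∃ γ γ', IsC1Lift J c γ γ') ∧ ∃ X : ℝ → DOp I, SmoothOp J X ∧ IsEvolutionOp J c X := by
  choose v _ hv using fun k => (h.jointC_curvature k).exists_timeDeriv
  obtain ⟨γ, hγ⟩ := h
  obtain ⟨γ', hs, hγ'⟩ := hγ.exists_isC1Lift
  refine ⟨⟨γ, γ', hγ'⟩, fun t => opLow (frameCoord (γ t).1 (γ' t)), smoothOp_opLow fun k =>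
    JointC.frameCoord J.isOpen hγ.jointC hs (fun t _ => (γ t).ev_det_ne_zero) k, ?_⟩
  have hv' : ∀ t ∈ J, ∀ k, ∀ x : I,
      HasDerivAt (fun s => ev x (curvature (c s) k)) (ev x (v k t)) t :=
    fun t ht k x => (hv k).hasDerivAt ht 0 x
  refine isEvolutionOp_of_lift hγ.2 (v := fun t k => v k t) hv' fun t ht j => ?_
  rw [opLow_apply (frameCoord _ _), StarCurve.frameCoord_spec]
  exact hγ'.Lop_apply_deriv ht (hv' t ht) j

/-- The wronskian matrix at a point, as an invertible matrix. -/
def StarCurve.frameAt (γ : StarCurve n I) (x₀ : I) : GL (Fin n) ℝ :=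
  Matrix.nonsingInvUnit ((W γ.1).map (ev x₀)) (by
    have h := γ.ev_det_ne_zero x₀
    rw [AlgHom.map_det] at h
    exact isUnit_iff_ne_zero.2 h)

theorem StarCurve.frameAt_val (γ : StarCurve n I) (x₀ : I) :
    (γ.frameAt x₀).1 = (W γ.1).map (ev x₀) := rfl

theorem StarCurve.frameAt_inv_apply (γ : StarCurve n I) (x₀ : I) (i j : Fin n) :
    (γ.frameAt x₀)⁻¹.1 i j = (ev x₀ (W γ.1).det)⁻¹ * ev x₀ ((W γ.1).adjugate i j) := by
  rw [Matrix.coe_units_inv, frameAt_val, Matrix.inv_def, Matrix.smul_apply, smul_eq_mul,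
    Ring.inverse_eq_inv', AlgHom.map_det]
  congr 1
  exact (congrFun (congrFun (AlgHom.map_adjugate (ev x₀) (W γ.1)) i) j).symm

theorem StarCurve.ev_D_pow_transform (γ : StarCurve n I) (x₀ : I) (i j : Fin n) :
    ev x₀ ((D I ^ (i : ℕ)) ((γ.transform (γ.frameAt x₀)⁻¹).1 j)) = if i = j then 1 else 0 := by
  have h : ((W (γ.transform (γ.frameAt x₀)⁻¹).1).map (ev x₀)) = 1 := by
    rw [show (γ.transform (γ.frameAt x₀)⁻¹).1 = rightMul γ.1 (γ.frameAt x₀)⁻¹.1 from rfl,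
      W_rightMul]
    ext i j
    rw [Matrix.map_apply, Matrix.mul_apply, map_sum]
    simp only [map_mul, Matrix.map_apply, AlgHom.commutes, Algebra.algebraMap_self, RingHom.id_apply]
    have h1 : (γ.frameAt x₀).1 * (γ.frameAt x₀)⁻¹.1 = 1 := Units.mul_inv _
    have h2 := congrFun (congrFun h1 i) j
    rw [Matrix.mul_apply] at h2
    exact h2
  have h3 := congrFun (congrFun h i) j
  rw [Matrix.one_apply] at h3
  exact h3

/-- The normalising matrix is the inverse of the Wronskian matrix at `x₀`, which is `C¹` in `t`, so
normalisation costs no regularity. -/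
theorem IsC1Lift.exists_normalized {c : ℝ → CentroAffine n I} {γ : ℝ → StarCurve n I}
    {γ' : ℝ → Fin n → Sm I} (h : IsC1Lift J c γ γ') (x₀ : I) :
    ∃ β' : ℝ → Fin n → Sm I,
      IsC1Lift J c (fun t => (γ t).transform ((γ t).frameAt x₀)⁻¹) β' := by
  have hW : ∀ i j, JointC (1 : ℕ) (J : Set ℝ) fun t => W (γ t).1 i j :=
    JointC.W fun j => (h.1 j).jointC_one
  have hg : ∀ i j, ContDiffOn ℝ 1 (fun t => ((γ t).frameAt x₀)⁻¹.1 i j) J := fun i j => by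
    simp only [StarCurve.frameAt_inv_apply]
    exact (((JointC.det hW).contDiffOn_ev x₀).inv fun t _ => (γ t).ev_det_ne_zero x₀).mul
      ((JointC.adjugate hW i j).contDiffOn_ev x₀)
  have hd : ∀ i j, ∀ t ∈ J, HasDerivAt (fun t => ((γ t).frameAt x₀)⁻¹.1 i j)
      (deriv (fun t => ((γ t).frameAt x₀)⁻¹.1 i j) t) t := fun i j t ht =>
    (((hg i j).differentiableOn (by simp)).differentiableAt (J.isOpen.mem_nhds ht)).hasDerivAt
  have hd' : ∀ i j, ContinuousOn (deriv fun t => ((γ t).frameAt x₀)⁻¹.1 i j) J := fun i j =>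
    (hg i j).continuousOn_deriv_of_isOpen J.isOpen le_rfl
  refine ⟨fun t j => ∑ i, (deriv (fun t => ((γ t).frameAt x₀)⁻¹.1 i j) t • (γ t).1 i +
    ((γ t).frameAt x₀)⁻¹.1 i j • γ' t i), fun j => HasC1Deriv.sum (s := Finset.univ) fun i _ => HasC1Deriv.smul (hd i j) (hd' i j) (h.1 i), ?_⟩
  intro t ht
  rw [StarCurve.cls_transform, h.2 t ht]

/-- An arbitrary `C¹` lift need not be smooth, as it may be multiplied by a `C¹` family of matrices.
Requiring the Wronskian matrix to be `1` at `x₀` removes this freedom: the normalised lift obeys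
`∂ₜβ_j = X(β_j) - ∑ X(β_j)⁽ᵏ⁾(x₀) β_k`, and the right-hand side is as regular as `β`. -/
theorem isAdmissible_of_isEvolutionOp (hI : (I : Set ℝ).OrdConnected) (x₀ : I)
    {c : ℝ → CentroAffine n I} {γ : ℝ → StarCurve n I}
    {γ' : ℝ → Fin n → Sm I} (h : IsC1Lift J c γ γ') {X : ℝ → DOp I} (hX : SmoothOp J X)
    (hE : IsEvolutionOp J c X) : IsAdmissible J c := by
  obtain ⟨β', hβ⟩ := h.exists_normalized x₀
  set β := fun t => (γ t).transform ((γ t).frameAt x₀)⁻¹ with hβdef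
  have hnorm : ∀ t, ∀ i j : Fin n, ev x₀ ((D I ^ (i : ℕ)) ((β t).1 j)) = if i = j then 1 else 0 :=
    fun t => (γ t).ev_D_pow_transform x₀
  have hβ' : ∀ j, ∀ t ∈ J, β' t j = (X t).1 ((β t).1 j) -
      ∑ k : Fin n, ev x₀ ((D I ^ (k : ℕ)) ((X t).1 ((β t).1 j))) • (β t).1 k := by
    intro j t ht
    have h0 := hE β β' hβ (Pi.single j 1) t ht
    simp only [Pi.single_apply, ite_smul, one_smul, zero_smul, Finset.sum_ite_eq',
      Finset.mem_univ, if_true] at h0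
    have hL : Lop (c t) = opL (curv (β t).1) := by rw [← hβ.2 t ht]; rfl
    rw [hL] at h0
    obtain ⟨m, hm⟩ := (β t).exists_eq_sum_of_opL_eq_zero hI x₀ h0
    -- The Wronskian matrix at `x₀` does not depend on `t`, so the derivatives of `∂ₜβ_j` of order
    -- `< n` vanish at `x₀`. The `i`-th derivative at `x₀` of the relation then isolates `m i`.
    have hm' : ∀ i, m i = - ev x₀ ((D I ^ (i : ℕ)) ((X t).1 ((β t).1 j))) := by
      intro i
      have h1 := congrArg (fun y => ev x₀ ((D I ^ (i : ℕ)) y)) hm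
      simp only [map_sub, map_sum, map_smul, hnorm, smul_eq_mul, mul_ite, mul_one, mul_zero,
        Finset.sum_ite_eq, Finset.mem_univ, if_true] at h1
      have h2 : HasDerivAt (fun s => ev x₀ ((D I ^ (i : ℕ)) ((β s).1 j))) 0 t := by
        simp only [hnorm]
        exact hasDerivAt_const _ _
      rw [((hβ.1 j).hasDerivAt ht i x₀).unique h2, zero_sub] at h1
      exact h1.symm
    rw [sub_eq_iff_eq_add] at hm
    rw [hm, add_comm, sub_eq_add_neg, ← Finset.sum_neg_distrib]
    simp only [hm', neg_smul]
  have key : ∀ r : ℕ, ∀ j, JointC r (J : Set ℝ) fun t => (β t).1 j := by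
    intro r
    induction r with
    | zero => exact fun j => (hβ.1 j).jointC_zero
    | succ r ih =>
      refine fun j => (hβ.1 j).jointC_succ (ih j) (JointC.congr (JointC.sub
        (JointC.smoothOp_apply hX (ih j)) (JointC.sum fun (k : Fin n) _ => JointC.smul
          (((JointC.smoothOp_apply hX (ih j)).D_pow k).contDiffOn_ev x₀) (ih k))) (hβ' j))
  refine ⟨β, fun j => ?_, hβ.2⟩
  rw [← jointC_iff_jointSmooth]
  exact fun k => contDiffOn_infty.2 fun r => key r j k

end Evolution


theorem isAdmissible_iff_exists_isEvolutionOp {n : ℕ} {I J : Opens ℝ}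
    (hI : (I : Set ℝ).OrdConnected) (hI₀ : (I : Set ℝ).Nonempty) (c : ℝ → CentroAffine n I) :
    IsAdmissible J c ↔ (∃ γ γ', IsC1Lift J c γ γ') ∧
      ∃ X : ℝ → DOp I, SmoothOp J X ∧ IsEvolutionOp J c X := by
  obtain ⟨x₀, hx₀⟩ := hI₀
  refine ⟨fun h => h.exists_isEvolutionOp, ?_⟩
  rintro ⟨⟨γ, γ', hγ⟩, X, hX, hE⟩
  exact isAdmissible_of_isEvolutionOp hI ⟨x₀, hx₀⟩ hγ hX hE

/-! ### The ring of formal pseudo-differential operators -/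

section Symbols

variable {I : Opens ℝ}

/-- The symbol `a` has order at most `A`. -/
def Psi.OrderLE (A : ℤ) (a : Psi I) : Prop := ∀ k, A < k → a k = 0

theorem Psi.OrderLE.mono {A A' : ℤ} {a : Psi I} (h : Psi.OrderLE A a) (hA : A ≤ A') :
    Psi.OrderLE A' a := fun k hk => h k (hA.trans_lt hk)

/-- The product `∂ⁱ ∘ b`. -/
def Psi.dpow (i : ℤ) (b : Psi I) : Psi I := fun m =>
  ∑ᶠ l : ℕ, Ring.choose i l • (D I ^ l) (b (m - i + l))

theorem Psi.dpow_eq_sum {B : ℤ} {b : Psi I} (hb : OrderLE B b) {i m : ℤ} {N : ℕ}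
    (hN : B - m + i < N) :
    dpow i b m = ∑ l ∈ Finset.range N, Ring.choose i l • (D I ^ l) (b (m - i + l)) := by
  refine finsum_eq_sum_of_support_subset _ fun l hl => ?_
  rw [Finset.coe_range, Set.mem_Iio]
  by_contra h
  refine hl ?_
  simp only []
  rw [hb _ (by omega), map_zero, smul_zero]

theorem Psi.OrderLE.dpow {B : ℤ} {b : Psi I} (hb : OrderLE B b) (i : ℤ) :
    OrderLE (B + i) (dpow i b) := fun m hm => by
  rw [dpow_eq_sum hb (N := 0) (by push_cast; omega), Finset.sum_range_zero]

theorem Psi.dpow_zero {B : ℤ} {b : Psi I} (hb : OrderLE B b) : Psi.dpow 0 b = b := by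
  funext m
  rw [dpow_eq_sum hb (N := (B - m).toNat + 1) (by omega), Finset.sum_range_succ']
  simp

/-- Pascal's rule for binomial coefficients with integer upper entry. It says `∂ⁱ⁺¹ ∘ b = ∂ ∘ (∂ⁱ ∘
b)`, because the `m`-th coefficient of `∂ ∘ c` is `c_{m-1} + c_m'`. -/
theorem Psi.dpow_succ {B : ℤ} {b : Psi I} (hb : OrderLE B b) (i m : ℤ) :
    dpow (i + 1) b m = dpow i b (m - 1) + D I (dpow i b m) := by
  obtain ⟨N, hN⟩ : ∃ N : ℕ, B - m + i < N := ⟨(B - m + i).toNat + 1, by omega⟩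
  rw [dpow_eq_sum hb (N := N + 1) (by omega), dpow_eq_sum hb (m := m - 1) (N := N + 1) (by omega),
    dpow_eq_sum hb (m := m) (i := i) (N := N) (by omega), Finset.sum_range_succ',
    Finset.sum_range_succ', map_sum, add_right_comm, ← Finset.sum_add_distrib]
  congr 1
  · refine Finset.sum_congr rfl fun l _ => ?_
    rw [Ring.choose_succ_succ, add_smul, map_zsmul, ← D_pow_succ_apply, add_comm]
    have h1 : m - (i + 1) + ((l + 1 : ℕ) : ℤ) = m - i + l := by push_cast; ring
    have h2 : m - 1 - i + ((l + 1 : ℕ) : ℤ) = m - i + l := by push_cast; ring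
    rw [h1, h2]
  · have h1 : m - (i + 1) = m - 1 - i := by ring
    simp [h1]

/-- The bounds `lo` and `hi` are left loose so that several products can be expanded over a common
range of indices. -/
theorem Psi.mul_eq_sum {A B : ℤ} {a b : Psi I} (ha : OrderLE A a) (hb : OrderLE B b) {m lo hi : ℤ}
    (hlo : lo ≤ m - B) (hhi : A ≤ hi) :
    mul a b m = ∑ i ∈ Finset.Icc lo hi, a i * dpow i b m := by
  set N := (B - m + hi).toNat + 1
  have h1 : mul a b m = ∑ p ∈ Finset.Icc lo hi ×ˢ Finset.range N,
      Ring.choose p.1 p.2 • (a p.1 * (D I ^ p.2) (b (m - p.1 + p.2))) := by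
    refine finsum_eq_sum_of_support_subset _ fun p hp => ?_
    have h2 : p.1 ≤ A := by
      by_contra h
      exact hp (by simp only []; rw [ha _ (by omega), zero_mul, smul_zero])
    have h3 : m - p.1 + p.2 ≤ B := by
      by_contra h
      exact hp (by simp only []; rw [hb _ (by omega), map_zero, mul_zero, smul_zero])
    rw [Finset.mem_coe, Finset.mem_product, Finset.mem_Icc, Finset.mem_range]
    omega
  rw [h1, Finset.sum_product]
  refine Finset.sum_congr rfl fun i hi => ?_
  rw [Finset.mem_Icc] at hi
  rw [dpow_eq_sum hb (N := N) (by omega), Finset.mul_sum]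
  exact Finset.sum_congr rfl fun l _ => (mul_smul_comm _ _ _).symm

theorem Psi.OrderLE.mul {A B : ℤ} {a b : Psi I} (ha : OrderLE A a) (hb : OrderLE B b) :
    OrderLE (A + B) (mul a b) := fun m hm => by
  rw [mul_eq_sum ha hb (lo := m - B) (hi := A) le_rfl le_rfl, Finset.Icc_eq_empty (by omega),
    Finset.sum_empty]

/-- Left multiplication by `∂` is injective on symbols bounded above in order: starting at the top,
each coefficient determines the next lower one. -/
theorem Psi.OrderLE.eq_of_d_eq {A : ℤ} {a b : Psi I} (ha : OrderLE A a) (hb : OrderLE A b)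
    (h : ∀ m, a (m - 1) + D I (a m) = b (m - 1) + D I (b m)) : a = b := by
  have key : ∀ j : ℕ, ∀ k, A - j < k → a k = b k := by
    intro j
    induction j with
    | zero => intro k hk; rw [ha k (by simpa using hk), hb k (by simpa using hk)]
    | succ j ih =>
      intro k hk
      have h1 := h (k + 1)
      rw [ih (k + 1) (by push_cast at hk; omega), add_left_inj, add_sub_cancel_right] at h1
      exact h1
  exact funext fun k => key ((A - k).toNat + 1) k (by omega)

theorem Psi.d_mul {A B : ℤ} {b c : Psi I} (hb : OrderLE A b) (hc : OrderLE B c) (p : ℤ) :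
    mul (fun m => b (m - 1) + D I (b m)) c p = mul b c (p - 1) + D I (mul b c p) := by
  have hb' : OrderLE (A + 1) (fun m => b (m - 1) + D I (b m)) := fun m hm => by
    simp only []
    rw [hb _ (by omega), hb _ (by omega), map_zero, add_zero]
  -- The lower end is chosen so that the shift `i ↦ i + 1` carries the range of the second sum onto
  -- this one; the other ranges differ only by vanishing terms.
  rw [mul_eq_sum hb' hc (lo := p - B - 1 + 1) (hi := A + 1) (by omega) (by omega),
    mul_eq_sum hb hc (m := p - 1) (lo := p - B - 1) (hi := A) (by omega) le_rfl,
    mul_eq_sum hb hc (m := p) (lo := p - B - 1) (hi := A + 1) (by omega) (by omega)]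
  simp only [add_mul, Finset.sum_add_distrib, map_sum, D_mul]
  have h1 : ∑ x ∈ Finset.Icc (p - B - 1 + 1) (A + 1), b (x - 1) * dpow x c p =
      ∑ i ∈ Finset.Icc (p - B - 1) A, (b i * dpow i c (p - 1) + b i * D I (dpow i c p)) := by
    rw [← Finset.image_add_right_Icc, Finset.sum_image (fun _ _ _ _ h => add_right_cancel h)]
    refine Finset.sum_congr rfl fun i _ => ?_
    rw [add_sub_cancel_right, dpow_succ hc, mul_add]
  have h2 : ∑ i ∈ Finset.Icc (p - B - 1) A, b i * D I (dpow i c p) =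
      ∑ i ∈ Finset.Icc (p - B - 1) (A + 1), b i * D I (dpow i c p) := by
    refine Finset.sum_subset (Finset.Icc_subset_Icc_right (by omega)) fun i hi hi' => ?_
    rw [Finset.mem_Icc] at hi hi'
    rw [hb i (by omega), zero_mul]
  have h3 : ∑ i ∈ Finset.Icc (p - B - 1 + 1) (A + 1), D I (b i) * dpow i c p =
      ∑ i ∈ Finset.Icc (p - B - 1) (A + 1), D I (b i) * dpow i c p := by
    refine Finset.sum_subset (Finset.Icc_subset_Icc_left (by omega)) fun i hi hi' => ?_
    rw [Finset.mem_Icc] at hi hi'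
    rw [hc.dpow i p (by omega), mul_zero]
  rw [h1, h3, Finset.sum_add_distrib, h2]
  ring

/-- The core of associativity, `(∂ⁱ ∘ b) c = ∂ⁱ ∘ (b c)`. For positive `i` the case of a single `∂`
is iterated; for negative `i` one descends by cancelling a `∂` on the left, so no identity between
binomial coefficients beyond Pascal's rule is needed. -/
theorem Psi.dpow_mul {A B : ℤ} {b c : Psi I} (hb : OrderLE A b) (hc : OrderLE B c) (i : ℤ) :
    mul (dpow i b) c = dpow i (mul b c) := by
  have hbc := hb.mul hc
  have step : ∀ i, mul (dpow (i + 1) b) c =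
      fun m => mul (dpow i b) c (m - 1) + D I (mul (dpow i b) c m) := fun i => by
    have h1 : dpow (i + 1) b = fun m => dpow i b (m - 1) + D I (dpow i b m) :=
      funext (dpow_succ hb i)
    rw [h1]
    exact funext (d_mul (hb.dpow i) hc)
  induction i using Int.induction_on with
  | zero => rw [dpow_zero hb, dpow_zero hbc]
  | succ i ih =>
    rw [step, ih]
    exact (funext (dpow_succ hbc i)).symm
  | pred i ih =>
    refine OrderLE.eq_of_d_eq (((hb.dpow _).mul hc).mono (by omega)) (hbc.dpow _)
      (A := A + B + (-i - 1)) fun m => ?_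
    rw [← dpow_succ hbc, sub_add_cancel, ← ih, ← congrFun (step (-i - 1)) m, sub_add_cancel]

theorem Psi.mul_assoc {A B C : ℤ} {a b c : Psi I} (ha : OrderLE A a) (hb : OrderLE B b)
    (hc : OrderLE C c) : mul (mul a b) c = mul a (mul b c) := by
  funext p
  rw [mul_eq_sum (ha.mul hb) hc (lo := p - C) (hi := A + B) le_rfl le_rfl,
    mul_eq_sum ha (hb.mul hc) (lo := p - C - B) (hi := A) (by omega) le_rfl]
  have h1 : ∀ m ∈ Finset.Icc (p - C) (A + B), mul a b m * dpow m c p =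
      ∑ i ∈ Finset.Icc (p - C - B) A, a i * (dpow i b m * dpow m c p) := fun m hm => by
    rw [Finset.mem_Icc] at hm
    rw [mul_eq_sum ha hb (lo := p - C - B) (hi := A) (by omega) le_rfl, Finset.sum_mul]
    simp only [_root_.mul_assoc]
  rw [Finset.sum_congr rfl h1, Finset.sum_comm]
  refine Finset.sum_congr rfl fun i hi => ?_
  rw [Finset.mem_Icc] at hi
  rw [← dpow_mul hb hc, mul_eq_sum (hb.dpow i) hc (lo := p - C) (hi := A + B) le_rfl (by omega),
    Finset.mul_sum]

theorem Psi.dpow_add {B : ℤ} {b c : Psi I} (hb : OrderLE B b) (hc : OrderLE B c) (i : ℤ) :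
    dpow i (b + c) = dpow i b + dpow i c := by
  have hbc : OrderLE B (b + c) := fun k hk => by rw [Pi.add_apply, hb k hk, hc k hk, add_zero]
  funext m
  rw [Pi.add_apply, dpow_eq_sum hbc (N := (B - m + i).toNat + 1) (by omega),
    dpow_eq_sum hb (N := (B - m + i).toNat + 1) (by omega),
    dpow_eq_sum hc (N := (B - m + i).toNat + 1) (by omega), ← Finset.sum_add_distrib]
  exact Finset.sum_congr rfl fun l _ => by rw [Pi.add_apply, map_add, smul_add]

theorem Psi.dpow_smul {B : ℤ} {b : Psi I} (hb : OrderLE B b) (i : ℤ) (r : ℝ) :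
    dpow i (r • b) = r • dpow i b := by
  have hb' : OrderLE B (r • b) := fun k hk => by rw [Pi.smul_apply, hb k hk, smul_zero]
  funext m
  rw [Pi.smul_apply, dpow_eq_sum hb' (N := (B - m + i).toNat + 1) (by omega),
    dpow_eq_sum hb (N := (B - m + i).toNat + 1) (by omega), Finset.smul_sum]
  exact Finset.sum_congr rfl fun l _ => by rw [Pi.smul_apply, map_smul, smul_comm]

theorem Psi.mul_add {A B : ℤ} {a b c : Psi I} (ha : OrderLE A a) (hb : OrderLE B b)
    (hc : OrderLE B c) : mul a (b + c) = mul a b + mul a c := by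
  have hbc : OrderLE B (b + c) := fun k hk => by rw [Pi.add_apply, hb k hk, hc k hk, add_zero]
  funext m
  rw [Pi.add_apply, mul_eq_sum ha hbc le_rfl le_rfl, mul_eq_sum ha hb le_rfl le_rfl,
    mul_eq_sum ha hc le_rfl le_rfl, ← Finset.sum_add_distrib]
  exact Finset.sum_congr rfl fun i _ => by rw [dpow_add hb hc, Pi.add_apply, _root_.mul_add]

theorem Psi.add_mul {A B : ℤ} {a b c : Psi I} (ha : OrderLE A a) (hb : OrderLE A b)
    (hc : OrderLE B c) : mul (a + b) c = mul a c + mul b c := by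
  have hab : OrderLE A (a + b) := fun k hk => by rw [Pi.add_apply, ha k hk, hb k hk, add_zero]
  funext m
  rw [Pi.add_apply, mul_eq_sum ha hc le_rfl le_rfl, mul_eq_sum hb hc le_rfl le_rfl,
    mul_eq_sum hab hc le_rfl le_rfl, ← Finset.sum_add_distrib]
  exact Finset.sum_congr rfl fun i _ => by rw [Pi.add_apply, _root_.add_mul]

theorem Psi.smul_mul {A B : ℤ} {a b : Psi I} (ha : OrderLE A a) (hb : OrderLE B b) (r : ℝ) :
    mul (r • a) b = r • mul a b := by
  have ha' : OrderLE A (r • a) := fun k hk => by rw [Pi.smul_apply, ha k hk, smul_zero]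
  funext m
  rw [Pi.smul_apply, mul_eq_sum ha hb le_rfl le_rfl, mul_eq_sum ha' hb le_rfl le_rfl,
    Finset.smul_sum]
  exact Finset.sum_congr rfl fun i _ => by rw [Pi.smul_apply, smul_mul_assoc]

theorem Psi.mul_smul {A B : ℤ} {a b : Psi I} (ha : OrderLE A a) (hb : OrderLE B b) (r : ℝ) :
    mul a (r • b) = r • mul a b := by
  have hb' : OrderLE B (r • b) := fun k hk => by rw [Pi.smul_apply, hb k hk, smul_zero]
  funext m
  rw [Pi.smul_apply, mul_eq_sum ha hb le_rfl le_rfl, mul_eq_sum ha hb' le_rfl le_rfl,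
    Finset.smul_sum]
  exact Finset.sum_congr rfl fun i _ => by rw [dpow_smul hb, Pi.smul_apply, mul_smul_comm]

theorem Psi.orderLE_single (i : ℤ) (f : Sm I) : OrderLE i (Pi.single i f : Psi I) :=
  fun k hk => Pi.single_eq_of_ne (by omega) _

theorem Psi.single_mul {B : ℤ} {b : Psi I} (hb : OrderLE B b) (i : ℤ) (f : Sm I) (m : ℤ) :
    mul (Pi.single i f) b m = f * dpow i b m := by
  rw [mul_eq_sum (orderLE_single i f) hb (lo := min i (m - B)) (hi := i) (min_le_right _ _) le_rfl,
    Finset.sum_eq_single i (fun j _ hj => by rw [Pi.single_eq_of_ne hj, zero_mul])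
      (fun h => absurd (Finset.mem_Icc.2 ⟨min_le_left _ _, le_rfl⟩) h), Pi.single_eq_same]

theorem Psi.one_mul {B : ℤ} {b : Psi I} (hb : OrderLE B b) : mul (Psi.one I) b = b := by
  funext m
  rw [Psi.one, single_mul hb, dpow_zero hb, _root_.one_mul]

theorem Psi.dpow_one (i : ℤ) : dpow i (Psi.one I) = Pi.single i 1 := by
  have h0 : OrderLE 0 (Psi.one I) := orderLE_single 0 1
  have step : ∀ i m : ℤ, (Pi.single (i + 1) 1 : Psi I) m =
      (Pi.single i 1 : Psi I) (m - 1) + D I ((Pi.single i 1 : Psi I) m) := by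
    intro i m
    rcases eq_or_ne m i with rfl | hm
    · rw [Pi.single_eq_same, D_one, Pi.single_eq_of_ne (by omega), Pi.single_eq_of_ne (by omega),
        add_zero]
    · rw [Pi.single_eq_of_ne hm, map_zero, add_zero]
      rcases eq_or_ne m (i + 1) with rfl | hm'
      · rw [add_sub_cancel_right, Pi.single_eq_same, Pi.single_eq_same]
      · rw [Pi.single_eq_of_ne hm', Pi.single_eq_of_ne (by omega)]
  induction i using Int.induction_on with
  | zero => rw [dpow_zero h0]; rfl
  | succ i ih =>
    funext m
    rw [dpow_succ h0, ih, step]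
  | pred i ih =>
    refine OrderLE.eq_of_d_eq (A := -i - 1) ((h0.dpow _).mono (by omega)) (orderLE_single _ _)
      fun m => ?_
    rw [← dpow_succ h0, ← step, sub_add_cancel, ih]

theorem Psi.mul_one {A : ℤ} {a : Psi I} (ha : OrderLE A a) : mul a (Psi.one I) = a := by
  funext m
  rw [mul_eq_sum ha (show OrderLE 0 (Psi.one I) from orderLE_single 0 1) (lo := min m A) (hi := max m A)
    ((min_le_left _ _).trans (by omega)) (le_max_right _ _)]
  simp only [dpow_one]
  rw [Finset.sum_eq_single m (fun j _ hj => by rw [Pi.single_eq_of_ne hj.symm, mul_zero])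
      (fun h => absurd (Finset.mem_Icc.2 ⟨min_le_left _ _, le_max_left _ _⟩) h),
    Pi.single_eq_same, _root_.mul_one]

end Symbols

/-! ### The algebra of formal pseudo-differential operators and the action of its differential part
-/

section Ring

/-- The formal pseudo-differential operators: symbols of finite order. -/
def boundedPsi (I : Opens ℝ) : Submodule ℝ (Psi I) where
  carrier := {a | ∃ A, Psi.OrderLE A a}
  add_mem' := by
    rintro a b ⟨A, ha⟩ ⟨B, hb⟩
    refine ⟨max A B, fun k hk => ?_⟩
    rw [Pi.add_apply, ha k ((le_max_left _ _).trans_lt hk), hb k ((le_max_right _ _).trans_lt hk),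
      add_zero]
  zero_mem' := ⟨0, fun _ _ => rfl⟩
  smul_mem' := by
    rintro r a ⟨A, ha⟩
    exact ⟨A, fun k hk => by rw [Pi.smul_apply, ha k hk, smul_zero]⟩

/-- The ring of formal pseudo-differential operators. -/
def PsiDO (I : Opens ℝ) : Type := boundedPsi I

namespace PsiDO

variable {I : Opens ℝ}

instance : AddCommGroup (PsiDO I) := inferInstanceAs (AddCommGroup (boundedPsi I))

instance : Module ℝ (PsiDO I) := inferInstanceAs (Module ℝ (boundedPsi I))

instance : Mul (PsiDO I) :=
  ⟨fun a b => ⟨Psi.mul a.1 b.1, by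
    obtain ⟨A, ha⟩ := a.2
    obtain ⟨B, hb⟩ := b.2
    exact ⟨A + B, ha.mul hb⟩⟩⟩

instance : One (PsiDO I) := ⟨⟨Psi.one I, 0, Psi.orderLE_single 0 1⟩⟩

theorem mul_val (a b : PsiDO I) : (a * b).1 = Psi.mul a.1 b.1 := rfl

theorem add_val (a b : PsiDO I) : (a + b).1 = a.1 + b.1 := rfl

theorem exists_orderLE₂ (a b : PsiDO I) : ∃ A, Psi.OrderLE A a.1 ∧ Psi.OrderLE A b.1 := by
  obtain ⟨A, ha⟩ := a.2
  obtain ⟨B, hb⟩ := b.2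
  exact ⟨max A B, ha.mono (le_max_left _ _), hb.mono (le_max_right _ _)⟩

theorem left_distrib_aux (a b c : PsiDO I) : a * (b + c) = a * b + a * c := by
  obtain ⟨A, ha⟩ := a.2
  obtain ⟨B, hb, hc⟩ := exists_orderLE₂ b c
  exact Subtype.ext (Psi.mul_add ha hb hc)

theorem right_distrib_aux (a b c : PsiDO I) : (a + b) * c = a * c + b * c := by
  obtain ⟨C, hc⟩ := c.2
  obtain ⟨B, ha, hb⟩ := exists_orderLE₂ a b
  exact Subtype.ext (Psi.add_mul ha hb hc)

instance : Ring (PsiDO I) :=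
  { (inferInstance : AddCommGroup (PsiDO I)), (inferInstance : Mul (PsiDO I)),
    (inferInstance : One (PsiDO I)) with
    left_distrib := left_distrib_aux
    right_distrib := right_distrib_aux
    zero_mul := fun a => by
      have h := right_distrib_aux 0 0 a
      rwa [add_zero, left_eq_add] at h
    mul_zero := fun a => by
      have h := left_distrib_aux a 0 0
      rwa [add_zero, left_eq_add] at h
    mul_assoc := fun a b c => by
      obtain ⟨A, ha⟩ := a.2
      obtain ⟨B, hb⟩ := b.2
      obtain ⟨C, hc⟩ := c.2
      exact Subtype.ext (Psi.mul_assoc ha hb hc)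
    one_mul := fun a => by
      obtain ⟨A, ha⟩ := a.2
      exact Subtype.ext (Psi.one_mul ha)
    mul_one := fun a => by
      obtain ⟨A, ha⟩ := a.2
      exact Subtype.ext (Psi.mul_one ha)
    zsmul := fun k a => k • a
    zsmul_zero' := fun a => zero_zsmul a
    zsmul_succ' := fun k a => SubNegMonoid.zsmul_succ' k a
    zsmul_neg' := fun k a => SubNegMonoid.zsmul_neg' k a }

instance : Algebra ℝ (PsiDO I) :=
  Algebra.ofModule
    (fun r a b => by
      obtain ⟨A, ha⟩ := a.2
      obtain ⟨B, hb⟩ := b.2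
      exact Subtype.ext (Psi.smul_mul ha hb r))
    (fun r a b => by
      obtain ⟨A, ha⟩ := a.2
      obtain ⟨B, hb⟩ := b.2
      exact Subtype.ext (Psi.mul_smul ha hb r))

theorem pow_val (a : PsiDO I) (k : ℕ) : (a ^ k).1 = Psi.pow a.1 k := by
  induction k with
  | zero => rw [pow_zero]; rfl
  | succ k ih => rw [pow_succ', mul_val, ih]; rfl

/-- The coefficient of `∂ᵏ`. -/
def coeff (k : ℤ) : PsiDO I →ₗ[ℝ] Sm I where
  toFun a := a.1 k
  map_add' _ _ := rfl
  map_smul' _ _ := rfl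

theorem coeff_apply (k : ℤ) (a : PsiDO I) : coeff k a = a.1 k := rfl

theorem ext_coeff {a b : PsiDO I} (h : ∀ k, coeff k a = coeff k b) : a = b :=
  Subtype.ext (funext h)

/-- The operator `f ∂ⁱ`. -/
def single (i : ℤ) (f : Sm I) : PsiDO I := ⟨Pi.single i f, i, Psi.orderLE_single i f⟩

theorem coeff_single_same (i : ℤ) (f : Sm I) : coeff i (single i f) = f := Pi.single_eq_same _ _

theorem coeff_single_of_ne {i k : ℤ} (h : k ≠ i) (f : Sm I) : coeff k (single i f) = 0 :=
  Pi.single_eq_of_ne h _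

theorem coeff_single (i k : ℤ) (f : Sm I) : coeff k (single i f) = if k = i then f else 0 := by
  split_ifs with h
  · rw [h, coeff_single_same]
  · exact coeff_single_of_ne h f

/-- The operators of order at most `A`. -/
def ordLE (A : ℤ) : Submodule ℝ (PsiDO I) where
  carrier := {a | ∀ k, A < k → coeff k a = 0}
  add_mem' {a b} ha hb k hk := by rw [map_add, ha k hk, hb k hk, add_zero]
  zero_mem' k _ := map_zero _
  smul_mem' r a ha k hk := by rw [map_smul, ha k hk, smul_zero]

theorem mem_ordLE_iff {A : ℤ} {a : PsiDO I} : a ∈ ordLE A ↔ Psi.OrderLE A a.1 := Iff.rfl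

theorem exists_mem_ordLE (a : PsiDO I) : ∃ A, a ∈ ordLE A := a.2

theorem ordLE_mono {A B : ℤ} (h : A ≤ B) : (ordLE A : Submodule ℝ (PsiDO I)) ≤ ordLE B :=
  fun _ ha k hk => ha k (h.trans_lt hk)

theorem single_mem_ordLE (i : ℤ) (f : Sm I) : single i f ∈ ordLE i := Psi.orderLE_single i f

theorem one_mem_ordLE : (1 : PsiDO I) ∈ ordLE 0 := Psi.orderLE_single 0 1

theorem mul_mem_ordLE {A B : ℤ} {a b : PsiDO I} (ha : a ∈ ordLE A) (hb : b ∈ ordLE B) :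
    a * b ∈ ordLE (A + B) := Psi.OrderLE.mul ha hb

theorem mem_ordLE_of_coeff_eq_zero {A : ℤ} {a : PsiDO I} (ha : a ∈ ordLE A) (h : coeff A a = 0) :
    a ∈ ordLE (A - 1) := fun k hk => by
  rcases (show A ≤ k by omega).eq_or_lt with rfl | hk'
  · exact h
  · exact ha k hk'

theorem coeff_mul_top {A B : ℤ} {a b : PsiDO I} (ha : a ∈ ordLE A) (hb : b ∈ ordLE B) :
    coeff (A + B) (a * b) = coeff A a * coeff B b := by
  rw [coeff_apply, mul_val, Psi.mul_eq_sum (mem_ordLE_iff.1 ha) (mem_ordLE_iff.1 hb) (lo := A)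
    (hi := A) (by omega) le_rfl, Finset.Icc_self, Finset.sum_singleton,
    Psi.dpow_eq_sum (mem_ordLE_iff.1 hb) (N := 1) (by push_cast; omega)]
  simp [coeff_apply]

theorem coeff_mul_top_sub_one {A B : ℤ} {a b : PsiDO I} (ha : a ∈ ordLE A) (hb : b ∈ ordLE B) :
    coeff (A + B - 1) (a * b) = coeff A a * coeff (B - 1) b + coeff (A - 1) a * coeff B b +
      A • (coeff A a * D I (coeff B b)) := by
  have h1 : Finset.Icc (A - 1) A = {A - 1, A} := by
    ext i; simp only [Finset.mem_Icc, Finset.mem_insert, Finset.mem_singleton]; omega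
  have h2 : A + B - 1 - (A - 1) = B := by ring
  have h3 : A + B - 1 - A = B - 1 := by ring
  rw [coeff_apply, mul_val, Psi.mul_eq_sum (mem_ordLE_iff.1 ha) (mem_ordLE_iff.1 hb) (lo := A - 1)
    (hi := A) (by omega) le_rfl, h1, Finset.sum_pair (by omega),
    Psi.dpow_eq_sum (mem_ordLE_iff.1 hb) (N := 1) (by push_cast; omega),
    Psi.dpow_eq_sum (mem_ordLE_iff.1 hb) (N := 2) (by push_cast; omega)]
  simp only [Finset.sum_range_succ, Finset.sum_range_zero, zero_add, Ring.choose_zero_right,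
    Ring.choose_one_right, h2, h3, one_smul, pow_zero, pow_one, Module.End.one_apply, coeff_apply,
    Nat.cast_zero, Nat.cast_one, add_zero, sub_add_cancel, mul_add, mul_smul_comm]
  abel

theorem commutator_mem_ordLE {A B : ℤ} {a b : PsiDO I} (ha : a ∈ ordLE A) (hb : b ∈ ordLE B) :
    a * b - b * a ∈ ordLE (A + B - 1) := by
  have hba : b * a ∈ ordLE (A + B) := by rw [add_comm A B]; exact mul_mem_ordLE hb ha
  refine mem_ordLE_of_coeff_eq_zero (sub_mem (mul_mem_ordLE ha hb) hba) ?_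
  rw [map_sub, coeff_mul_top ha hb, add_comm A B, coeff_mul_top hb ha, mul_comm, sub_self]

/-- Leading coefficients commute, so the top degree cancels and the next one carries the Poisson
bracket of the principal symbols. -/
theorem coeff_commutator {A B : ℤ} {a b : PsiDO I} (ha : a ∈ ordLE A) (hb : b ∈ ordLE B) :
    coeff (A + B - 1) (a * b - b * a) =
      A • (coeff A a * D I (coeff B b)) - B • (coeff B b * D I (coeff A a)) := by
  rw [map_sub, coeff_mul_top_sub_one ha hb, add_comm A B, coeff_mul_top_sub_one hb ha]
  ring

/-! ### The differential part -/

/-- The differential part `∑_{k ≥ 0} a_k ∂ᵏ`. -/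
def pos (a : PsiDO I) : PsiDO I :=
  ⟨fun k => if 0 ≤ k then a.1 k else 0, by
    obtain ⟨A, ha⟩ := a.2
    exact ⟨A, fun k hk => by simp only [ha k hk, ite_self]⟩⟩

theorem coeff_pos (a : PsiDO I) (k : ℤ) : coeff k (pos a) = if 0 ≤ k then coeff k a else 0 := rfl

theorem sub_pos_mem_ordLE (a : PsiDO I) : a - pos a ∈ ordLE (-1) := fun k hk => by
  rw [map_sub, coeff_pos, if_pos (by omega), sub_self]

theorem pos_mem_ordLE {A : ℤ} {a : PsiDO I} (ha : a ∈ ordLE A) : pos a ∈ ordLE A := fun k hk => by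
  rw [coeff_pos, ha k hk, ite_self]

/-- The operators without negative powers of `∂`. -/
def diff (I : Opens ℝ) : Submodule ℝ (PsiDO I) where
  carrier := {a | ∀ k, k < 0 → coeff k a = 0}
  add_mem' {a b} ha hb k hk := by rw [map_add, ha k hk, hb k hk, add_zero]
  zero_mem' k _ := map_zero _
  smul_mem' r a ha k hk := by rw [map_smul, ha k hk, smul_zero]

theorem pos_mem_diff (a : PsiDO I) : pos a ∈ diff I := fun k hk => by
  rw [coeff_pos, if_neg (by omega)]

theorem single_mem_diff (i : ℕ) (f : Sm I) : single (i : ℤ) f ∈ diff I := fun k hk => by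
  rw [coeff_single_of_ne (by omega)]

theorem choose_eq_zero {i : ℤ} (hi : 0 ≤ i) {l : ℕ} (h : i < l) : Ring.choose i l = 0 := by
  lift i to ℕ using hi
  rw [Ring.choose_natCast, Nat.choose_eq_zero_of_lt (by omega), Nat.cast_zero]

/-- If `a` is differential then the coefficients of `a * b` in degrees `≤ m` depend only on the
coefficients of `b` in degrees `≤ m`. -/
theorem coeff_mul_eq_zero {a b : PsiDO I} (ha : a ∈ diff I) {m : ℤ}
    (hb : ∀ k ≤ m, coeff k b = 0) : coeff m (a * b) = 0 := by
  obtain ⟨A, hA⟩ := exists_mem_ordLE a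
  obtain ⟨B, hB⟩ := exists_mem_ordLE b
  rw [coeff_apply, mul_val, Psi.mul_eq_sum (mem_ordLE_iff.1 hA) (mem_ordLE_iff.1 hB) le_rfl le_rfl]
  refine Finset.sum_eq_zero fun i _ => ?_
  rcases lt_or_ge i 0 with hi | hi
  · rw [← coeff_apply, ha i hi, zero_mul]
  have h0 : Psi.dpow i b.1 m = 0 := by
    refine finsum_eq_zero_of_forall_eq_zero fun l => ?_
    rcases lt_or_ge i l with hl | hl
    · rw [choose_eq_zero hi hl, zero_smul]
    · rw [← coeff_apply, hb _ (by omega), map_zero, smul_zero]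
  rw [h0, mul_zero]

theorem mul_mem_diff {a b : PsiDO I} (ha : a ∈ diff I) (hb : b ∈ diff I) : a * b ∈ diff I :=
  fun _ hm => coeff_mul_eq_zero ha fun k hk => hb k (by omega)

theorem one_mem_diff : (1 : PsiDO I) ∈ diff I := single_mem_diff 0 1

theorem pow_mem_diff {a : PsiDO I} (ha : a ∈ diff I) (k : ℕ) : a ^ k ∈ diff I := by
  induction k with
  | zero => rw [pow_zero]; exact one_mem_diff
  | succ k ih => rw [pow_succ]; exact mul_mem_diff ih ha

theorem plus_eq_sum {a : PsiDO I} {N : ℕ} (ha : a ∈ ordLE (N - 1)) :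
    Psi.plus a.1 = ∑ k ∈ Finset.range N, mulOp (coeff k a) * D I ^ k := by
  refine finsum_eq_sum_of_support_subset _ fun k hk => ?_
  rw [Finset.coe_range, Set.mem_Iio]
  by_contra h
  refine hk ?_
  have h0 : a.1 (k : ℤ) = 0 := ha k (by omega)
  simp only [h0]
  rw [show mulOp (0 : Sm I) = 0 from LinearMap.ext fun f => zero_mul f, zero_mul]

theorem dpow_single_zero (f : Sm I) (i : ℕ) :
    Psi.dpow (i : ℤ) (Pi.single 0 f) 0 = (D I ^ i) f := by
  rw [Psi.dpow, finsum_eq_single _ i fun l hl => by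
    rw [Pi.single_eq_of_ne (by omega), map_zero, smul_zero]]
  simp [Ring.choose_natCast]

/-- Applying the differential part to `f` amounts to taking the coefficient of `∂⁰` in `a ∘ f`. This
turns the action on functions into multiplication in the ring. -/
theorem plus_apply (a : PsiDO I) (f : Sm I) :
    Psi.plus a.1 f = coeff 0 (a * single 0 f) := by
  obtain ⟨A, hA⟩ := exists_mem_ordLE a
  have hN : a ∈ ordLE (((A.toNat + 1 : ℕ) : ℤ) - 1) := ordLE_mono (by omega) hA
  rw [plus_eq_sum hN, coeff_apply, mul_val, Psi.mul_eq_sum (mem_ordLE_iff.1 hN)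
    (mem_ordLE_iff.1 (single_mem_ordLE 0 f)) (lo := 0) (hi := A.toNat) (by omega) (by push_cast; omega),
    LinearMap.sum_apply]
  refine Finset.sum_nbij' (fun k : ℕ => (k : ℤ)) Int.toNat ?_ ?_ ?_ ?_ ?_
  · intro k hk; rw [Finset.mem_range] at hk; rw [Finset.mem_Icc]; omega
  · intro k hk; rw [Finset.mem_Icc] at hk; rw [Finset.mem_range]; omega
  · intro k _; exact Int.toNat_natCast k
  · intro k hk; rw [Finset.mem_Icc] at hk; exact Int.toNat_of_nonneg hk.1
  · intro k _
    rw [show (single 0 f).1 = Pi.single 0 f from rfl, dpow_single_zero]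
    rfl

theorem plus_add (a b : PsiDO I) : Psi.plus (a + b).1 = Psi.plus a.1 + Psi.plus b.1 :=
  LinearMap.ext fun f => by
    rw [LinearMap.add_apply, plus_apply, plus_apply, plus_apply, add_mul, map_add]

theorem plus_smul (r : ℝ) (a : PsiDO I) : Psi.plus (r • a).1 = r • Psi.plus a.1 :=
  LinearMap.ext fun f => by
    rw [LinearMap.smul_apply, plus_apply, plus_apply, smul_mul_assoc, map_smul]

/-- The operator on functions defined by the differential part of a symbol. -/
def toEnd (I : Opens ℝ) : PsiDO I →ₗ[ℝ] Module.End ℝ (Sm I) where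
  toFun a := Psi.plus a.1
  map_add' := plus_add
  map_smul' := plus_smul

theorem toEnd_eq_plus (a : PsiDO I) : toEnd I a = Psi.plus a.1 := rfl

theorem toEnd_apply (a : PsiDO I) (f : Sm I) : toEnd I a f = coeff 0 (a * single 0 f) :=
  plus_apply a f

theorem toEnd_eq_sum {a : PsiDO I} {N : ℕ} (ha : a ∈ ordLE (N - 1)) :
    toEnd I a = ∑ k ∈ Finset.range N, mulOp (coeff k a) * D I ^ k := plus_eq_sum ha

/-- The symbol `b ∘ f` minus its coefficient of `∂⁰` has only positive powers of `∂`, and left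
multiplication by a differential `a` creates no coefficient of `∂⁰` from these. -/
theorem toEnd_mul {a b : PsiDO I} (ha : a ∈ diff I) (hb : b ∈ diff I) :
    toEnd I (a * b) = toEnd I a * toEnd I b := by
  refine LinearMap.ext fun f => ?_
  rw [Module.End.mul_apply, toEnd_apply, toEnd_apply, mul_assoc, ← sub_eq_zero, ← map_sub, ← mul_sub]
  refine coeff_mul_eq_zero ha fun k hk => ?_
  rw [map_sub, coeff_single]
  split_ifs with h
  · rw [h, toEnd_apply, sub_self]
  · have h0 : b * single 0 f ∈ diff I := mul_mem_diff hb (single_mem_diff 0 f)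
    rw [h0 k (by omega), sub_zero]

theorem toEnd_single (i : ℕ) (f : Sm I) : toEnd I (single i f) = mulOp f * D I ^ i := by
  rw [toEnd_eq_sum (N := i + 1) (by push_cast; rw [add_sub_cancel_right]; exact single_mem_ordLE _ _),
    Finset.sum_range_succ, coeff_single_same, Finset.sum_eq_zero, zero_add]
  intro k hk
  rw [Finset.mem_range] at hk
  rw [coeff_single_of_ne (by omega), show mulOp (0 : Sm I) = 0 from
    LinearMap.ext fun f => zero_mul f, zero_mul]

theorem toEnd_one : toEnd I (1 : PsiDO I) = 1 := by
  refine (toEnd_single 0 1).trans (LinearMap.ext fun f => ?_)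
  exact one_mul f

theorem toEnd_pow {a : PsiDO I} (ha : a ∈ diff I) (k : ℕ) : toEnd I (a ^ k) = toEnd I a ^ k := by
  induction k with
  | zero => rw [pow_zero, pow_zero, toEnd_one]
  | succ k ih => rw [pow_succ, pow_succ, toEnd_mul (pow_mem_diff ha k) ha, ih]

theorem toEnd_pos (a : PsiDO I) : toEnd I (pos a) = toEnd I a := by
  obtain ⟨A, hA⟩ := exists_mem_ordLE a
  have hN : a ∈ ordLE (((A.toNat + 1 : ℕ) : ℤ) - 1) := ordLE_mono (by omega) hA
  rw [toEnd_eq_sum hN, toEnd_eq_sum (pos_mem_ordLE hN)]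
  exact Finset.sum_congr rfl fun k _ => by rw [coeff_pos, if_pos (by omega)]

/-- A differential symbol is determined by its operator. -/
theorem eq_zero_of_toEnd_eq_zero {a : PsiDO I} (ha : a ∈ diff I) (h : toEnd I a = 0) : a = 0 := by
  obtain ⟨A, hA⟩ := exists_mem_ordLE a
  have hN : a ∈ ordLE (((A.toNat + 1 : ℕ) : ℤ) - 1) := ordLE_mono (by omega) hA
  rw [toEnd_eq_sum hN] at h
  refine ext_coeff fun k => ?_
  rw [map_zero]
  rcases lt_or_ge k 0 with hk | hk
  · exact ha k hk
  rcases lt_or_ge (((A.toNat + 1 : ℕ) : ℤ) - 1) k with hk' | hk'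
  · exact hN k hk'
  lift k to ℕ using hk
  refine Sm.ext_ev fun x => ?_
  -- Evaluating at `x` the image of the `k`-th power of the coordinate centred at `x` yields `k!`
  -- times the `k`-th coefficient.
  have h1 := congrArg (fun T : Module.End ℝ (Sm I) => ev x (T (coordAt x ^ k))) h
  simp only [LinearMap.sum_apply, map_sum, Module.End.mul_apply, LinearMap.mulLeft_apply, map_mul,
    ev_D_pow_coordAt, LinearMap.zero_apply, map_zero, mul_ite, mul_zero] at h1
  rw [Finset.sum_ite_eq' (Finset.range (A.toNat + 1)) k, if_pos (Finset.mem_range.2 (by omega))] at h1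
  rw [map_zero]
  exact (mul_eq_zero.1 h1).resolve_right (by exact_mod_cast k.factorial_ne_zero)

theorem toEnd_injOn {a b : PsiDO I} (ha : a ∈ diff I) (hb : b ∈ diff I)
    (h : toEnd I a = toEnd I b) : a = b :=
  sub_eq_zero.1 (eq_zero_of_toEnd_eq_zero (sub_mem ha hb) (by rw [map_sub, h, sub_self]))

end PsiDO
end Ring

namespace PsiDO

variable {I J : Opens ℝ} {n : ℕ}

/-! ### Roots of monic operators -/

section Root

/-- The operator is `∂ + ⋯`. -/
def IsMonicOne (X : PsiDO I) : Prop := X ∈ ordLE 1 ∧ coeff 1 X = 1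

theorem IsMonicOne.pow {X : PsiDO I} (hX : IsMonicOne X) (p : ℕ) :
    X ^ p ∈ ordLE p ∧ coeff p (X ^ p) = 1 := by
  induction p with
  | zero => rw [pow_zero]; exact ⟨one_mem_ordLE, coeff_single_same 0 1⟩
  | succ p ih =>
    rw [pow_succ]
    push_cast
    exact ⟨mul_mem_ordLE ih.1 hX.1, by rw [coeff_mul_top ih.1 hX.1, ih.2, hX.2, one_mul]⟩

/-- The linearisation of `X ↦ Xᵖ` at top order: all factors are monic, so the leading coefficient of
a perturbation is multiplied by `p`. Both the uniqueness of roots and the recursion that constructs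
them rest on it. -/
theorem IsMonicOne.pow_sub_pow {X Y : PsiDO I} (hX : IsMonicOne X) (hY : IsMonicOne Y) {d : ℤ}
    (h : X - Y ∈ ordLE d) (p : ℕ) :
    X ^ p - Y ^ p ∈ ordLE (p - 1 + d) ∧
      coeff (p - 1 + d) (X ^ p - Y ^ p) = (p : ℝ) • coeff d (X - Y) := by
  induction p with
  | zero =>
    rw [pow_zero, pow_zero, sub_self]
    exact ⟨zero_mem _, by rw [map_zero, CharP.cast_eq_zero, zero_smul]⟩
  | succ p ih =>
    have h1 : X ^ (p + 1) - Y ^ (p + 1) = X * (X ^ p - Y ^ p) + (X - Y) * Y ^ p := by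
      rw [pow_succ', pow_succ']; noncomm_ring
    have e1 : ((p + 1 : ℕ) : ℤ) - 1 + d = 1 + (p - 1 + d) := by push_cast; ring
    have e2 : 1 + (p - 1 + d) = d + p := by ring
    have h2 := mul_mem_ordLE h (hY.pow p).1
    have h3 := coeff_mul_top h (hY.pow p).1
    rw [← e2] at h2 h3
    rw [h1, e1]
    refine ⟨add_mem (mul_mem_ordLE hX.1 ih.1) h2, ?_⟩
    rw [map_add, coeff_mul_top hX.1 ih.1, h3, hX.2, ih.2, (hY.pow p).2, one_mul, mul_one,
      Nat.cast_succ, add_smul, one_smul]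

theorem IsMonicOne.eq_of_pow_eq {X Y : PsiDO I} (hX : IsMonicOne X) (hY : IsMonicOne Y)
    (hn : 0 < n) (h : X ^ n = Y ^ n) : X = Y := by
  have key : ∀ j : ℕ, X - Y ∈ ordLE (-j) := by
    intro j
    induction j with
    | zero =>
      have := mem_ordLE_of_coeff_eq_zero (sub_mem hX.1 hY.1) (by rw [map_sub, hX.2, hY.2, sub_self])
      simpa using this
    | succ j ih =>
      have h1 := (hX.pow_sub_pow hY ih n).2
      rw [h, sub_self, map_zero] at h1
      have h2 := (smul_eq_zero.1 h1.symm).resolve_left (by exact_mod_cast hn.ne')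
      have h3 := mem_ordLE_of_coeff_eq_zero ih h2
      rwa [show -((j + 1 : ℕ) : ℤ) = -j - 1 by push_cast; ring]
  refine sub_eq_zero.1 (ext_coeff fun k => ?_)
  rw [map_zero]
  exact key ((-k).toNat + 1) k (by omega)

/-- Successive approximations of the monic `n`-th root of `ℓ`. -/
def rootSeq (n : ℕ) (ℓ : PsiDO I) : ℕ → PsiDO I
  | 0 => single 1 1
  | j + 1 => rootSeq n ℓ j +
      single (-j) ((n : ℝ)⁻¹ • coeff (n - 1 - j) (ℓ - rootSeq n ℓ j ^ n))

theorem rootSeq_succ_sub (n : ℕ) (ℓ : PsiDO I) (j : ℕ) :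
    rootSeq n ℓ (j + 1) - rootSeq n ℓ j =
      single (-j) ((n : ℝ)⁻¹ • coeff (n - 1 - j) (ℓ - rootSeq n ℓ j ^ n)) := by
  rw [rootSeq, add_sub_cancel_left]

theorem rootSeq_succ_sub_mem (n : ℕ) (ℓ : PsiDO I) (j : ℕ) :
    rootSeq n ℓ (j + 1) - rootSeq n ℓ j ∈ ordLE (-j) := by
  rw [rootSeq_succ_sub]; exact single_mem_ordLE _ _

theorem isMonicOne_rootSeq (n : ℕ) (ℓ : PsiDO I) (j : ℕ) : IsMonicOne (rootSeq n ℓ j) := by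
  induction j with
  | zero => exact ⟨single_mem_ordLE _ _, coeff_single_same _ _⟩
  | succ j ih =>
    refine ⟨add_mem ih.1 (ordLE_mono (by omega) (single_mem_ordLE _ _)), ?_⟩
    rw [rootSeq, map_add, ih.2, coeff_single_of_ne (by omega), add_zero]

/-- A correction of order `-j` changes the `n`-th power in order `n - 1 - j` by `n` times its
coefficient. The factor `n⁻¹` in `rootSeq` therefore cancels the leading error exactly. -/
theorem sub_rootSeq_pow_mem (hn : 0 < n) {ℓ : PsiDO I} (hℓ : ℓ ∈ ordLE n) (hℓ' : coeff n ℓ = 1)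
    (j : ℕ) : ℓ - rootSeq n ℓ j ^ n ∈ ordLE (n - 1 - j) := by
  induction j with
  | zero =>
    have h := (isMonicOne_rootSeq n ℓ 0).pow n
    have := mem_ordLE_of_coeff_eq_zero (sub_mem hℓ h.1) (by rw [map_sub, hℓ', h.2, sub_self])
    simpa using this
  | succ j ih =>
    have h := (isMonicOne_rootSeq n ℓ (j + 1)).pow_sub_pow (isMonicOne_rootSeq n ℓ j)
      (rootSeq_succ_sub_mem n ℓ j) n
    rw [rootSeq_succ_sub, coeff_single_same, smul_smul,
      mul_inv_cancel₀ (by exact_mod_cast hn.ne'), one_smul, ← sub_eq_add_neg] at h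
    have e : ℓ - rootSeq n ℓ (j + 1) ^ n =
        (ℓ - rootSeq n ℓ j ^ n) - (rootSeq n ℓ (j + 1) ^ n - rootSeq n ℓ j ^ n) := by abel
    rw [show ((n : ℤ) - 1 - (j + 1 : ℕ)) = n - 1 - j - 1 by push_cast; ring, e]
    exact mem_ordLE_of_coeff_eq_zero (sub_mem ih h.1) (by rw [map_sub, h.2, sub_self])

/-- The step from `j` to `j + 1` touches only the coefficient of `∂⁻ʲ`, so the coefficient of `∂ᵏ`
is final from index `1 - k` on. -/
theorem coeff_rootSeq (n : ℕ) (ℓ : PsiDO I) {k : ℤ} {j : ℕ} (hj : (1 - k).toNat ≤ j) :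
    coeff k (rootSeq n ℓ j) = coeff k (rootSeq n ℓ (1 - k).toNat) := by
  induction j, hj using Nat.le_induction with
  | base => rfl
  | succ j hj ih =>
    rw [← ih, ← sub_eq_zero, ← map_sub]
    exact rootSeq_succ_sub_mem n ℓ j k (by omega)

/-- The monic `n`-th root. -/
def root (n : ℕ) (ℓ : PsiDO I) : PsiDO I :=
  ⟨fun k => coeff k (rootSeq n ℓ (1 - k).toNat), 1, fun k hk => (isMonicOne_rootSeq n ℓ _).1 k hk⟩

theorem coeff_root (n : ℕ) (ℓ : PsiDO I) (k : ℤ) :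
    coeff k (root n ℓ) = coeff k (rootSeq n ℓ (1 - k).toNat) := rfl

theorem isMonicOne_root (n : ℕ) (ℓ : PsiDO I) : IsMonicOne (root n ℓ) :=
  ⟨fun k hk => (isMonicOne_rootSeq n ℓ _).1 k hk,
    (coeff_root n ℓ 1).trans (isMonicOne_rootSeq n ℓ _).2⟩

theorem root_sub_rootSeq_mem (n : ℕ) (ℓ : PsiDO I) (j : ℕ) :
    root n ℓ - rootSeq n ℓ j ∈ ordLE (-j) := fun k hk => by
  rw [map_sub, coeff_root, coeff_rootSeq n ℓ (j := j) (by omega), sub_self]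

theorem root_pow (hn : 0 < n) {ℓ : PsiDO I} (hℓ : ℓ ∈ ordLE n) (hℓ' : coeff n ℓ = 1) :
    root n ℓ ^ n = ℓ := by
  refine ext_coeff fun k => ?_
  obtain ⟨j, hj⟩ : ∃ j : ℕ, (n : ℤ) - 1 - j < k := ⟨(n - k).toNat, by omega⟩
  have h1 := ((isMonicOne_root n ℓ).pow_sub_pow (isMonicOne_rootSeq n ℓ j)
    (root_sub_rootSeq_mem n ℓ j) n).1 k (by omega)
  have h2 := sub_rootSeq_pow_mem hn hℓ hℓ' j k hj
  rw [map_sub, sub_eq_zero] at h1 h2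
  rw [h1, h2]

end Root

/-! ### Smooth families -/

section SmoothFamily

/-- A family of operators of bounded order with coefficients in `𝓕_{x,t}`. -/
def SmoothFam (J : Opens ℝ) (a : ℝ → PsiDO I) : Prop :=
  (∃ A, ∀ t ∈ J, a t ∈ ordLE A) ∧ ∀ k, JointC ∞ (J : Set ℝ) fun t => coeff k (a t)

variable {a b : ℝ → PsiDO I}

theorem SmoothFam.exists_ordLE₂ (ha : SmoothFam J a) (hb : SmoothFam J b) :
    ∃ A, ∀ t ∈ J, a t ∈ ordLE A ∧ b t ∈ ordLE A := by
  obtain ⟨⟨A, hA⟩, -⟩ := ha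
  obtain ⟨⟨B, hB⟩, -⟩ := hb
  exact ⟨max A B, fun t ht => ⟨ordLE_mono (le_max_left _ _) (hA t ht),
    ordLE_mono (le_max_right _ _) (hB t ht)⟩⟩

theorem SmoothFam.add (ha : SmoothFam J a) (hb : SmoothFam J b) :
    SmoothFam J fun t => a t + b t := by
  obtain ⟨A, hA⟩ := ha.exists_ordLE₂ hb
  refine ⟨⟨A, fun t ht => add_mem (hA t ht).1 (hA t ht).2⟩, fun k => ?_⟩
  simp only [map_add]
  exact (ha.2 k).add (hb.2 k)

theorem SmoothFam.sub (ha : SmoothFam J a) (hb : SmoothFam J b) :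
    SmoothFam J fun t => a t - b t := by
  obtain ⟨A, hA⟩ := ha.exists_ordLE₂ hb
  refine ⟨⟨A, fun t ht => sub_mem (hA t ht).1 (hA t ht).2⟩, fun k => ?_⟩
  simp only [map_sub]
  exact (ha.2 k).sub (hb.2 k)

theorem SmoothFam.smul (ha : SmoothFam J a) {c : ℝ → ℝ} (hc : ContDiffOn ℝ ∞ c J) :
    SmoothFam J fun t => c t • a t := by
  obtain ⟨⟨A, hA⟩, ha'⟩ := ha
  refine ⟨⟨A, fun t ht => Submodule.smul_mem _ _ (hA t ht)⟩, fun k => ?_⟩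
  simp only [map_smul]
  exact (ha' k).smul hc

theorem SmoothFam.pos (ha : SmoothFam J a) : SmoothFam J fun t => pos (a t) := by
  obtain ⟨⟨A, hA⟩, ha'⟩ := ha
  refine ⟨⟨A, fun t ht => pos_mem_ordLE (hA t ht)⟩, fun k => ?_⟩
  simp only [coeff_pos]
  split_ifs
  · exact ha' k
  · exact jointC_zero

theorem smoothFam_single (i : ℤ) {f : ℝ → Sm I} (hf : JointC ∞ (J : Set ℝ) f) :
    SmoothFam J fun t => single i (f t) := by
  refine ⟨⟨i, fun t _ => single_mem_ordLE _ _⟩, fun k => ?_⟩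
  simp only [coeff_single]
  split_ifs
  · exact hf
  · exact jointC_zero

theorem smoothFam_const (a : PsiDO I) : SmoothFam J fun _ => a :=
  ⟨(exists_mem_ordLE a).imp fun _ hA _ _ => hA, fun _ => jointC_const_of_contDiffOn le_rfl _⟩

theorem SmoothFam.sum {ι : Type*} {s : Finset ι} {a : ι → ℝ → PsiDO I}
    (h : ∀ i ∈ s, SmoothFam J (a i)) : SmoothFam J fun t => ∑ i ∈ s, a i t := by
  classical
  induction s using Finset.induction_on with
  | empty => simpa using smoothFam_const (0 : PsiDO I)
  | insert i s hi ih =>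
    simp only [Finset.sum_insert hi]
    exact (h i (by simp)).add (ih fun k hk => h k (by simp [hk]))

theorem SmoothFam.mul (ha : SmoothFam J a) (hb : SmoothFam J b) :
    SmoothFam J fun t => a t * b t := by
  obtain ⟨⟨A, hA⟩, ha'⟩ := ha
  obtain ⟨⟨B, hB⟩, hb'⟩ := hb
  refine ⟨⟨A + B, fun t ht => mul_mem_ordLE (hA t ht) (hB t ht)⟩, fun m => ?_⟩
  have h1 : JointC ∞ (J : Set ℝ) fun t => ∑ i ∈ Finset.Icc (m - B) A, coeff i (a t) *
      ∑ l ∈ Finset.range ((B - m + A).toNat + 1),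
        Ring.choose i l • (D I ^ l) (coeff (m - i + l) (b t)) :=
    JointC.sum fun i _ => (ha' i).mul (JointC.sum fun l _ => ((hb' _).D_pow l).zsmul _)
  refine h1.congr fun t ht => ?_
  rw [coeff_apply, mul_val, Psi.mul_eq_sum (mem_ordLE_iff.1 (hA t ht)) (mem_ordLE_iff.1 (hB t ht))
    le_rfl le_rfl]
  refine Finset.sum_congr rfl fun i hi => ?_
  rw [Finset.mem_Icc] at hi
  rw [Psi.dpow_eq_sum (mem_ordLE_iff.1 (hB t ht)) (N := (B - m + A).toNat + 1) (by omega)]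
  rfl

theorem SmoothFam.pow (ha : SmoothFam J a) (k : ℕ) : SmoothFam J fun t => a t ^ k := by
  induction k with
  | zero => simpa only [pow_zero] using smoothFam_const 1
  | succ k ih => simpa only [pow_succ] using ih.mul ha

theorem SmoothFam.rootSeq (ha : SmoothFam J a) (n j : ℕ) :
    SmoothFam J fun t => rootSeq n (a t) j := by
  induction j with
  | zero => exact smoothFam_const _
  | succ j ih => exact ih.add (smoothFam_single _ (((ha.sub (ih.pow n)).2 _).const_smul _))

theorem SmoothFam.root (ha : SmoothFam J a) (n : ℕ) : SmoothFam J fun t => root n (a t) :=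
  ⟨⟨1, fun t _ => (isMonicOne_root n (a t)).1⟩, fun k => (ha.rootSeq n _).2 k⟩

theorem SmoothFam.exists_nat_ordLE (ha : SmoothFam J a) : ∃ M : ℕ, ∀ t ∈ J, a t ∈ ordLE M := by
  obtain ⟨⟨A, hA⟩, -⟩ := ha
  exact ⟨A.toNat, fun t ht => ordLE_mono (Int.self_le_toNat A) (hA t ht)⟩

end SmoothFamily

/-! ### Operators almost commuting with a monic operator -/

section Commuting

/-- Since `Rᵏ` commutes with `Rⁿ`, its differential part has up to sign the same commutator with
`Rⁿ` as the remaining part, which has order at most `-1`. -/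
theorem commutator_pos_pow_mem (R : PsiDO I) (k : ℕ) (h : R ^ n ∈ ordLE n) :
    pos (R ^ k) * R ^ n - R ^ n * pos (R ^ k) ∈ ordLE (n - 2) := by
  have h1 : pos (R ^ k) * R ^ n - R ^ n * pos (R ^ k) =
      - ((R ^ k - pos (R ^ k)) * R ^ n - R ^ n * (R ^ k - pos (R ^ k))) := by
    rw [sub_mul, mul_sub, ← pow_add, ← pow_add, add_comm n k]
    abel
  rw [h1]
  have h2 := commutator_mem_ordLE (sub_pos_mem_ordLE (R ^ k)) h
  rw [show (n : ℤ) - 2 = -1 + n - 1 by ring]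
  exact neg_mem h2

/-- The coefficient in question is `-n` times the derivative of the leading coefficient of `b`,
because `ℓ` is monic. -/
theorem D_eq_zero_of_commutator {M : ℕ} (hn : 0 < n) {ℓ b : PsiDO I} (hℓ : ℓ ∈ ordLE n)
    (hℓ' : coeff n ℓ = 1) (hb : b ∈ ordLE M)
    (h : coeff (M + n - 1) (b * ℓ - ℓ * b) = 0) : D I (coeff M b) = 0 := by
  rw [coeff_commutator hb hℓ, hℓ', D_one, mul_zero, smul_zero, zero_sub, neg_eq_zero, one_mul] at h
  rw [← Int.cast_smul_eq_zsmul ℝ] at h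
  exact (smul_eq_zero.1 h).resolve_left (by exact_mod_cast hn.ne')

/-- A differential operator whose commutator with a monic operator `ℓ` of order `n` has order
less than `n` is a function plus a combination of differential parts of fractional powers. -/
theorem exists_eq_sum_pos_pow (hI : (I : Set ℝ).OrdConnected) (x₀ : I) (hn : 0 < n)
    {ℓ R : ℝ → PsiDO I} (hℓ : ∀ t ∈ J, ℓ t ∈ ordLE n) (hℓ' : ∀ t ∈ J, coeff n (ℓ t) = 1)
    (hR : SmoothFam J R) (hR₁ : ∀ t ∈ J, IsMonicOne (R t)) (hRn : ∀ t ∈ J, R t ^ n = ℓ t)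
    (M : ℕ) {b : ℝ → PsiDO I} (hb : SmoothFam J b) (hbd : ∀ t ∈ J, b t ∈ diff I)
    (hbM : ∀ t ∈ J, b t ∈ ordLE M)
    (hcomm : ∀ t ∈ J, b t * ℓ t - ℓ t * b t ∈ ordLE (n - 1)) :
    ∃ (c : ℕ → ℝ → ℝ) (f : ℝ → Sm I), (∀ k, ContDiffOn ℝ ∞ (c k) J) ∧
      JointC ∞ (J : Set ℝ) f ∧
      ∀ t ∈ J, b t = single 0 (f t) + ∑ k ∈ Finset.range (M + 1), c k t • pos (R t ^ k) := by
  induction M generalizing b with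
  | zero =>
    -- In order zero the condition on the commutator says nothing, so the function `f` stays
    -- arbitrary.
    refine ⟨fun _ _ => 0, fun t => coeff 0 (b t), fun _ => contDiffOn_const, hb.2 0,
      fun t ht => ext_coeff fun k => ?_⟩
    simp only [zero_smul, Finset.sum_const_zero, add_zero, coeff_single]
    split_ifs with hk
    · rw [hk]
    · rcases lt_or_gt_of_ne hk with hk | hk
      · exact hbd t ht k hk
      · exact hbM t ht k (by simpa using hk)
  | succ M ih =>
    -- The commutator has no term of degree `M + n`, which makes the leading coefficient a function
    -- `C` of `t` alone. Subtracting `C` times the differential part of `R^(M+1)` lowers the order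
    -- and preserves the hypothesis, as that part has a commutator of order at most `n - 2`.
    set C : ℝ → ℝ := fun t => ev x₀ (coeff ((M + 1 : ℕ) : ℤ) (b t)) with hC
    have hCs : ContDiffOn ℝ ∞ C J := (hb.2 _).contDiffOn_ev x₀
    have htop : ∀ t ∈ J, coeff ((M + 1 : ℕ) : ℤ) (b t) = algebraMap ℝ (Sm I) (C t) := by
      intro t ht
      refine eq_algebraMap_of_D_eq_zero hI ?_ x₀
      exact D_eq_zero_of_commutator hn (hℓ t ht) (hℓ' t ht) (hbM t ht)
        (hcomm t ht _ (by push_cast; omega))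
    obtain ⟨c, f, hc, hf, h⟩ := ih (b := fun t => b t - C t • pos (R t ^ (M + 1)))
      (hb.sub ((hR.pow (M + 1)).pos.smul hCs))
      (fun t ht => sub_mem (hbd t ht) (Submodule.smul_mem _ _ (pos_mem_diff _)))
      (fun t ht => by
        have h1 := (hR₁ t ht).pow (M + 1)
        have h2 := mem_ordLE_of_coeff_eq_zero (sub_mem (hbM t ht)
          (Submodule.smul_mem _ (C t) (pos_mem_ordLE h1.1))) (by
            rw [map_sub, map_smul, coeff_pos, if_pos (by omega), h1.2, htop t ht,
              Algebra.algebraMap_eq_smul_one, sub_self])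
        simpa using h2)
      (fun t ht => by
        have h1 : (b t - C t • pos (R t ^ (M + 1))) * ℓ t -
            ℓ t * (b t - C t • pos (R t ^ (M + 1))) = (b t * ℓ t - ℓ t * b t) -
              C t • (pos (R t ^ (M + 1)) * ℓ t - ℓ t * pos (R t ^ (M + 1))) := by
          rw [sub_mul, mul_sub, smul_mul_assoc, mul_smul_comm, smul_sub]
          abel
        rw [h1]
        refine sub_mem (hcomm t ht) (Submodule.smul_mem _ _ ?_)
        have h2 := commutator_pos_pow_mem (R t) (M + 1) (by rw [hRn t ht]; exact hℓ t ht)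
        rw [hRn t ht] at h2
        exact ordLE_mono (by omega) h2)
    refine ⟨fun k => if k = M + 1 then C else c k, f, fun k => ?_, hf, fun t ht => ?_⟩
    · dsimp only
      split_ifs
      · exact hCs
      · exact hc k
    · dsimp only
      rw [Finset.sum_range_succ, if_pos rfl, ← add_assoc, ← sub_eq_iff_eq_add, h t ht]
      congr 1
      refine Finset.sum_congr rfl fun k hk => ?_
      rw [Finset.mem_range] at hk
      rw [if_neg (by omega)]

end Commuting

end PsiDO

/-! ### `n`-KdV operators and the Lax equation in terms of symbols -/

section KdV

variable {I J : Opens ℝ} {n : ℕ}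

namespace PsiDO

/-- The symbol of `∑_{k<n} h_k ∂ᵏ`. -/
def low (h : Fin n → Sm I) : PsiDO I := ∑ k : Fin n, single ((k : ℕ) : ℤ) (h k)

/-- The symbol of `∂ⁿ + ∑_{k<n} u_k ∂ᵏ`. -/
def ell (u : Fin n → Sm I) : PsiDO I := single n 1 + low u

theorem ell_val (u : Fin n → Sm I) : (ell u).1 = symL u := by
  have h : (low u).1 = ∑ k : Fin n, (single ((k : ℕ) : ℤ) (u k)).1 :=
    map_sum (boundedPsi I).subtype (fun k : Fin n => single ((k : ℕ) : ℤ) (u k)) Finset.univ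
  rw [ell, add_val, h]
  rfl

theorem toEnd_low (h : Fin n → Sm I) : toEnd I (low h) = (opLow h).1 := by
  rw [low, map_sum]
  exact Finset.sum_congr rfl fun k _ => toEnd_single k (h k)

theorem toEnd_ell (u : Fin n → Sm I) : toEnd I (ell u) = (opL u).1 := by
  rw [ell, map_add, toEnd_low, toEnd_single, opL_eq]
  rw [show mulOp (1 : Sm I) = 1 from LinearMap.ext fun f => one_mul f, one_mul]
  rfl

theorem low_mem_diff (h : Fin n → Sm I) : low h ∈ diff I :=
  sum_mem fun k _ => single_mem_diff k (h k)

theorem low_mem_ordLE (h : Fin n → Sm I) : low h ∈ ordLE (n - 1) :=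
  sum_mem fun k _ => ordLE_mono (by have := k.2; omega) (single_mem_ordLE _ _)

theorem coeff_low (h : Fin n → Sm I) (k : Fin n) : coeff ((k : ℕ) : ℤ) (low h) = h k := by
  rw [low, map_sum, Finset.sum_eq_single k]
  · exact coeff_single_same _ _
  · intro j _ hj
    exact coeff_single_of_ne (fun h => hj (Fin.ext (by exact_mod_cast h.symm))) _
  · simp

theorem ell_mem_diff (u : Fin n → Sm I) : ell u ∈ diff I :=
  add_mem (single_mem_diff n 1) (low_mem_diff u)

theorem ell_mem_ordLE (u : Fin n → Sm I) : ell u ∈ ordLE n :=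
  add_mem (single_mem_ordLE _ _) (ordLE_mono (by omega) (low_mem_ordLE u))

theorem coeff_ell (u : Fin n → Sm I) : coeff n (ell u) = 1 := by
  rw [ell, map_add, coeff_single_same, low_mem_ordLE u n (by omega), add_zero]

theorem smoothFam_ell {u : ℝ → Fin n → Sm I} (hu : ∀ k, JointC ∞ (J : Set ℝ) fun t => u t k) :
    SmoothFam J fun t => ell (u t) :=
  (smoothFam_const _).add (SmoothFam.sum fun k _ => smoothFam_single _ (hu k))

/-- The operator `L^{1/n}`. -/
def rootL (u : Fin n → Sm I) : PsiDO I := root n (ell u)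

theorem isMonicOne_rootL (u : Fin n → Sm I) : IsMonicOne (rootL u) := isMonicOne_root _ _

theorem rootL_pow (hn : 0 < n) (u : Fin n → Sm I) : rootL u ^ n = ell u :=
  root_pow hn (ell_mem_ordLE u) (coeff_ell u)

theorem isRootL_rootL (hn : 0 < n) (u : Fin n → Sm I) : IsRootL u (rootL u).1 :=
  ⟨(isMonicOne_rootL u).2, (isMonicOne_rootL u).1, by rw [← pow_val, rootL_pow hn, ell_val]⟩

/-- Monic roots are unique, so the root that occurs in `IsKdVOp` may be taken to be `rootL`, which
depends smoothly on smooth coefficients. -/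
theorem eq_rootL (hn : 0 < n) {u : Fin n → Sm I} {R : Psi I} (h : IsRootL u R) :
    R = (rootL u).1 := by
  obtain ⟨h1, h2, h3⟩ := h
  obtain ⟨X, rfl⟩ : ∃ X : PsiDO I, X.1 = R := ⟨⟨R, 1, h2⟩, rfl⟩
  have hX : IsMonicOne X := ⟨h2, h1⟩
  rw [hX.eq_of_pow_eq (isMonicOne_rootL u) hn]
  rw [rootL_pow hn]
  exact Subtype.ext (by rw [pow_val, ell_val, h3])

/-- The symbol `f + ∑_{k<m} c_k (L^{k/n})_+`. -/
def kdvSymbol (u : Fin n → Sm I) (m : ℕ) (c : ℕ → ℝ) (f : Sm I) : PsiDO I :=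
  single 0 f + ∑ k ∈ Finset.range m, c k • pos (rootL u ^ k)

theorem kdvSymbol_mem_diff (u : Fin n → Sm I) (m : ℕ) (c : ℕ → ℝ) (f : Sm I) :
    kdvSymbol u m c f ∈ diff I :=
  add_mem (single_mem_diff 0 f) (sum_mem fun _ _ => Submodule.smul_mem _ _ (pos_mem_diff _))

theorem toEnd_kdvSymbol (u : Fin n → Sm I) (m : ℕ) (c : ℕ → ℝ) (f : Sm I) :
    toEnd I (kdvSymbol u m c f) =
      (∑ k ∈ Finset.range m, c k • Psi.plus (Psi.pow (rootL u).1 k)) + mulOp f := by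
  have h : toEnd I (single 0 f) = mulOp f * D I ^ 0 := toEnd_single 0 f
  rw [kdvSymbol, map_add, h, pow_zero, mul_one, add_comm, map_sum]
  congr 1
  refine Finset.sum_congr rfl fun k _ => ?_
  rw [map_smul, toEnd_pos, toEnd_eq_plus, pow_val]

theorem smoothFam_kdvSymbol {u : ℝ → Fin n → Sm I}
    (hu : ∀ k, JointC ∞ (J : Set ℝ) fun t => u t k) (m : ℕ) {c : ℕ → ℝ → ℝ}
    (hc : ∀ k, ContDiffOn ℝ ∞ (c k) J) {f : ℝ → Sm I} (hf : JointC ∞ (J : Set ℝ) f) :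
    SmoothFam J fun t => kdvSymbol (u t) m (fun k => c k t) (f t) :=
  (smoothFam_single 0 hf).add (SmoothFam.sum fun k _ =>
    ((((smoothFam_ell hu).root n).pow k).pos).smul (hc k))

/-- The fractional powers contribute only in order at most `n - 2`, which leaves `[f, ∂ⁿ] = -n f'
∂ⁿ⁻¹ + ⋯`. -/
theorem coeff_commutator_kdvSymbol (hn : 0 < n) (u : Fin n → Sm I) (m : ℕ) (c : ℕ → ℝ) (f : Sm I) :
    coeff (n - 1) (kdvSymbol u m c f * ell u - ell u * kdvSymbol u m c f) = - ((n : ℝ) • D I f) := by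
  have h1 : kdvSymbol u m c f * ell u - ell u * kdvSymbol u m c f =
      (single 0 f * ell u - ell u * single 0 f) + ∑ k ∈ Finset.range m,
        c k • (pos (rootL u ^ k) * ell u - ell u * pos (rootL u ^ k)) := by
    simp only [kdvSymbol, add_mul, mul_add, Finset.sum_mul, Finset.mul_sum, smul_sub,
      Finset.sum_sub_distrib, smul_mul_assoc, mul_smul_comm]
    abel
  have h2 : ∑ k ∈ Finset.range m, c k • (pos (rootL u ^ k) * ell u - ell u * pos (rootL u ^ k)) ∈
      (ordLE (n - 2) : Submodule ℝ (PsiDO I)) := by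
    refine sum_mem fun k _ => Submodule.smul_mem _ _ ?_
    have h3 := commutator_pos_pow_mem (n := n) (rootL u) k (by
      rw [rootL_pow hn]; exact ell_mem_ordLE u)
    rwa [rootL_pow hn] at h3
  have h4 := coeff_commutator (single_mem_ordLE 0 f) (ell_mem_ordLE u)
  rw [zero_add, zero_smul, coeff_ell, coeff_single_same, one_mul, zero_sub] at h4
  rw [h1, map_add, h2 _ (by omega), add_zero, h4, ← Int.cast_smul_eq_zsmul ℝ, Int.cast_natCast]

end PsiDO

open PsiDO

theorem isGaugedKdVOp_iff (hn : 0 < n) {u : ℝ → Fin n → Sm I} {B : ℝ → Module.End ℝ (Sm I)} :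
    IsGaugedKdVOp J u B ↔ ∃ (m : ℕ) (c : ℕ → ℝ → ℝ) (f : ℝ → Sm I),
      (∀ k, ContDiffOn ℝ ∞ (c k) J) ∧ JointC ∞ (J : Set ℝ) f ∧
        ∀ t ∈ J, B t = toEnd I (kdvSymbol (u t) m (fun k => c k t) (f t)) := by
  constructor
  · rintro ⟨B₀, f, ⟨m, c, R, hc, hR, hB₀⟩, hf, hB⟩
    refine ⟨m, c, f, hc, jointC_iff_jointSmooth.2 hf, fun t ht => ?_⟩
    rw [toEnd_kdvSymbol, hB t ht, hB₀ t ht, eq_rootL hn (hR t ht)]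
  · rintro ⟨m, c, f, hc, hf, hB⟩
    refine ⟨_, f, ⟨m, c, fun t => (rootL (u t)).1, hc, fun t _ => isRootL_rootL hn _,
      fun t _ => rfl⟩, jointC_iff_jointSmooth.1 hf, fun t ht => ?_⟩
    rw [hB t ht, toEnd_kdvSymbol]

theorem isKdVOp_iff (hn : 0 < n) {u : ℝ → Fin n → Sm I} {B : ℝ → Module.End ℝ (Sm I)} :
    IsKdVOp J u B ↔ ∃ (m : ℕ) (c : ℕ → ℝ → ℝ), (∀ k, ContDiffOn ℝ ∞ (c k) J) ∧
        ∀ t ∈ J, B t = toEnd I (kdvSymbol (u t) m (fun k => c k t) 0) := by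
  have h0 : mulOp (0 : Sm I) = 0 := LinearMap.ext fun f => zero_mul f
  constructor
  · rintro ⟨m, c, R, hc, hR, hB⟩
    refine ⟨m, c, hc, fun t ht => ?_⟩
    rw [toEnd_kdvSymbol, hB t ht, eq_rootL hn (hR t ht), h0, add_zero]
  · rintro ⟨m, c, hc, hB⟩
    refine ⟨m, c, fun t => (rootL (u t)).1, hc, fun t _ => isRootL_rootL hn _, fun t ht => ?_⟩
    rw [hB t ht, toEnd_kdvSymbol, h0, add_zero]

theorem IsKdVOp.isGaugedKdVOp {u : ℝ → Fin n → Sm I} {B : ℝ → Module.End ℝ (Sm I)}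
    (h : IsKdVOp J u B) : IsGaugedKdVOp J u B :=
  ⟨B, fun _ => 0, h, jointC_iff_jointSmooth.1 jointC_zero, fun t _ => by
    rw [show mulOp (0 : Sm I) = 0 from LinearMap.ext fun f => zero_mul f, add_zero]⟩

/-- The Lax equation in terms of symbols. -/
theorem laxEq_iff {u v : ℝ → Fin n → Sm I}
    (hv : ∀ t ∈ J, ∀ k, ∀ x : I, HasDerivAt (fun s => ev x (u s k)) (ev x (v t k)) t)
    {B : ℝ → Module.End ℝ (Sm I)} {b : ℝ → PsiDO I} (hb : ∀ t ∈ J, b t ∈ diff I)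
    (hB : ∀ t ∈ J, B t = toEnd I (b t)) :
    LaxEq J u B ↔ ∀ t ∈ J, low (v t) = b t * ell (u t) - ell (u t) * b t := by
  have key : ∀ t ∈ J, ((opLow (v t)).1 = B t * (opL (u t)).1 - (opL (u t)).1 * B t ↔
      low (v t) = b t * ell (u t) - ell (u t) * b t) := fun t ht => by
    rw [hB t ht, ← toEnd_low, ← toEnd_ell, ← toEnd_mul (hb t ht) (ell_mem_diff _),
      ← toEnd_mul (ell_mem_diff _) (hb t ht), ← map_sub]
    exact ⟨fun h => toEnd_injOn (low_mem_diff _) (sub_mem (mul_mem_diff (hb t ht) (ell_mem_diff _))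
      (mul_mem_diff (ell_mem_diff _) (hb t ht))) h, fun h => by rw [h]⟩
  constructor
  · intro h t ht
    obtain ⟨w, hw, hL⟩ := h t ht
    have hwv : w = v t := funext fun k => Sm.ext_ev fun x => (hw k x).unique (hv t ht k x)
    rw [hwv] at hL
    exact (key t ht).1 hL
  · exact fun h t ht => ⟨v t, hv t ht, (key t ht).2 (h t ht)⟩

/-- The time derivative of a monic operator has order `< n`. By the Lax equation the commutator `[B,
L]` does too, which is the hypothesis of `exists_eq_sum_pos_pow`. -/
theorem LaxEq.isGaugedKdVOp (hI : (I : Set ℝ).OrdConnected) (x₀ : I) (hn : 0 < n)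
    {u : ℝ → Fin n → Sm I} (hu : ∀ k, JointC ∞ (J : Set ℝ) fun t => u t k)
    {B : ℝ → Module.End ℝ (Sm I)} {b : ℝ → PsiDO I} (hbs : SmoothFam J b)
    (hb : ∀ t ∈ J, b t ∈ diff I) (hB : ∀ t ∈ J, B t = toEnd I (b t)) (h : LaxEq J u B) :
    IsGaugedKdVOp J u B := by
  choose v _ hv using fun k => (hu k).exists_timeDeriv
  have hL := (laxEq_iff (u := u) (v := fun t k => v k t)
    (fun t ht k x => (hv k).hasDerivAt ht 0 x) hb hB).1 h
  obtain ⟨M, hM⟩ := hbs.exists_nat_ordLE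
  obtain ⟨c, f, hc, hf, hbf⟩ := exists_eq_sum_pos_pow (ℓ := fun t => ell (u t))
    (R := fun t => rootL (u t)) hI x₀ hn (fun t _ => ell_mem_ordLE _) (fun t _ => coeff_ell _)
    ((smoothFam_ell hu).root n) (fun t _ => isMonicOne_rootL _) (fun t _ => rootL_pow hn _)
    M hbs hb hM fun t ht => by rw [← hL t ht]; exact low_mem_ordLE _
  refine (isGaugedKdVOp_iff hn).2 ⟨M + 1, c, f, hc, hf, fun t ht => ?_⟩
  rw [hB t ht, hbf t ht]
  rfl

theorem LaxEq.deriv_top (hn : 0 < n) {u v : ℝ → Fin n → Sm I}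
    (hv : ∀ t ∈ J, ∀ k, ∀ x : I, HasDerivAt (fun s => ev x (u s k)) (ev x (v t k)) t)
    {B : ℝ → Module.End ℝ (Sm I)} {m : ℕ} {c : ℕ → ℝ → ℝ} {f : ℝ → Sm I}
    (hB : ∀ t ∈ J, B t = toEnd I (kdvSymbol (u t) m (fun k => c k t) (f t))) (h : LaxEq J u B)
    {k : Fin n} (hk : (k : ℕ) + 1 = n) {t : ℝ} (ht : t ∈ J) :
    v t k = - ((n : ℝ) • D I (f t)) := by
  have hL := (laxEq_iff hv (fun t _ => kdvSymbol_mem_diff _ _ _ _) hB).1 h t ht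
  rw [← coeff_commutator_kdvSymbol hn, ← hL, ← coeff_low (v t)]
  congr 2
  omega

theorem topCurvatureConst_iff (hJ : (J : Set ℝ).OrdConnected) {c : ℝ → CentroAffine n I}
    {v : ℝ → Fin n → Sm I}
    (hv : ∀ t ∈ J, ∀ k, ∀ x : I,
      HasDerivAt (fun s => ev x (curvature (c s) k)) (ev x (v t k)) t) :
    TopCurvatureConst J c ↔ ∀ k : Fin n, (k : ℕ) + 1 = n → ∀ t ∈ J, v t k = 0 := by
  constructor
  · intro h k hk t ht
    refine Sm.ext_ev fun x => ?_
    rw [map_zero]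
    refine (hv t ht k x).unique ((hasDerivAt_const t (ev x (curvature (c t) k))).congr_of_eventuallyEq
      ?_)
    filter_upwards [J.isOpen.mem_nhds ht] with s hs
    rw [h k hk s hs t ht]
  · intro h k hk t ht t' ht'
    refine Sm.ext_ev fun x => ?_
    refine J.isOpen.is_const_of_deriv_eq_zero hJ.isPreconnected
      (f := fun s => ev x (curvature (c s) k))
      (fun s hs => (hv s hs k x).differentiableAt.differentiableWithinAt) (fun s hs => ?_) ht ht'
    rw [(hv s hs k x).deriv, h k hk s hs, map_zero]
    rfl

/-- The Lax equation in degree `n - 1` is `∂ₜu_{n-1} = -n ∂ₓf`. If the left side vanishes, `f`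
depends on `t` alone and is absorbed into the coefficient of `(L⁰)₊ = 1`. -/
theorem isKdVOp_iff_topCurvatureConst (hI : (I : Set ℝ).OrdConnected) (x₀ : I) (hn : 0 < n)
    (hJ : (J : Set ℝ).OrdConnected) {c : ℝ → CentroAffine n I} (hc : IsAdmissible J c)
    {B : ℝ → Module.End ℝ (Sm I)} (hB : IsGaugedKdVOp J (fun t => curvature (c t)) B)
    (h : LaxEq J (fun t => curvature (c t)) B) :
    IsKdVOp J (fun t => curvature (c t)) B ↔ TopCurvatureConst J c := by
  choose w _ hw using fun k => (hc.jointC_curvature k).exists_timeDeriv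
  have hv : ∀ t ∈ J, ∀ k, ∀ x : I,
      HasDerivAt (fun s => ev x (curvature (c s) k)) (ev x (w k t)) t :=
    fun t ht k x => (hw k).hasDerivAt ht 0 x
  rw [topCurvatureConst_iff (v := fun t k => w k t) hJ hv]
  constructor
  · intro hK k hk t ht
    obtain ⟨m, a, -, hB'⟩ := (isKdVOp_iff hn).1 hK
    rw [h.deriv_top (v := fun t k => w k t) (f := fun _ => 0) hn hv hB' hk ht, map_zero, smul_zero,
      neg_zero]
  · intro h0
    obtain ⟨m, a, f, ha, hf, hB'⟩ := (isGaugedKdVOp_iff hn).1 hB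
    have hf' : ∀ t ∈ J, f t = algebraMap ℝ (Sm I) (ev x₀ (f t)) := by
      intro t ht
      refine eq_algebraMap_of_D_eq_zero hI ?_ x₀
      have h1 := h.deriv_top (v := fun t k => w k t) hn hv hB'
        (k := ⟨n - 1, by omega⟩) (Nat.sub_add_cancel hn) ht
      rw [h0 _ (Nat.sub_add_cancel hn) t ht, eq_comm, neg_eq_zero] at h1
      exact (smul_eq_zero.1 h1).resolve_left (by exact_mod_cast hn.ne')
    -- The range is enlarged to `m + 1` so that the index `0`, which receives `f`, is present even
    -- when `m = 0`.
    refine (isKdVOp_iff hn).2 ⟨m + 1, fun k t => (if k < m then a k t else 0) +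
      if k = 0 then ev x₀ (f t) else 0, fun k => ContDiffOn.add ?_ ?_, fun t ht => ?_⟩
    · by_cases hk : k < m
      · simpa only [hk, if_true] using ha k
      · simpa only [hk, if_false] using contDiffOn_const
    · by_cases hk : k = 0
      · simpa only [hk, if_true] using hf.contDiffOn_ev x₀
      · simpa only [hk, if_false] using contDiffOn_const
    · rw [hB' t ht]
      congr 1
      have h1 : single 0 (f t) = ev x₀ (f t) • pos (rootL (curvature (c t)) ^ 0) := by
        refine ext_coeff fun k => ?_
        rw [pow_zero, map_smul, coeff_pos, show (1 : PsiDO I) = single 0 1 from rfl, coeff_single,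
          coeff_single]
        split_ifs with h1 h2 h2
        · rw [← Algebra.algebraMap_eq_smul_one]; exact hf' t ht
        · omega
        · rw [smul_zero]
        · rw [smul_zero]
      have h2 : single 0 (0 : Sm I) = 0 := ext_coeff fun k => by
        rw [coeff_single, ite_self, map_zero]
      rw [kdvSymbol, kdvSymbol, h2, zero_add]
      simp only [add_smul, Finset.sum_add_distrib]
      rw [Finset.sum_range_succ, if_neg (lt_irrefl m), zero_smul, add_zero, h1, add_comm]
      congr 1
      · exact Finset.sum_congr rfl fun k hk => by rw [if_pos (Finset.mem_range.1 hk)]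
      · rw [Finset.sum_eq_single 0 (fun k _ hk => by rw [if_neg hk, zero_smul]) (by simp),
          if_pos rfl]

theorem SmoothOp.exists_symbol {X : ℝ → DOp I} (hX : SmoothOp J X) :
    ∃ a : ℝ → PsiDO I, SmoothFam J a ∧ (∀ t, a t ∈ diff I) ∧
      ∀ t ∈ J, (X t).1 = toEnd I (a t) := by
  obtain ⟨N, a, ha, hX⟩ := hX
  refine ⟨fun t => ∑ k ∈ Finset.range N, single (k : ℤ) (a k t),
    SmoothFam.sum fun k _ => smoothFam_single _ (jointC_iff_jointSmooth.2 (ha k)),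
    fun t => sum_mem fun k _ => single_mem_diff k _, fun t ht => ?_⟩
  rw [hX t ht, map_sum]
  exact Finset.sum_congr rfl fun k _ => (toEnd_single k _).symm

theorem exists_smoothOp {b : ℝ → PsiDO I} (hb : SmoothFam J b) :
    ∃ X : ℝ → DOp I, SmoothOp J X ∧ ∀ t ∈ J, (X t).1 = toEnd I (b t) := by
  obtain ⟨M, hM⟩ := hb.exists_nat_ordLE
  refine ⟨fun t => opLow (n := M + 1) fun k => coeff ((k : ℕ) : ℤ) (b t),
    smoothOp_opLow fun k => hb.2 _, fun t ht => ?_⟩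
  rw [toEnd_eq_sum (N := M + 1) (by push_cast; rw [add_sub_cancel_right]; exact hM t ht),
    Finset.sum_range]
  rfl

theorem exists_symbol_polyOpAtL {c : ℝ → CentroAffine n I} (hc : IsAdmissible J c) (N : ℕ)
    {P : ℕ → ℝ → DOp I} (hP : ∀ i, SmoothOp J (P i)) :
    ∃ b : ℝ → PsiDO I, SmoothFam J b ∧ (∀ t, b t ∈ diff I) ∧
      ∀ t ∈ J, polyOpAtL N P c t = toEnd I (b t) := by
  choose a ha had haP using fun i => (hP i).exists_symbol
  have hm : ∀ i t, a i t * ell (curvature (c t)) ^ i ∈ diff I := fun i t =>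
    mul_mem_diff (had i t) (pow_mem_diff (ell_mem_diff _) i)
  refine ⟨fun t => ∑ i ∈ Finset.range N, a i t * ell (curvature (c t)) ^ i,
    SmoothFam.sum fun i _ => (ha i).mul ((smoothFam_ell hc.jointC_curvature).pow i),
    fun t => sum_mem fun i _ => hm i t, fun t ht => ?_⟩
  rw [polyOpAtL, DOp.sum_val, map_sum]
  refine Finset.sum_congr rfl fun i _ => ?_
  rw [toEnd_mul (had i t) (pow_mem_diff (ell_mem_diff _) i), toEnd_pow (ell_mem_diff _), toEnd_ell,
    ← haP i t ht]
  rfl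

end KdV

/-! ### Spectral deformations -/

section Spectral

variable {I J : Opens ℝ} {n : ℕ}

/-- The coefficients of `L - μ`. -/
def shift (u : Fin n → Sm I) (μ : ℝ) : Fin n → Sm I :=
  fun k => u k - algebraMap ℝ (Sm I) (if (k : ℕ) = 0 then μ else 0)

theorem opLow_shift_apply (hn : 0 < n) (u : Fin n → Sm I) (μ : ℝ) (y : Sm I) :
    (opLow (shift u μ)).1 y = (opLow u).1 y - μ • y := by
  rw [opLow_apply, opLow_apply]
  simp only [shift, sub_mul, Finset.sum_sub_distrib]
  congr 1
  rw [Finset.sum_eq_single (⟨0, hn⟩ : Fin n)]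
  · rw [if_pos rfl, Algebra.smul_def]
    rfl
  · intro k _ hk
    rw [if_neg (fun h => hk (Fin.ext h)), map_zero, zero_mul]
  · simp

theorem opL_shift (hn : 0 < n) (u : Fin n → Sm I) (μ : ℝ) :
    (opL (shift u μ)).1 = (opL u).1 - μ • 1 := by
  refine LinearMap.ext fun y => ?_
  rw [opL_eq, opL_eq, DOp.add_val, DOp.add_val, LinearMap.sub_apply, LinearMap.add_apply,
    LinearMap.add_apply, opLow_shift_apply hn]
  exact (add_sub_assoc _ _ _).symm

theorem IsSpectralCurve.curvature_eq (hn : 0 < n) {c cl : CentroAffine n I} {μ : ℝ}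
    (h : IsSpectralCurve c μ cl) : curvature cl = shift (curvature c) μ := by
  obtain ⟨γ, rfl⟩ := exists_cls_eq cl
  refine γ.curv_eq_of_opL fun j => ?_
  have h1 : (Lop γ.cls).1 (γ.1 j) = 0 := StarCurve.Lop_apply rfl j
  rw [h] at h1
  rw [opL_shift hn]
  exact h1

theorem isSpectralCurve_of_curvature_eq (hn : 0 < n) {c cl : CentroAffine n I} {μ : ℝ}
    (h : curvature cl = shift (curvature c) μ) : IsSpectralCurve c μ cl := by
  rw [IsSpectralCurve, Lop, h, opL_shift hn]
  rfl

theorem opL_apply_of_spectral (hn : 0 < n) {u : Fin n → Sm I} {μ : ℝ} {y : Sm I}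
    (h : (opL (shift u μ)).1 y = 0) : (opL u).1 y = μ • y := by
  rw [opL_shift hn, LinearMap.sub_apply, LinearMap.smul_apply, Module.End.one_apply,
    sub_eq_zero] at h
  exact h

theorem polyOp_apply_of_eigen {L : DOp I} {y : Sm I} {μ : ℝ} (h : L.1 y = μ • y) (N : ℕ)
    (P : ℕ → ℝ → DOp I) (t : ℝ) :
    (polyOp N P μ t).1 y = (∑ i ∈ Finset.range N, P i t * L ^ i).1 y := by
  rw [polyOp, DOp.sum_val, DOp.sum_val, LinearMap.sum_apply, LinearMap.sum_apply]
  refine Finset.sum_congr rfl fun i _ => ?_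
  rw [DOp.mul_apply, pow_apply_of_eigen h, map_smul, DOp.smul_val, LinearMap.smul_apply]

/-- The operator `∂L/∂t - [B, L]`. -/
def laxDefect (u v : Fin n → Sm I) (B : DOp I) : DOp I := opLow v - (B * opL u - opL u * B)

theorem laxDefect_apply_of_eigen {u v : Fin n → Sm I} {B : DOp I} {y : Sm I} {μ : ℝ}
    (h : (opL u).1 y = μ • y) :
    (laxDefect u v B).1 y = (opLow v).1 y + ((opL u).1 (B.1 y) - μ • B.1 y) := by
  rw [laxDefect, DOp.sub_val, DOp.sub_val, LinearMap.sub_apply, LinearMap.sub_apply, DOp.mul_apply,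
    DOp.mul_apply, h, map_smul]
  abel

theorem hasDerivAt_shift {u : ℝ → Fin n → Sm I} {v : Fin n → Sm I} {lam : ℝ → ℝ} {lam' t : ℝ}
    (hv : ∀ k, ∀ x : I, HasDerivAt (fun s => ev x (u s k)) (ev x (v k)) t)
    (hl : HasDerivAt lam lam' t) (k : Fin n) (x : I) :
    HasDerivAt (fun s => ev x (shift (u s) (lam s) k)) (ev x (shift v lam' k)) t := by
  simp only [shift, map_sub, AlgHom.commutes]
  refine (hv k x).sub ?_
  by_cases hk : (k : ℕ) = 0
  · simpa only [hk, if_true] using! hl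
  · simpa only [hk, if_false] using! hasDerivAt_const t (0 : ℝ)

/-- On the eigenfunctions of `L`, the defect of the Lax equation is the derivative of the
eigenvalue. -/
theorem laxDefect_apply_spectral (hn : 0 < n) {c cl : ℝ → CentroAffine n I}
    {lam : ℝ → ℝ} (hl : ContDiffOn ℝ ∞ lam J)
    (hcl : ∀ t ∈ J, IsSpectralCurve (c t) (lam t) (cl t)) (ha : IsAdmissible J cl)
    {N : ℕ} {P : ℕ → ℝ → DOp I} (hE : IsEvolutionOp J cl fun t => polyOp N P (lam t) t)
    {v : Fin n → Sm I} {t : ℝ} (ht : t ∈ J)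
    (hv : ∀ k, ∀ x : I, HasDerivAt (fun s => ev x (curvature (c s) k)) (ev x (v k)) t) :
    ∃ γ : StarCurve n I, ∀ j, (Lop (c t)).1 (γ.1 j) = lam t • γ.1 j ∧
      (laxDefect (curvature (c t)) v (∑ i ∈ Finset.range N, P i t * Lop (c t) ^ i)).1 (γ.1 j) =
        deriv lam t • γ.1 j := by
  obtain ⟨γ, hγ⟩ := ha
  obtain ⟨γ', -, hγ'⟩ := hγ.exists_isC1Lift
  have hld : HasDerivAt lam (deriv lam t) t :=
    ((hl.differentiableOn (by simp)).differentiableAt (J.isOpen.mem_nhds ht)).hasDerivAt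
  have hv' : ∀ k, ∀ x : I, HasDerivAt (fun s => ev x (curvature (cl s) k))
      (ev x (shift v (deriv lam t) k)) t := fun k x => by
    refine (hasDerivAt_shift hv hld k x).congr_of_eventuallyEq ?_
    filter_upwards [J.isOpen.mem_nhds ht] with s hs
    rw [(hcl s hs).curvature_eq hn]
  have hL : Lop (cl t) = opL (shift (curvature (c t)) (lam t)) := by
    rw [Lop, (hcl t ht).curvature_eq hn]
  refine ⟨γ t, fun j => ?_⟩
  have h1 : (Lop (c t)).1 ((γ t).1 j) = lam t • (γ t).1 j := by
    refine opL_apply_of_spectral hn ?_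
    rw [← hL]
    exact StarCurve.Lop_apply (hγ.2 t ht) j
  refine ⟨h1, ?_⟩
  -- The evolution equation for the `j`-th component gives `(L - λ)(∂ₜγ_j) = (L - λ)(P(λ)γ_j)`. Its
  -- left side is `-(∂ₜL - ∂ₜλ)γ_j`, and `P(λ)γ_j = P(L)γ_j` on eigenfunctions.
  have h2 := hE γ γ' hγ' (Pi.single j 1) t ht
  simp only [Pi.single_apply, ite_smul, one_smul, zero_smul, Finset.sum_ite_eq',
    Finset.mem_univ, if_true] at h2
  rw [map_sub, hγ'.Lop_apply_deriv ht hv' j, polyOp_apply_of_eigen h1, hL, opL_shift hn,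
    opLow_shift_apply hn] at h2
  rw [laxDefect_apply_of_eigen h1]
  simp only [LinearMap.sub_apply, LinearMap.smul_apply, Module.End.one_apply] at h2
  rw [sub_eq_zero] at h2
  rw [← h2]
  abel

/-- An operator that annihilates the eigenfunctions for infinitely many eigenvalues is zero. -/
theorem eq_zero_of_infinite_spectrum (hn : 0 < n) (u : Fin n → Sm I) (E : DOp I) {S : Set ℝ}
    (hS : S.Infinite) (h : ∀ s ∈ S, ∃ γ : StarCurve n I, ∀ j,
      (opL u).1 (γ.1 j) = s • γ.1 j ∧ E.1 (γ.1 j) = 0) : E = 0 := by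
  obtain ⟨a, rfl⟩ := exists_adicSum hn u E
  -- On the eigenfunctions for `s` the operator has order `< n`, and it annihilates a star-shaped
  -- curve, so all its coefficients vanish.
  have h1 : ∀ s ∈ S, ∑ i ∈ a.support, s ^ i • a i = 0 := by
    intro s hs
    obtain ⟨γ, hγ⟩ := h s hs
    refine γ.opLow_inj fun j => ?_
    rw [← adicSum_apply_of_eigen (hγ j).1, (hγ j).2, opLow_zero]
    rfl
  have h2 : a = 0 := by
    ext i k : 2
    refine Sm.ext_ev fun x => ?_
    -- With `k` and the point `x` fixed, the relation is polynomial in `s` and holds for infinitely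
    -- many `s`.
    set p : Polynomial ℝ := ∑ i ∈ a.support, Polynomial.monomial i (ev x (a i k)) with hp
    have hp0 : p = 0 := by
      refine Polynomial.eq_zero_of_infinite_isRoot _ (hS.mono fun s hs => ?_)
      have h3 := congrArg (fun w : Fin n → Sm I => ev x (w k)) (h1 s hs)
      simp only [Finset.sum_apply, Pi.smul_apply, map_sum, map_smul, smul_eq_mul, Pi.zero_apply,
        map_zero] at h3
      show Polynomial.eval s p = 0
      rw [hp, Polynomial.eval_finsetSum, ← h3]
      exact Finset.sum_congr rfl fun i _ => by rw [Polynomial.eval_monomial, mul_comm]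
    have h4 := congrArg (fun q : Polynomial ℝ => q.coeff i) hp0
    simp only [hp, Polynomial.finsetSum_coeff, Polynomial.coeff_monomial, Finset.sum_ite_eq',
      Polynomial.coeff_zero] at h4
    rw [Finsupp.zero_apply, Pi.zero_apply, map_zero]
    by_cases hi : i ∈ a.support
    · rwa [if_pos hi] at h4
    · rw [Finsupp.notMem_support_iff.1 hi, Pi.zero_apply, map_zero]
  rw [h2, map_zero]

theorem StarCurve.eq_zero_of_smul (hn : 0 < n) (x₀ : I) (γ : StarCurve n I) {r : ℝ}
    (h : ∀ j, r • γ.1 j = 0) : r = 0 := by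
  by_contra hr
  have h0 : γ.1 = 0 := funext fun j => (smul_eq_zero.1 (h j)).resolve_left hr
  refine γ.ev_det_ne_zero x₀ ?_
  have : Nonempty (Fin n) := ⟨⟨0, hn⟩⟩
  rw [h0, show W (0 : Fin n → Sm I) = 0 from Matrix.ext fun i _ => map_zero (D I ^ (i : ℕ)),
    Matrix.det_zero, map_zero]

/-- The defect `∂ₜL - [P(L), L]` multiplies the eigenfunctions for `λ_s` by `∂ₜλ_s`. If it is zero
then so is each `∂ₜλ_s`, as a star-shaped curve is nonzero; if all these derivatives are zero, it
annihilates infinitely many eigenspaces. -/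
theorem deriv_eq_zero_iff_laxEq (hn : 0 < n) (x₀ : I) (hJ0 : (0 : ℝ) ∈ J)
    (hJ : (J : Set ℝ).OrdConnected) {c : ℝ → CentroAffine n I} (hc : IsAdmissible J c) {S : Set ℝ}
    {lam : ℝ → ℝ → ℝ} {N : ℕ} {P : ℕ → ℝ → DOp I} (hS : S.Infinite)
    (h : IsSpectralDeformation J c S lam N P) :
    (∀ s ∈ S, ∀ t ∈ J, deriv (lam s) t = 0) ↔
      LaxEq J (fun t => curvature (c t)) (polyOpAtL N P c) := by
  choose w _ hw using fun k => (hc.jointC_curvature k).exists_timeDeriv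
  have hv : ∀ t ∈ J, ∀ k, ∀ x : I,
      HasDerivAt (fun s => ev x (curvature (c s) k)) (ev x (w k t)) t :=
    fun t ht k x => (hw k).hasDerivAt ht 0 x
  constructor
  · intro hl t ht
    refine ⟨fun k => w k t, hv t ht, ?_⟩
    have h0 : laxDefect (curvature (c t)) (fun k => w k t)
        (∑ i ∈ Finset.range N, P i t * Lop (c t) ^ i) = 0 := by
      refine eq_zero_of_infinite_spectrum hn (curvature (c t)) _ hS fun s hs => ?_
      obtain ⟨hs0, hsm, cl, hcl, ha, hE⟩ := h.2 s hs
      obtain ⟨γ, hγ⟩ := laxDefect_apply_spectral hn hsm hcl ha hE ht (hv t ht)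
      -- Constancy on the interval `J` keeps the eigenvalue at time `t` equal to `s`, so infinitely
      -- many distinct eigenvalues are available at each time.
      have hst : lam s t = s := (J.isOpen.is_const_of_deriv_eq_zero hJ.isPreconnected
        (hsm.differentiableOn (by simp)) (hl s hs) ht hJ0).trans hs0
      refine ⟨γ, fun j => ⟨?_, ?_⟩⟩
      · rw [← hst]; exact (hγ j).1
      · rw [(hγ j).2, hl s hs t ht, zero_smul]
    exact congrArg Subtype.val (sub_eq_zero.1 h0)
  · intro hL s hs t ht
    obtain ⟨hs0, hsm, cl, hcl, ha, hE⟩ := h.2 s hs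
    obtain ⟨v, hv', hLv⟩ := hL t ht
    obtain ⟨γ, hγ⟩ := laxDefect_apply_spectral hn hsm hcl ha hE ht hv'
    have h0 : laxDefect (curvature (c t)) v
        (∑ i ∈ Finset.range N, P i t * Lop (c t) ^ i) = 0 :=
      sub_eq_zero.2 (DOp.ext_val hLv)
    refine γ.eq_zero_of_smul hn x₀ fun j => ?_
    rw [← (hγ j).2, h0]
    rfl

theorem IsSpectralDeformation.iff_isGaugedKdVOp (hI : (I : Set ℝ).OrdConnected) (hn : 0 < n)
    (x₀ : I) (hJ0 : (0 : ℝ) ∈ J) (hJ : (J : Set ℝ).OrdConnected) {c : ℝ → CentroAffine n I}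
    (hc : IsAdmissible J c) {S : Set ℝ}
    {lam : ℝ → ℝ → ℝ} {N : ℕ} {P : ℕ → ℝ → DOp I} (hS : S.Infinite)
    (h : IsSpectralDeformation J c S lam N P) :
    (∀ s ∈ S, ∀ t ∈ J, deriv (lam s) t = 0) ↔
      IsGaugedKdVOp J (fun t => curvature (c t)) (polyOpAtL N P c) ∧
        LaxEq J (fun t => curvature (c t)) (polyOpAtL N P c) := by
  rw [deriv_eq_zero_iff_laxEq hn x₀ hJ0 hJ hc hS h]
  refine ⟨fun hL => ⟨?_, hL⟩, fun hL => hL.2⟩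
  obtain ⟨b, hbs, hb, hB⟩ := exists_symbol_polyOpAtL hc N h.1
  exact hL.isGaugedKdVOp hI x₀ hn hc.jointC_curvature hbs (fun t _ => hb t) hB

theorem IsSpectralDeformation.iff_isKdVOp (hI : (I : Set ℝ).OrdConnected) (hn : 0 < n)
    (x₀ : I) (hJ0 : (0 : ℝ) ∈ J) (hJ : (J : Set ℝ).OrdConnected) {c : ℝ → CentroAffine n I}
    (hc : IsAdmissible J c) {S : Set ℝ}
    {lam : ℝ → ℝ → ℝ} {N : ℕ} {P : ℕ → ℝ → DOp I} (hS : S.Infinite)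
    (h : IsSpectralDeformation J c S lam N P) :
    (∀ s ∈ S, ∀ t ∈ J, deriv (lam s) t = 0) ∧ TopCurvatureConst J c ↔
      IsKdVOp J (fun t => curvature (c t)) (polyOpAtL N P c) ∧
        LaxEq J (fun t => curvature (c t)) (polyOpAtL N P c) := by
  rw [h.iff_isGaugedKdVOp hI hn x₀ hJ0 hJ hc hS]
  constructor
  · rintro ⟨⟨hB, hL⟩, hT⟩
    exact ⟨(isKdVOp_iff_topCurvatureConst hI x₀ hn hJ hc hB hL).2 hT, hL⟩
  · rintro ⟨hK, hL⟩
    exact ⟨⟨hK.isGaugedKdVOp, hL⟩,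
      (isKdVOp_iff_topCurvatureConst hI x₀ hn hJ hc hK.isGaugedKdVOp hL).1 hK⟩

/-- The Lax equation of an `n`-KdV operator makes the deformation isospectral. -/
theorem isIsospectral_of_laxEq (hI : (I : Set ℝ).OrdConnected) (hn : 0 < n) (x₀ : I)
    {c : ℝ → CentroAffine n I} (hc : IsAdmissible J c) {B : ℝ → Module.End ℝ (Sm I)}
    (hB : IsGaugedKdVOp J (fun t => curvature (c t)) B)
    (hL : LaxEq J (fun t => curvature (c t)) B) : IsIsospectral J c := by
  choose w _ hw using fun k => (hc.jointC_curvature k).exists_timeDeriv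
  have hv : ∀ t ∈ J, ∀ k, ∀ x : I,
      HasDerivAt (fun s => ev x (curvature (c s) k)) (ev x (w k t)) t :=
    fun t ht k x => (hw k).hasDerivAt ht 0 x
  obtain ⟨m, a, f, ha, hf, hB'⟩ := (isGaugedKdVOp_iff hn).1 hB
  obtain ⟨X, hX, hXB⟩ := exists_smoothOp (PsiDO.smoothFam_kdvSymbol hc.jointC_curvature m ha hf)
  have hE : ∀ t ∈ J, laxDefect (curvature (c t)) (fun k => w k t) (X t) = 0 := fun t ht => by
    obtain ⟨v, hv', hLv⟩ := hL t ht
    have hvw : v = fun k => w k t :=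
      funext fun k => Sm.ext_ev fun x => (hv' k x).unique (hv t ht k x)
    rw [hB' t ht, ← hXB t ht, hvw] at hLv
    exact sub_eq_zero.2 (DOp.ext_val hLv)
  obtain ⟨γ₀, -⟩ := exists_cls_eq (c 0)
  -- The given operator itself serves as `P`, of degree `0` in the spectral parameter.
  refine ⟨1, fun _ => X, fun _ => hX, fun s _ => ⟨rfl, contDiffOn_const, ?_⟩⟩
  obtain ⟨γ, hγ, hcurv⟩ := exists_starCurve_family J.isOpen hI x₀ hn γ₀
    (u := fun t => shift (curvature (c t)) s) fun k =>
      (hc.jointC_curvature k).sub (jointC_const_of_contDiffOn le_rfl _)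
  have hcl : ∀ t ∈ J, IsSpectralCurve (c t) s (γ t).cls := fun t ht =>
    isSpectralCurve_of_curvature_eq hn (hcurv t ht)
  refine ⟨fun t => (γ t).cls, hcl,
    ⟨γ, fun j => jointC_iff_jointSmooth.1 (hγ j), fun _ _ => rfl⟩, ?_⟩
  refine isEvolutionOp_of_lift (γ := γ) (fun _ _ => rfl) (v := fun t k => w k t)
    (fun t ht k x => ?_) fun t ht j => ?_
  · have h1 := hasDerivAt_shift (hv t ht) (hasDerivAt_const t s) k x
    have h2 : shift (fun k => w k t) 0 k = w k t := by
      rw [shift, ite_self, map_zero, sub_zero]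
    rw [h2] at h1
    refine h1.congr_of_eventuallyEq ?_
    filter_upwards [J.isOpen.mem_nhds ht] with r hr
    rw [(hcl r hr).curvature_eq hn]
  · have hLs : Lop (γ t).cls = opL (shift (curvature (c t)) s) := by
      rw [Lop, (hcl t ht).curvature_eq hn]
    have h1 : (opL (curvature (c t))).1 ((γ t).1 j) = s • (γ t).1 j := by
      refine opL_apply_of_spectral hn ?_
      rw [← hLs]
      exact StarCurve.Lop_apply rfl j
    have h2 := laxDefect_apply_of_eigen (v := fun k => w k t) (B := X t) h1
    rw [hE t ht] at h2
    have h3 : polyOp 1 (fun _ => X) s t = X t := by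
      rw [polyOp, Finset.sum_range_one, pow_zero, one_smul]
    rw [h3, hLs, opL_shift hn]
    simp only [LinearMap.sub_apply, LinearMap.smul_apply, Module.End.one_apply]
    exact eq_neg_of_add_eq_zero_right h2.symm

theorem isIsospectral_iff (hI : (I : Set ℝ).OrdConnected) (hn : 0 < n)
    (x₀ : I) (hJ0 : (0 : ℝ) ∈ J) (hJ : (J : Set ℝ).OrdConnected) {c : ℝ → CentroAffine n I}
    (hc : IsAdmissible J c) :
    IsIsospectral J c ↔ ∃ B, IsGaugedKdVOp J (fun t => curvature (c t)) B ∧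
      LaxEq J (fun t => curvature (c t)) B := by
  constructor
  · rintro ⟨N, P, h⟩
    exact ⟨_, (h.iff_isGaugedKdVOp hI hn x₀ hJ0 hJ hc Set.infinite_univ).1
      fun s _ t _ => deriv_const t s⟩
  · rintro ⟨B, hB, hL⟩
    exact isIsospectral_of_laxEq hI hn x₀ hc hB hL

theorem isIsospectral_and_topCurvatureConst_iff (hI : (I : Set ℝ).OrdConnected) (hn : 0 < n)
    (x₀ : I) (hJ0 : (0 : ℝ) ∈ J) (hJ : (J : Set ℝ).OrdConnected) {c : ℝ → CentroAffine n I}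
    (hc : IsAdmissible J c) :
    IsIsospectral J c ∧ TopCurvatureConst J c ↔
      ∃ B, IsKdVOp J (fun t => curvature (c t)) B ∧ LaxEq J (fun t => curvature (c t)) B := by
  rw [isIsospectral_iff hI hn x₀ hJ0 hJ hc]
  constructor
  · rintro ⟨⟨B, hB, hL⟩, hT⟩
    exact ⟨B, (isKdVOp_iff_topCurvatureConst hI x₀ hn hJ hc hB hL).2 hT, hL⟩
  · rintro ⟨B, hK, hL⟩
    exact ⟨⟨B, hK.isGaugedKdVOp, hL⟩,
      (isKdVOp_iff_topCurvatureConst hI x₀ hn hJ hc hK.isGaugedKdVOp hL).1 hK⟩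

end Spectral

end StarShaped

end

/-! ### The main theorem -/

theorem theorem1 (n : ℕ) (hn : 2 ≤ n) (I : TopologicalSpace.Opens ℝ)
    (hI : (I : Set ℝ).OrdConnected) (hI₀ : (I : Set ℝ).Nonempty)
    (c₀ : StarShaped.CentroAffine n I) :
    -- (1) and (2)
    (∃ (_ : AddCommGroup (StarShaped.Tangent c₀))
        (_ : Module (StarShaped.Sm I) (StarShaped.Tangent c₀))
        (e : StarShaped.Tangent c₀ ≃ₗ[StarShaped.Sm I] (Fin n → StarShaped.Sm I))
        (Φ : (StarShaped.DMod c₀ ⧸ StarShaped.tangentKer c₀) ≃+ StarShaped.Tangent c₀),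
      -- the isomorphism with `𝓕^{1×n}` is the derivative of the curvature, and it is smooth
      (∀ (Γ : StarShaped.Deformation c₀) (k : Fin n) (x : I),
        HasDerivAt (fun t => (StarShaped.curvature (Γ.path t) k).1 x)
          ((e Γ.tangent k).1 x) 0) ∧
      (∀ (K : TopologicalSpace.Opens ℝ) (σ : ℝ → StarShaped.Tangent c₀),
        StarShaped.Tangent.IsSmoothCurve K σ ↔
          ∀ k, StarShaped.JointSmooth K fun s => e (σ s) k) ∧
      -- the identification with `𝓓ₓ/𝓓ₓL` modulo the kernel of the tangent vector mapping
      Submodule.span (StarShaped.DOp I) {StarShaped.coset c₀ 1} = ⊤ ∧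
      (∀ (r : ℝ) (q : StarShaped.DMod c₀ ⧸ StarShaped.tangentKer c₀),
        Φ (r • q) = algebraMap ℝ (StarShaped.Sm I) r • Φ q) ∧
      (∀ X : StarShaped.DOp I, ∃ Γ : StarShaped.Deformation c₀, Γ.IsInducedBy X) ∧
      (∀ (X : StarShaped.DOp I) (Γ : StarShaped.Deformation c₀), Γ.IsInducedBy X →
        Φ (Submodule.Quotient.mk (StarShaped.coset c₀ X)) = Γ.tangent) ∧
      -- the correspondence between `h` and `X`
      (∀ (X : StarShaped.DOp I) (h : Fin n → StarShaped.Sm I),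
        StarShaped.TangentEq c₀ X h ↔
          e (Φ (Submodule.Quotient.mk (StarShaped.coset c₀ X))) = h) ∧
      (∀ h : Fin n → StarShaped.Sm I, ∃ X, StarShaped.TangentEq c₀ X h) ∧
      (∀ (h : Fin n → StarShaped.Sm I) (X Y : StarShaped.DOp I),
        StarShaped.TangentEq c₀ X h →
          (StarShaped.TangentEq c₀ Y h ↔ StarShaped.TangentEq c₀ (X - Y) 0)) ∧
      (∀ X : StarShaped.DOp I,
        StarShaped.coset c₀ X ∈ StarShaped.tangentKer c₀ ↔ StarShaped.TangentEq c₀ X 0)) ∧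
    -- (3)
    (∀ J : TopologicalSpace.Opens ℝ, (0 : ℝ) ∈ J → (J : Set ℝ).OrdConnected →
      ∀ c : ℝ → StarShaped.CentroAffine n I, c 0 = c₀ →
        (StarShaped.IsAdmissible J c ↔
          (∃ γ γ', StarShaped.IsC1Lift J c γ γ') ∧
            ∃ X : ℝ → StarShaped.DOp I,
              StarShaped.SmoothOp J X ∧ StarShaped.IsEvolutionOp J c X)) ∧
    -- (4)
    (∀ J : TopologicalSpace.Opens ℝ, (0 : ℝ) ∈ J → (J : Set ℝ).OrdConnected →
      ∀ c : ℝ → StarShaped.CentroAffine n I, c 0 = c₀ → StarShaped.IsAdmissible J c →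
        (∀ (S : Set ℝ) (lam : ℝ → ℝ → ℝ) (N : ℕ) (P : ℕ → ℝ → StarShaped.DOp I),
          S.Infinite → StarShaped.IsSpectralDeformation J c S lam N P →
            ((∀ s ∈ S, ∀ t ∈ J, deriv (lam s) t = 0) ↔
              StarShaped.IsGaugedKdVOp J (fun t => StarShaped.curvature (c t))
                  (StarShaped.polyOpAtL N P c) ∧
                StarShaped.LaxEq J (fun t => StarShaped.curvature (c t))
                  (StarShaped.polyOpAtL N P c)) ∧
            ((∀ s ∈ S, ∀ t ∈ J, deriv (lam s) t = 0) ∧ StarShaped.TopCurvatureConst J c ↔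
              StarShaped.IsKdVOp J (fun t => StarShaped.curvature (c t))
                  (StarShaped.polyOpAtL N P c) ∧
                StarShaped.LaxEq J (fun t => StarShaped.curvature (c t))
                  (StarShaped.polyOpAtL N P c))) ∧
        (StarShaped.IsIsospectral J c ↔
          ∃ B, StarShaped.IsGaugedKdVOp J (fun t => StarShaped.curvature (c t)) B ∧
            StarShaped.LaxEq J (fun t => StarShaped.curvature (c t)) B) ∧
        (StarShaped.IsIsospectral J c ∧ StarShaped.TopCurvatureConst J c ↔
          ∃ B, StarShaped.IsKdVOp J (fun t => StarShaped.curvature (c t)) B ∧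
            StarShaped.LaxEq J (fun t => StarShaped.curvature (c t)) B)) := by
  have hn' : 0 < n := by omega
  obtain ⟨x₀, hx₀⟩ := id hI₀
  refine ⟨StarShaped.exists_tangentSpace_module n hn I hI hI₀ c₀, fun J _ _ c _ =>
    StarShaped.isAdmissible_iff_exists_isEvolutionOp hI hI₀ c, fun J hJ0 hJ c _ hc =>
    ⟨fun S lam N P hS h => ⟨h.iff_isGaugedKdVOp hI hn' ⟨x₀, hx₀⟩ hJ0 hJ hc hS,
      h.iff_isKdVOp hI hn' ⟨x₀, hx₀⟩ hJ0 hJ hc hS⟩,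
      StarShaped.isIsospectral_iff hI hn' ⟨x₀, hx₀⟩ hJ0 hJ hc,
      StarShaped.isIsospectral_and_topCurvatureConst_iff hI hn' ⟨x₀, hx₀⟩ hJ0 hJ hc⟩⟩
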